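/- For a commutative ring $R$, a homogeneous depth-three $\Sigma^{[s]}\Pi^{[k]}\Sigma$ circuit of degree $k$ over $R$ in the variables $x_1,\dots,x_n$ is given by the coefficients $a_{t,j,i}\in R$ of its linear forms and computes $$f=\sum_{t=1}^{s}\ \prod_{j=1}^{k}\ \Bigl(\sum_{i=1}^{n} a_{t,j,i}\,x_i\Bigr)\in R[x_1,\dots,x_n].$$ The problem $(k,n)$-MLC is to compute the sum of the coefficients of all degree-$k$ multilinear monomials of $f$. The problem $k$-MMD is to decide whether some degree-$k$ multilinear monomial has a nonzero coefficient in $f$. Algorithms are deterministic programs of a random access machine with cells for natural numbers (including all indices), charged by bit length, and cells for elements of $R$, on which it can perform $+,-,\cdot$ and zero tests. An operation on ring elements costs one step if $R$ is a field and unit cost is used; under bit cost (for $\mathbb Z$ and $\mathbb Q$) it is charged by the bit lengths of the numbers involved. The input consists of $n,k,s$ and all the $a_{t,j,i}$. Its size $N$ is $n+k+s$ under unit cost, and $n+k+s$ plus the total bit length of the $a_{t,j,i}$ under bit cost. $O^*(T)$ stands for $T\cdot N^{O(1)}$. Then: 1. There is a deterministic algorithm that solves $(k,n)$-MLC for homogeneous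 $\Sigma^{[s]}\Pi^{[k]}\Sigma$ circuits of degree $k$ in time $O^*(2^k)$. It is a single program that works over every field with unit cost for the field operations, and over $\mathbb Z$ and over $\mathbb Q$ with bit cost; the constants in the time bound are the same in all cases. 2. There is a deterministic algorithm that solves $k$-MMD for homogeneous $\Sigma^{[s]}\Pi^{[k]}\Sigma$ circuits of degree $k$ over $\mathbb Z$ in time $O^*(4^k)$, with bit cost. 3. There are a constant $c\le 5$ and a deterministic algorithm that solves $k$-MMD for homogeneous $\Sigma^{[s]}\Pi^{[k]}\Sigma$ circuits of degree $k$ over finite fields in time $e^k\,k^{O(\log k)}\,(2^{ck}+2^k)\cdot\mathrm{poly}(n,k,s)$, with unit cost for the field operations. The program, $c$ and the implied constants do not depend on the field. -/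

import Mathlib

/-! ### Depth-three circuits and the two problems -/

/-- A homogeneous depth-three circuit of degree `k` over `n` variables: a top sum gate of fan-in `s`
over product gates, each of which multiplies `k` homogeneous linear forms.
`form t j i` is the coefficient of the variable `i` in the `j`-th linear form of the `t`-th product. -/
structure DepthThreeCircuit (R : Type*) (n k s : ℕ) where
  form : Fin s → Fin k → Fin n → R

/-- The polynomial computed by the circuit. -/
noncomputable def DepthThreeCircuit.poly {R : Type*} [CommRing R] {n k s : ℕ}
    (C : DepthThreeCircuit R n k s) : MvPolynomial (Fin n) R :=
  ∑ t : Fin s, ∏ j : Fin k, ∑ i : Fin n, MvPolynomial.C (C.form t j i) * MvPolynomial.X i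

/-- The size of the input: the number of variables, the degree, the top fan-in and the sizes of all
the coefficients, where `w` measures the size of a ring element. -/
def DepthThreeCircuit.inputSize {R : Type*} {n k s : ℕ} (w : R → ℕ)
    (C : DepthThreeCircuit R n k s) : ℕ :=
  n + k + s + ∑ t : Fin s, ∑ j : Fin k, ∑ i : Fin n, w (C.form t j i)

/-- `m` is (the exponent vector of) a multilinear monomial of degree `k`. -/
def IsMultilinearMonomial {n : ℕ} (k : ℕ) (m : Fin n →₀ ℕ) : Prop :=
  (∀ i, m i ≤ 1) ∧ m.degree = k

open Classical in
/-- The value asked for by the multilinear counting problem: the sum of the coefficients of all the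
degree-`k` multilinear monomials of `f`. -/
noncomputable def multilinearCoeffSum {R : Type*} [CommRing R] {n : ℕ} (k : ℕ)
    (f : MvPolynomial (Fin n) R) : R :=
  ∑ m ∈ f.support with IsMultilinearMonomial k m, f.coeff m

/-- The question of the multilinear monomial detection problem: does `f` have a degree-`k`
multilinear monomial with nonzero coefficient? -/
def HasMultilinearMonomial {R : Type*} [CommRing R] {n : ℕ} (k : ℕ)
    (f : MvPolynomial (Fin n) R) : Prop :=
  ∃ m : Fin n →₀ ℕ, IsMultilinearMonomial k m ∧ f.coeff m ≠ 0

/-! ### The machine model: a random access machine over a ring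

The memory consists of arrays of natural numbers and arrays of ring elements. Arrays have fixed
names (natural numbers written in the program) and unbounded length, and their indices are computed
at run time. A program is a finite text that does not depend on the ring. Operations on natural
numbers (also those on indices) are charged by the bit lengths of the numbers involved; operations
on ring elements are charged by the size `w` of the elements involved, plus one. -/

/-- Expressions for natural numbers. -/
inductive NumExpr : Type
  | lit (c : ℕ)
  | read (a : ℕ) (i : NumExpr)
  | add (x y : NumExpr)
  | sub (x y : NumExpr)
  | mul (x y : NumExpr)
  | div (x y : NumExpr)
  | mod (x y : NumExpr)

/-- Expressions for ring elements. -/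
inductive EltExpr : Type
  | zero
  | one
  | read (a : ℕ) (i : NumExpr)
  | add (x y : EltExpr)
  | sub (x y : EltExpr)
  | mul (x y : EltExpr)

/-- Tests: comparison of natural numbers and zero test of ring elements. -/
inductive Test : Type
  | eq (x y : NumExpr)
  | lt (x y : NumExpr)
  | isZero (x : EltExpr)

/-- Programs. -/
inductive Program : Type
  | skip
  | setNum (a : ℕ) (i : NumExpr) (x : NumExpr)
  | setElt (a : ℕ) (i : NumExpr) (x : EltExpr)
  | seq (p q : Program)
  | branch (b : Test) (p q : Program)
  | loop (b : Test) (p : Program)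

/-- The memory: `num a i` is cell `i` of the `a`-th array of natural numbers, and `elt a i` is
cell `i` of the `a`-th array of ring elements. -/
@[ext]
structure Memory (R : Type*) where
  num : ℕ → ℕ → ℕ
  elt : ℕ → ℕ → R

/-- Write a natural number to one cell. -/
def Memory.setNum {R : Type*} (σ : Memory R) (a i v : ℕ) : Memory R :=
  { σ with num := Function.update σ.num a (Function.update (σ.num a) i v) }

/-- Write a ring element to one cell. -/
def Memory.setElt {R : Type*} (σ : Memory R) (a i : ℕ) (v : R) : Memory R :=
  { σ with elt := Function.update σ.elt a (Function.update (σ.elt a) i v) }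

/-- The value of an expression. -/
def NumExpr.eval {R : Type*} (σ : Memory R) : NumExpr → ℕ
  | lit c => c
  | read a i => σ.num a (i.eval σ)
  | add x y => x.eval σ + y.eval σ
  | sub x y => x.eval σ - y.eval σ
  | mul x y => x.eval σ * y.eval σ
  | div x y => x.eval σ / y.eval σ
  | mod x y => x.eval σ % y.eval σ

/-- The time for evaluating an expression (`Nat.size` is the bit length). -/
def NumExpr.cost {R : Type*} (σ : Memory R) : NumExpr → ℕ
  | lit c => 1 + c.size
  | read a i => i.cost σ + 1 + (i.eval σ).size + (σ.num a (i.eval σ)).size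
  | add x y => x.cost σ + y.cost σ + 1 + (x.eval σ).size + (y.eval σ).size
  | sub x y => x.cost σ + y.cost σ + 1 + (x.eval σ).size + (y.eval σ).size
  | mul x y => x.cost σ + y.cost σ + 1 + (x.eval σ).size + (y.eval σ).size
  | div x y => x.cost σ + y.cost σ + 1 + (x.eval σ).size + (y.eval σ).size
  | mod x y => x.cost σ + y.cost σ + 1 + (x.eval σ).size + (y.eval σ).size

/-- The value of an expression. -/
def EltExpr.eval {R : Type*} [CommRing R] (σ : Memory R) : EltExpr → R
  | zero => 0
  | one => 1
  | read a i => σ.elt a (i.eval σ)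
  | add x y => x.eval σ + y.eval σ
  | sub x y => x.eval σ - y.eval σ
  | mul x y => x.eval σ * y.eval σ

/-- The time for evaluating an expression. -/
def EltExpr.cost {R : Type*} [CommRing R] (w : R → ℕ) (σ : Memory R) : EltExpr → ℕ
  | zero => 1
  | one => 1
  | read a i => i.cost σ + 1 + (i.eval σ).size + w (σ.elt a (i.eval σ))
  | add x y => x.cost w σ + y.cost w σ + 1 + w (x.eval σ) + w (y.eval σ)
  | sub x y => x.cost w σ + y.cost w σ + 1 + w (x.eval σ) + w (y.eval σ)
  | mul x y => x.cost w σ + y.cost w σ + 1 + w (x.eval σ) + w (y.eval σ)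

/-- The outcome of a test. -/
def Test.holds {R : Type*} [CommRing R] (σ : Memory R) : Test → Prop
  | eq x y => x.eval σ = y.eval σ
  | lt x y => x.eval σ < y.eval σ
  | isZero x => x.eval σ = 0

/-- The time for a test. -/
def Test.cost {R : Type*} [CommRing R] (w : R → ℕ) (σ : Memory R) : Test → ℕ
  | eq x y => x.cost σ + y.cost σ + 1 + (x.eval σ).size + (y.eval σ).size
  | lt x y => x.cost σ + y.cost σ + 1 + (x.eval σ).size + (y.eval σ).size
  | isZero x => x.cost w σ + 1 + w (x.eval σ)

/-- `Exec w p σ τ t`: the program `p`, started on the memory `σ`, halts after `t` time steps with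
the memory `τ`. -/
inductive Exec {R : Type*} [CommRing R] (w : R → ℕ) :
    Program → Memory R → Memory R → ℕ → Prop
  | skip (σ : Memory R) : Exec w Program.skip σ σ 1
  | setNum (a : ℕ) (i x : NumExpr) (σ : Memory R) :
      Exec w (Program.setNum a i x) σ (σ.setNum a (i.eval σ) (x.eval σ))
        (i.cost σ + x.cost σ + 1 + (i.eval σ).size + (x.eval σ).size)
  | setElt (a : ℕ) (i : NumExpr) (x : EltExpr) (σ : Memory R) :
      Exec w (Program.setElt a i x) σ (σ.setElt a (i.eval σ) (x.eval σ))
        (i.cost σ + x.cost w σ + 1 + (i.eval σ).size + w (x.eval σ))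
  | seq {p q : Program} {σ τ υ : Memory R} {t u : ℕ} :
      Exec w p σ τ t → Exec w q τ υ u → Exec w (Program.seq p q) σ υ (t + u)
  | branchTrue {b : Test} {p q : Program} {σ τ : Memory R} {t : ℕ} :
      b.holds σ → Exec w p σ τ t → Exec w (Program.branch b p q) σ τ (b.cost w σ + t)
  | branchFalse {b : Test} {p q : Program} {σ τ : Memory R} {t : ℕ} :
      ¬ b.holds σ → Exec w q σ τ t → Exec w (Program.branch b p q) σ τ (b.cost w σ + t)
  | loopDone {b : Test} {p : Program} {σ : Memory R} :
      ¬ b.holds σ → Exec w (Program.loop b p) σ σ (b.cost w σ)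
  | loopStep {b : Test} {p : Program} {σ τ υ : Memory R} {t u : ℕ} :
      b.holds σ → Exec w p σ τ t → Exec w (Program.loop b p) τ υ u →
        Exec w (Program.loop b p) σ υ (b.cost w σ + t + u)

/-- The machine is deterministic: the final memory and the running time are determined by the
program and the initial memory. -/
theorem Exec.deterministic {R : Type*} [CommRing R] {w : R → ℕ} {p : Program}
    {σ τ τ' : Memory R} {t t' : ℕ} (h : Exec w p σ τ t) (h' : Exec w p σ τ' t') :
    τ = τ' ∧ t = t' := by
  induction h generalizing τ' t' with
  | skip => cases h'; exact ⟨rfl, rfl⟩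
  | setNum => cases h'; exact ⟨rfl, rfl⟩
  | setElt => cases h'; exact ⟨rfl, rfl⟩
  | seq _ _ ih₁ ih₂ =>
    cases h' with
    | seq h₁ h₂ =>
      obtain ⟨rfl, rfl⟩ := ih₁ h₁
      obtain ⟨rfl, rfl⟩ := ih₂ h₂
      exact ⟨rfl, rfl⟩
  | branchTrue hb _ ih =>
    cases h' with
    | branchTrue _ h₁ => obtain ⟨rfl, rfl⟩ := ih h₁; exact ⟨rfl, rfl⟩
    | branchFalse hn => exact absurd hb hn
  | branchFalse hb _ ih =>
    cases h' with
    | branchTrue hn => exact absurd hn hb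
    | branchFalse _ h₁ => obtain ⟨rfl, rfl⟩ := ih h₁; exact ⟨rfl, rfl⟩
  | loopDone hb =>
    cases h' with
    | loopDone => exact ⟨rfl, rfl⟩
    | loopStep hn => exact absurd hn hb
  | loopStep hb _ _ ih₁ ih₂ =>
    cases h' with
    | loopDone hn => exact absurd hb hn
    | loopStep _ h₁ h₂ =>
      obtain ⟨rfl, rfl⟩ := ih₁ h₁
      obtain ⟨rfl, rfl⟩ := ih₂ h₂
      exact ⟨rfl, rfl⟩

/-- The initial memory: cells 0, 1, 2 of the number array 0 hold `n`, `k`, `s`; cell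
`(t * k + j) * n + i` of the element array 0 holds the coefficient `form t j i`; all else is 0. -/
def DepthThreeCircuit.inputMemory {R : Type*} [CommRing R] {n k s : ℕ}
    (C : DepthThreeCircuit R n k s) : Memory R where
  num a i := if a = 0 ∧ i = 0 then n else if a = 0 ∧ i = 1 then k
    else if a = 0 ∧ i = 2 then s else 0
  elt a c := if h : a = 0 ∧ c / n / k < s ∧ c / n % k < k ∧ c % n < n then
    C.form ⟨c / n / k, h.2.1⟩ ⟨c / n % k, h.2.2.1⟩ ⟨c % n, h.2.2.2⟩ else 0

/-- On the circuit `C`, the program halts within time `T` and leaves the sum of the coefficients of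
the degree-`k` multilinear monomials in cell 0 of the element array 1. -/
def ComputesMLC {R : Type*} [CommRing R] {n k s : ℕ} (w : R → ℕ) (P : Program)
    (C : DepthThreeCircuit R n k s) (T : ℝ) : Prop :=
  ∃ (τ : Memory R) (t : ℕ), Exec w P C.inputMemory τ t ∧ (t : ℝ) ≤ T ∧
    τ.elt 1 0 = multilinearCoeffSum k C.poly

/-- On the circuit `C`, the program halts within time `T` and leaves in cell 0 of the number array 1
the answer (1 for yes and 0 for no) to the question whether there is a degree-`k` multilinear
monomial with nonzero coefficient. -/
def DecidesMMD {R : Type*} [CommRing R] {n k s : ℕ} (w : R → ℕ) (P : Program)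
    (C : DepthThreeCircuit R n k s) (T : ℝ) : Prop :=
  ∃ (τ : Memory R) (t : ℕ), Exec w P C.inputMemory τ t ∧ (t : ℝ) ≤ T ∧
    (HasMultilinearMonomial k C.poly → τ.num 1 0 = 1) ∧
    (¬ HasMultilinearMonomial k C.poly → τ.num 1 0 = 0)

/-- Size 0 for all ring elements: every ring operation is charged as one step. -/
def unitSize {R : Type*} (_ : R) : ℕ := 0

/-- The number of bits of an integer (with its sign). -/
def intSize (a : ℤ) : ℕ := a.natAbs.size + 1

/-- The number of bits of a rational number in lowest terms. -/
def ratSize (a : ℚ) : ℕ := intSize a.num + a.den.size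

/-! The coefficient of the monomial `x_S` in a product of linear forms satisfies a recursion. If `i
∉ S`, differentiating by `x_i` and applying the Leibniz rule removes one form at a time: the
coefficient of `x_i x_S` in the product over `T` is the sum over `j ∈ T` of `A j i` times the
coefficient of `x_S` in the product over `T \ {j}` (`formProdCoeff_insert`). No factorials arise, so
this holds over every commutative ring. All three algorithms are dynamic programs over the variables
built on this recursion, with sets of forms coded by bit strings.

Counting: summing over all `S` among the first `i` variables gives a table indexed by the `2 ^ k`
sets `T` (`DepthThreeCircuit.countDP_eq`); its last entry, added up over the `s` products, is the
answer.

Detection over the integers: all coefficients vanish iff the sum of their squares does. A square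
expands into products of coefficients from two product gates, and the recursion runs on pairs of
sets, with `4 ^ k` states (`DepthThreeCircuit.pairDP_eq`).

Detection over fields: for fixed `S`, the coefficients of `x_S` in all subproducts form a vector
with `N = s * 2 ^ k` entries, and adding a variable to `S` acts on it by a linear map that does not
depend on `S`. Hence the span `V` of the vectors for the first `i` variables becomes `V + M_i V`,
and an echelon system of at most `N` nonzero rows represents it. A multilinear monomial exists iff
the linear functional that adds up the entries of the full products is nonzero on the final span.
Elimination takes about `N ^ 3` operations per variable, which gives `8 ^ k`, that is `c = 3`. Spans
are compared through the functionals vanishing on them.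

Running times come from a small program logic, `Runs`: a bound `X` on the number of rounds is
tracked, while the cost of a single step is bounded by a weight read off the program text times a
bound on the bit lengths. Over `ℤ` and `ℚ` the latter comes from writing all coefficients over one
common denominator, so that bit lengths grow only linearly with the number of variables treated
(`subsetDP_size_le`). -/

/-! ### Costs of expressions and tests -/

/-- A size measure on ring elements which grows at most by a constant factor under the ring
operations. -/
structure IsTameSize {R : Type*} [CommRing R] (w : R → ℕ) : Prop where
  zero : w 0 ≤ 3
  one : w 1 ≤ 3
  add : ∀ x y, w (x + y) ≤ 2 * (w x + w y + 1)
  sub : ∀ x y, w (x - y) ≤ 2 * (w x + w y + 1)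
  mul : ∀ x y, w (x * y) ≤ 2 * (w x + w y + 1)

/-- All numbers in the memory have at most `L` bits and all ring elements have size at most `W`. -/
structure Memory.Bounded {R : Type*} (w : R → ℕ) (L W : ℕ) (σ : Memory R) : Prop where
  num : ∀ a i, σ.num a i < 2 ^ L
  elt : ∀ a i, w (σ.elt a i) ≤ W

/-- A factor that depends only on the text of the expression and bounds its cost. -/
def NumExpr.weight : NumExpr → ℕ
  | lit c => 1 + c.size
  | read _ i => 2 * i.weight + 1
  | add x y => 2 * (x.weight + y.weight) + 1
  | sub x y => 2 * (x.weight + y.weight) + 1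
  | mul x y => 2 * (x.weight + y.weight) + 1
  | div x y => 2 * (x.weight + y.weight) + 1
  | mod x y => 2 * (x.weight + y.weight) + 1

/-- A factor that depends only on the text of the expression and bounds its cost. -/
def EltExpr.weight : EltExpr → ℕ
  | zero => 3
  | one => 3
  | read _ i => 2 * i.weight + 1
  | add x y => 2 * (x.weight + y.weight + 1)
  | sub x y => 2 * (x.weight + y.weight + 1)
  | mul x y => 2 * (x.weight + y.weight + 1)

/-- A factor that depends only on the text of the test and bounds its cost. -/
def Test.weight : Test → ℕ
  | eq x y => 2 * (x.weight + y.weight) + 1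
  | lt x y => 2 * (x.weight + y.weight) + 1
  | isZero x => 2 * x.weight + 1

/-- A factor that depends only on the text of the program and bounds the cost of each of its steps. -/
def Program.weight : Program → ℕ
  | skip => 1
  | setNum _ i x => 2 * (i.weight + x.weight) + 1
  | setElt _ i x => 2 * (i.weight + x.weight) + 1
  | seq p q => p.weight + q.weight
  | branch b p q => b.weight + p.weight + q.weight
  | loop b p => b.weight + p.weight

theorem Nat.size_add_le (x y : ℕ) : (x + y).size ≤ x.size + y.size + 1 := by
  rw [Nat.size_le]
  have hx := Nat.lt_size_self x
  have hy := Nat.lt_size_self y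
  have h1 : 2 ^ x.size ≤ 2 ^ (x.size + y.size) := Nat.pow_le_pow_right (by simp) (by omega)
  have h2 : 2 ^ y.size ≤ 2 ^ (x.size + y.size) := Nat.pow_le_pow_right (by simp) (by omega)
  rw [pow_succ]
  omega

theorem Nat.size_mul_le (x y : ℕ) : (x * y).size ≤ x.size + y.size := by
  rw [Nat.size_le, pow_add]
  exact Nat.mul_lt_mul'' (Nat.lt_size_self x) (Nat.lt_size_self y)

/-- The cost of an operation includes the sizes of its operands, so both bounds must go through the
induction together. Multiplication at worst adds bit lengths; truncated subtraction, division and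
remainder never exceed the left operand. -/
theorem NumExpr.size_le_and_cost_le {R : Type*} {w : R → ℕ} {L W : ℕ}
    {σ : Memory R} (hσ : σ.Bounded w L W) (e : NumExpr) :
    (e.eval σ).size ≤ e.weight * (L + W + 1) ∧ e.cost σ ≤ e.weight * (L + W + 1) := by
  have aux : ∀ x y c z u v : ℕ, x ≤ u * (L + W + 1) ∧ c ≤ u * (L + W + 1) →
      y ≤ v * (L + W + 1) ∧ z ≤ v * (L + W + 1) →
      c + z + 1 + x + y ≤ (2 * (u + v) + 1) * (L + W + 1) := by
    intro x y c z u v h h'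
    nlinarith
  have aux' : ∀ x y r u v : ℕ, x ≤ u * (L + W + 1) → y ≤ v * (L + W + 1) →
      r ≤ x + y + 1 → r ≤ (2 * (u + v) + 1) * (L + W + 1) := by
    intro x y r u v h h' h''
    nlinarith
  induction e with
  | lit c =>
    simp only [eval, cost, weight]
    constructor <;> nlinarith
  | read a i ih =>
    have := Nat.size_le.2 (hσ.num a (i.eval σ))
    obtain ⟨h, h'⟩ := ih
    simp only [eval, cost, weight]
    constructor <;> nlinarith
  | add x y hx hy =>
    exact ⟨aux' _ _ _ _ _ hx.1 hy.1 (Nat.size_add_le _ _), aux _ _ _ _ _ _ hx hy⟩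
  | sub x y hx hy =>
    exact ⟨aux' _ _ _ _ _ hx.1 hy.1
      ((Nat.size_le_size (Nat.sub_le _ _)).trans (by omega)), aux _ _ _ _ _ _ hx hy⟩
  | mul x y hx hy =>
    exact ⟨aux' _ _ _ _ _ hx.1 hy.1 ((Nat.size_mul_le _ _).trans (by omega)),
      aux _ _ _ _ _ _ hx hy⟩
  | div x y hx hy =>
    exact ⟨aux' _ _ _ _ _ hx.1 hy.1
      ((Nat.size_le_size (Nat.div_le_self _ _)).trans (by omega)), aux _ _ _ _ _ _ hx hy⟩
  | mod x y hx hy =>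
    exact ⟨aux' _ _ _ _ _ hx.1 hy.1
      ((Nat.size_le_size (Nat.mod_le _ _)).trans (by omega)), aux _ _ _ _ _ _ hx hy⟩

section Costs

variable {R : Type*} [CommRing R] {w : R → ℕ} {L W : ℕ} {σ : Memory R}

/-- Tameness lets every operation enlarge sizes by a constant factor only; the compounded factor
depends on the nesting of the expression and is absorbed in its weight. -/
theorem EltExpr.size_le_and_cost_le (hw : IsTameSize w) (hσ : σ.Bounded w L W) (e : EltExpr) :
    w (e.eval σ) ≤ e.weight * (L + W + 1) ∧ e.cost w σ ≤ e.weight * (L + W + 1) := by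
  have aux : ∀ x y c z u v : ℕ, x ≤ u * (L + W + 1) ∧ c ≤ u * (L + W + 1) →
      y ≤ v * (L + W + 1) ∧ z ≤ v * (L + W + 1) →
      c + z + 1 + x + y ≤ (2 * (u + v + 1)) * (L + W + 1) := by
    intro x y c z u v h h'
    nlinarith
  have aux' : ∀ x y r u v : ℕ, x ≤ u * (L + W + 1) → y ≤ v * (L + W + 1) →
      r ≤ 2 * (x + y + 1) → r ≤ (2 * (u + v + 1)) * (L + W + 1) := by
    intro x y r u v h h' h''
    nlinarith
  induction e with
  | zero =>
    have := hw.zero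
    simp only [eval, cost, weight]
    constructor <;> omega
  | one =>
    have := hw.one
    simp only [eval, cost, weight]
    constructor <;> omega
  | read a i =>
    have := hσ.elt a (i.eval σ)
    have := i.size_le_and_cost_le hσ
    simp only [eval, cost, weight]
    constructor <;> nlinarith
  | add x y hx hy =>
    exact ⟨aux' _ _ _ _ _ hx.1 hy.1 (hw.add _ _), aux _ _ _ _ _ _ hx hy⟩
  | sub x y hx hy =>
    exact ⟨aux' _ _ _ _ _ hx.1 hy.1 (hw.sub _ _), aux _ _ _ _ _ _ hx hy⟩
  | mul x y hx hy =>
    exact ⟨aux' _ _ _ _ _ hx.1 hy.1 (hw.mul _ _), aux _ _ _ _ _ _ hx hy⟩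

theorem Test.cost_le (hw : IsTameSize w) (hσ : σ.Bounded w L W) (b : Test) :
    b.cost w σ ≤ b.weight * (L + W + 1) := by
  cases b with
  | eq x y =>
    have := x.size_le_and_cost_le hσ
    have := y.size_le_and_cost_le hσ
    simp only [cost, weight]
    nlinarith
  | lt x y =>
    have := x.size_le_and_cost_le hσ
    have := y.size_le_and_cost_le hσ
    simp only [cost, weight]
    nlinarith
  | isZero x =>
    have := x.size_le_and_cost_le hw hσ
    simp only [cost, weight]
    nlinarith

end Costs

/-! ### Memory access -/

section Memory

variable {R : Type*} (σ : Memory R) (a b i j v : ℕ) (x : R)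

@[simp]
theorem Memory.setNum_num :
    (σ.setNum a i v).num b j = if b = a ∧ j = i then v else σ.num b j := by
  by_cases h : b = a
  · subst h
    by_cases h' : j = i
    · subst h'; simp [Memory.setNum]
    · simp [Memory.setNum, h']
  · simp [Memory.setNum, h]

@[simp]
theorem Memory.setNum_elt : (σ.setNum a i v).elt = σ.elt := rfl

@[simp]
theorem Memory.setElt_num : (σ.setElt a i x).num = σ.num := rfl

@[simp]
theorem Memory.setElt_elt :
    (σ.setElt a i x).elt b j = if b = a ∧ j = i then x else σ.elt b j := by
  by_cases h : b = a
  · subst h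
    by_cases h' : j = i
    · subst h'; simp [Memory.setElt]
    · simp [Memory.setElt, h']
  · simp [Memory.setElt, h]

variable {σ a i v x} {w : R → ℕ} {L W : ℕ}

theorem Memory.Bounded.setNum (h : σ.Bounded w L W) (hv : v < 2 ^ L) :
    (σ.setNum a i v).Bounded w L W :=
  ⟨fun b j => by rw [Memory.setNum_num]; split_ifs; exacts [hv, h.num b j], h.elt⟩

theorem Memory.Bounded.setElt (h : σ.Bounded w L W) (hx : w x ≤ W) :
    (σ.setElt a i x).Bounded w L W :=
  ⟨h.num, fun b j => by rw [Memory.setElt_elt]; split_ifs; exacts [hx, h.elt b j]⟩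

end Memory

/-! ### The arrays changed by a program -/

/-- The arrays of numbers that the program writes to. -/
def Program.numWrites : Program → List ℕ
  | skip => []
  | setNum a _ _ => [a]
  | setElt _ _ _ => []
  | seq p q => p.numWrites ++ q.numWrites
  | branch _ p q => p.numWrites ++ q.numWrites
  | loop _ p => p.numWrites

/-- The arrays of ring elements that the program writes to. -/
def Program.eltWrites : Program → List ℕ
  | skip => []
  | setNum _ _ _ => []
  | setElt a _ _ => [a]
  | seq p q => p.eltWrites ++ q.eltWrites
  | branch _ p q => p.eltWrites ++ q.eltWrites
  | loop _ p => p.eltWrites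

/-- The memories agree on all the arrays outside the two lists. -/
structure Memory.AgreeOff {R : Type*} (l m : List ℕ) (σ τ : Memory R) : Prop where
  num : ∀ a, a ∉ l → τ.num a = σ.num a
  elt : ∀ a, a ∉ m → τ.elt a = σ.elt a

section Agree

variable {R : Type*} {l l' m m' : List ℕ} {σ τ υ : Memory R}

theorem Memory.AgreeOff.refl : Memory.AgreeOff l m σ σ := ⟨fun _ _ => rfl, fun _ _ => rfl⟩

theorem Memory.AgreeOff.trans (h : Memory.AgreeOff l m σ τ) (h' : Memory.AgreeOff l m τ υ) :
    Memory.AgreeOff l m σ υ :=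
  ⟨fun a ha => (h'.num a ha).trans (h.num a ha), fun a ha => (h'.elt a ha).trans (h.elt a ha)⟩

theorem Memory.AgreeOff.mono (h : Memory.AgreeOff l m σ τ) (hl : l ⊆ l') (hm : m ⊆ m') :
    Memory.AgreeOff l' m' σ τ :=
  ⟨fun a ha => h.num a fun h' => ha (hl h'), fun a ha => h.elt a fun h' => ha (hm h')⟩

theorem Memory.AgreeOff.setNum (h : Memory.AgreeOff l m σ τ) {a i v : ℕ} (ha : a ∈ l) :
    Memory.AgreeOff l m σ (τ.setNum a i v) :=
  ⟨fun b hb => by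
    have : b ≠ a := fun h' => hb (h' ▸ ha)
    rw [← h.num b hb]; funext j; simp [this], h.elt⟩

theorem Memory.AgreeOff.setElt (h : Memory.AgreeOff l m σ τ) {a i : ℕ} {x : R} (ha : a ∈ m) :
    Memory.AgreeOff l m σ (τ.setElt a i x) :=
  ⟨h.num, fun b hb => by
    have : b ≠ a := fun h' => hb (h' ▸ ha)
    rw [← h.elt b hb]; funext j; simp [this]⟩

/-- A frame property read off the text: loop invariants need to mention only arrays that the loop
body writes to. -/
theorem Exec.agreeOff [CommRing R] {w : R → ℕ} {p : Program} {t : ℕ} (h : Exec w p σ τ t) :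
    Memory.AgreeOff p.numWrites p.eltWrites σ τ := by
  induction h with
  | skip σ => exact .refl
  | setNum a i x σ => exact Memory.AgreeOff.refl.setNum (by simp [Program.numWrites])
  | setElt a i x σ => exact Memory.AgreeOff.refl.setElt (by simp [Program.eltWrites])
  | seq _ _ h h' =>
    exact (h.mono (by simp [Program.numWrites]) (by simp [Program.eltWrites])).trans
      (h'.mono (by simp [Program.numWrites]) (by simp [Program.eltWrites]))
  | branchTrue _ _ h =>
    exact h.mono (by simp [Program.numWrites]) (by simp [Program.eltWrites])
  | branchFalse _ _ h =>
    exact h.mono (by simp [Program.numWrites]) (by simp [Program.eltWrites])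
  | loopDone _ => exact .refl
  | loopStep _ _ _ h h' => exact .trans h h'

end Agree

/-! ### Verification of programs with time bounds -/

/-- From a memory with bounded cells, the program halts in time at most `X` times a factor depending
only on its text and the cell bounds; the cells stay bounded and the final memory satisfies `Q`. -/
def Runs {R : Type*} [CommRing R] (w : R → ℕ) (L W : ℕ) (p : Program) (X : ℕ) (σ : Memory R)
    (Q : Memory R → Prop) : Prop :=
  σ.Bounded w L W → ∃ (τ : Memory R) (t : ℕ), Exec w p σ τ t ∧ t ≤ p.weight * X * (L + W + 1) ∧
    τ.Bounded w L W ∧ Q τ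

/-- The scalar variable stored in cell 0 of the array `a` of numbers. -/
abbrev NumExpr.var (a : ℕ) : NumExpr := .read a (.lit 0)

/-- Run the body with the variable `v` ranging over the numbers below the value of the
variable `b`. -/
def Program.forLoop (v b : ℕ) (p : Program) : Program :=
  .seq (.setNum v (.lit 0) (.lit 0))
    (.loop (.lt (.var v) (.var b)) (.seq p (.setNum v (.lit 0) (.add (.var v) (.lit 1)))))

section Rules

variable {R : Type*} [CommRing R] {w : R → ℕ} {L W X : ℕ} {p q : Program} {σ : Memory R}
  {Q S : Memory R → Prop}

/-- The consequence rule; it also supplies the frame property for use in the new postcondition. -/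
theorem Runs.mono (h : Runs w L W p X σ Q) {Y : ℕ} (hXY : X ≤ Y)
    (hQ : ∀ τ, Memory.AgreeOff p.numWrites p.eltWrites σ τ → Q τ → S τ) :
    Runs w L W p Y σ S := by
  intro hb
  obtain ⟨τ, t, he, ht, hb', hq⟩ := h hb
  exact ⟨τ, t, he, ht.trans (by gcongr), hb', hQ τ he.agreeOff hq⟩

/-- Since weights add, both parts may share the same `X`; only loops change the count. -/
theorem Runs.seq (hp : Runs w L W p X σ Q)
    (hq : ∀ τ, Memory.AgreeOff p.numWrites p.eltWrites σ τ → Q τ → Runs w L W q X τ S) :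
    Runs w L W (.seq p q) X σ S := by
  intro hb
  obtain ⟨τ, t, he, ht, hb', hq'⟩ := hp hb
  obtain ⟨υ, u, he', hu, hb'', hs⟩ := hq τ he.agreeOff hq' hb'
  refine ⟨υ, t + u, .seq he he', ?_, hb'', hs⟩
  simp only [Program.weight, add_mul]
  exact add_le_add ht hu

theorem Runs.skip (hX : 1 ≤ X) (hQ : Q σ) : Runs w L W .skip X σ Q := by
  intro hb
  refine ⟨σ, 1, .skip σ, ?_, hb, hQ⟩
  simp only [Program.weight]
  nlinarith

theorem Runs.setNum {a : ℕ} {i x : NumExpr} (hX : 1 ≤ X)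
    (hx : x.eval σ < 2 ^ L) (hQ : Q (σ.setNum a (i.eval σ) (x.eval σ))) :
    Runs w L W (.setNum a i x) X σ Q := by
  intro hb
  refine ⟨_, _, .setNum a i x σ, ?_, hb.setNum hx, hQ⟩
  have h1 := i.size_le_and_cost_le hb
  have h2 := x.size_le_and_cost_le hb
  simp only [Program.weight]
  calc _ ≤ (2 * (i.weight + x.weight) + 1) * 1 * (L + W + 1) := by nlinarith
    _ ≤ _ := by gcongr

theorem Runs.setElt {a : ℕ} {i : NumExpr} {x : EltExpr} (hw : IsTameSize w) (hX : 1 ≤ X)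
    (hx : w (x.eval σ) ≤ W) (hQ : Q (σ.setElt a (i.eval σ) (x.eval σ))) :
    Runs w L W (.setElt a i x) X σ Q := by
  intro hb
  refine ⟨_, _, .setElt a i x σ, ?_, hb.setElt hx, hQ⟩
  have h1 := i.size_le_and_cost_le hb
  have h2 := x.size_le_and_cost_le hw hb
  simp only [Program.weight]
  calc _ ≤ (2 * (i.weight + x.weight) + 1) * 1 * (L + W + 1) := by nlinarith
    _ ≤ _ := by gcongr

theorem Runs.branch {b : Test} (hw : IsTameSize w) (hX : 1 ≤ X)
    (hp : b.holds σ → Runs w L W p X σ Q) (hq : ¬ b.holds σ → Runs w L W q X σ Q) :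
    Runs w L W (.branch b p q) X σ Q := by
  intro hb
  have hc : b.cost w σ ≤ b.weight * X * (L + W + 1) :=
    (b.cost_le hw hb).trans (by gcongr; exact Nat.le_mul_of_pos_right _ hX)
  by_cases h : b.holds σ
  · obtain ⟨τ, t, he, ht, hb', hq'⟩ := hp h hb
    refine ⟨τ, _, .branchTrue h he, ?_, hb', hq'⟩
    simp only [Program.weight, add_mul]
    omega
  · obtain ⟨τ, t, he, ht, hb', hq'⟩ := hq h hb
    refine ⟨τ, _, .branchFalse h he, ?_, hb', hq'⟩
    simp only [Program.weight, add_mul]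
    omega

/-- The factor is `m + 1` because the test is evaluated once more than the body. -/
theorem Runs.loop {b : Test} (hw : IsTameSize w) (hX : 1 ≤ X) {m : ℕ} {I : ℕ → Memory R → Prop}
    (h0 : I 0 σ) (hm : ∀ τ, I m τ → ¬ b.holds τ) (hb : ∀ i < m, ∀ τ, I i τ → b.holds τ)
    (hp : ∀ i < m, ∀ τ, I i τ → Runs w L W p X τ (I (i + 1))) :
    Runs w L W (.loop b p) ((m + 1) * X) σ (I m) := by
  -- The induction is on the number `j` of remaining rounds, since an execution of a loop is taken
  -- apart at its first round.
  have key : ∀ j ≤ m, ∀ τ, I (m - j) τ → Runs w L W (.loop b p) ((j + 1) * X) τ (I m) := by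
    intro j
    induction j with
    | zero =>
      intro _ τ hI hbd
      have hc : b.cost w τ ≤ b.weight * X * (L + W + 1) :=
        (b.cost_le hw hbd).trans (by gcongr; exact Nat.le_mul_of_pos_right _ hX)
      refine ⟨τ, _, .loopDone (hm τ hI), ?_, hbd, hI⟩
      simp only [Program.weight, add_mul, zero_add, one_mul]
      omega
    | succ j ih =>
      intro hj τ hI hbd
      have hc : b.cost w τ ≤ b.weight * X * (L + W + 1) :=
        (b.cost_le hw hbd).trans (by gcongr; exact Nat.le_mul_of_pos_right _ hX)
      obtain ⟨υ, t, he, ht, hbd', hI'⟩ := hp (m - (j + 1)) (by omega) τ hI hbd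
      rw [show m - (j + 1) + 1 = m - j by omega] at hI'
      obtain ⟨ν, u, he', hu, hbd'', hI''⟩ := ih (by omega) υ hI' hbd'
      refine ⟨ν, _, .loopStep (hb _ (by omega) τ hI) he he', ?_, hbd'', hI''⟩
      simp only [Program.weight] at hu ⊢
      have e : (b.weight + p.weight) * ((j + 1 + 1) * X) * (L + W + 1) =
        (b.weight + p.weight) * ((j + 1) * X) * (L + W + 1) + b.weight * X * (L + W + 1)
          + p.weight * X * (L + W + 1) := by ring
      omega
  exact key m le_rfl σ (by simpa using h0)

/-- The body must write neither to the counter nor to its bound. The invariant is demanded after the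
counter has been increased, and agreement with the memory before the loop is carried along with it.
-/
theorem Runs.forLoop {v b m : ℕ} {I : ℕ → Memory R → Prop} (hw : IsTameSize w) (hX : 1 ≤ X)
    (hL : m < 2 ^ L) (hb : b ∉ v :: p.numWrites) (hv : v ∉ p.numWrites) (hm : σ.num b 0 = m)
    (h0 : I 0 (σ.setNum v 0 0))
    (hp : ∀ i < m, ∀ τ, Memory.AgreeOff (v :: p.numWrites) p.eltWrites σ τ → τ.num v 0 = i →
      I i τ → Runs w L W p X τ (fun υ => I (i + 1) (υ.setNum v 0 (i + 1)))) :
    Runs w L W (.forLoop v b p) ((m + 1) * X) σ (fun τ => τ.num v 0 = m ∧ I m τ) := by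
  have hbv : b ≠ v := fun h => hb (h ▸ List.mem_cons_self)
  refine Runs.seq (Q := fun τ => τ.num v 0 = 0 ∧ I 0 τ ∧
    Memory.AgreeOff (v :: p.numWrites) p.eltWrites σ τ) ?_ ?_
  · exact Runs.setNum (by nlinarith) (by simp [NumExpr.eval])
      ⟨by simp [NumExpr.eval], by simpa [NumExpr.eval] using h0,
        Memory.AgreeOff.refl.setNum (by simp)⟩
  rintro τ - ⟨hτ, hI, hA⟩
  refine (Runs.loop (m := m) (I := fun i τ => τ.num v 0 = i ∧ I i τ ∧
    Memory.AgreeOff (v :: p.numWrites) p.eltWrites σ τ) hw hX ⟨hτ, hI, hA⟩ ?_ ?_ ?_).mono le_rfl ?_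
  · rintro τ ⟨h1, -, h3⟩
    simp [Test.holds, NumExpr.eval, h1, h3.num b hb, hm]
  · rintro i hi τ ⟨h1, -, h3⟩
    simpa [Test.holds, NumExpr.eval, h1, h3.num b hb, hm] using hi
  · rintro i hi τ ⟨h1, h2, h3⟩
    refine Runs.seq (hp i hi τ h3 h1 h2) ?_
    intro υ hA' hI'
    have hυ : υ.num v 0 = i := by rw [hA'.num v hv, h1]
    refine Runs.setNum hX ?_ ⟨?_, ?_, ?_⟩
    · simp only [NumExpr.eval, hυ]; omega
    · simp [NumExpr.eval, hυ]
    · simpa [NumExpr.eval, hυ] using hI'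
    · exact (h3.trans (hA'.mono (by simp) (by simp))).setNum (by simp)
  · rintro υ - ⟨h1, h2, -⟩
    exact ⟨h1, h2⟩

end Rules

/-! ### Coefficients of products of linear forms -/

/-- The exponent vector of the multilinear monomial with the variables in `S`. -/
noncomputable def multilinearExponent {n : ℕ} (S : Finset (Fin n)) : Fin n →₀ ℕ :=
  ∑ i ∈ S, Finsupp.single i 1

theorem multilinearExponent_apply {n : ℕ} (S : Finset (Fin n)) (i : Fin n) :
    multilinearExponent S i = if i ∈ S then 1 else 0 := by
  simp [multilinearExponent, Finsupp.single_apply]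

theorem multilinearExponent_injective {n : ℕ} :
    Function.Injective (multilinearExponent (n := n)) := by
  intro S T h
  ext i
  have := DFunLike.congr_fun h i
  rw [multilinearExponent_apply, multilinearExponent_apply] at this
  by_cases hS : i ∈ S <;> by_cases hT : i ∈ T <;> simp_all

theorem exists_multilinearExponent_eq {n k : ℕ} {m : Fin n →₀ ℕ}
    (h : IsMultilinearMonomial k m) : ∃ S, multilinearExponent S = m := by
  refine ⟨m.support, ?_⟩
  ext i
  rw [multilinearExponent_apply]
  have := h.1 i
  split_ifs with hi
  · have := Finsupp.mem_support_iff.1 hi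
    omega
  · exact (Finsupp.notMem_support_iff.1 hi).symm

/-- The coefficient of the multilinear monomial with the variables in `S` in the product of the
linear forms with indices in `T`. -/
noncomputable def formProdCoeff {R : Type*} [CommRing R] {n k : ℕ} (A : Fin k → Fin n → R)
    (S : Finset (Fin n)) (T : Finset (Fin k)) : R :=
  (∏ j ∈ T, ∑ i : Fin n, MvPolynomial.C (A j i) * MvPolynomial.X i).coeff (multilinearExponent S)

theorem Derivation.map_finset_prod {R A ι : Type*} [CommRing R] [CommRing A] [Algebra R A]
    [DecidableEq ι] (D : Derivation R A A) (T : Finset ι) (f : ι → A) :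
    D (∏ j ∈ T, f j) = ∑ j ∈ T, D (f j) * ∏ j' ∈ T.erase j, f j' := by
  induction T using Finset.induction_on with
  | empty => simp
  | insert a T ha ih =>
    rw [Finset.prod_insert ha, D.leibniz, ih, Finset.sum_insert ha, Finset.erase_insert ha,
      smul_eq_mul, smul_eq_mul, Finset.mul_sum, add_comm]
    congr 1
    · ring
    · refine Finset.sum_congr rfl fun j hj => ?_
      have hja : a ≠ j := fun h => ha (h ▸ hj)
      rw [Finset.erase_insert_of_ne hja, Finset.prod_insert (by simp [ha])]
      ring

section FormProdCoeff

variable {R : Type*} [CommRing R] {n k : ℕ} (A : Fin k → Fin n → R)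

/-- Linear forms have no constant term, so only the empty product contributes. -/
theorem formProdCoeff_empty (T : Finset (Fin k)) :
    formProdCoeff A ∅ T = if T = ∅ then 1 else 0 := by
  have : formProdCoeff A ∅ T = MvPolynomial.constantCoeff
      (∏ j ∈ T, ∑ i : Fin n, MvPolynomial.C (A j i) * MvPolynomial.X i) := by
    rw [formProdCoeff, multilinearExponent, Finset.sum_empty, MvPolynomial.constantCoeff_eq]
  rw [this, map_prod]
  split_ifs with h
  · simp [h]
  · obtain ⟨j, hj⟩ := Finset.nonempty_iff_ne_empty.2 h
    exact Finset.prod_eq_zero hj (by simp)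

/-- The partial derivative by `x_i` maps the monomial of `insert i S` to that of `S`, and sends each
linear form to a constant; the Leibniz rule gives the sum. -/
theorem formProdCoeff_insert {S : Finset (Fin n)} {i : Fin n} (hi : i ∉ S)
    (T : Finset (Fin k)) :
    formProdCoeff A (insert i S) T = ∑ j ∈ T, A j i * formProdCoeff A S (T.erase j) := by
  have h := MvPolynomial.coeff_pderiv (i := i)
    (∏ j ∈ T, ∑ i : Fin n, MvPolynomial.C (A j i) * MvPolynomial.X i) (multilinearExponent S)
  -- The exponent of `x_i` in the monomial of `S` is `0`, so differentiation contributes the factor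
  -- `0 + 1`, which is harmless in every characteristic.
  rw [multilinearExponent_apply, if_neg hi, Derivation.map_finset_prod,
    MvPolynomial.coeff_sum] at h
  have e : multilinearExponent (insert i S) = multilinearExponent S + Finsupp.single i 1 := by
    rw [multilinearExponent, Finset.sum_insert hi, add_comm, multilinearExponent]
  rw [formProdCoeff, e]
  simp only [Nat.cast_zero, zero_add, mul_one] at h
  rw [← h]
  refine Finset.sum_congr rfl fun j _ => ?_
  have : MvPolynomial.pderiv i (∑ i : Fin n, MvPolynomial.C (A j i) * MvPolynomial.X i) =
      MvPolynomial.C (A j i) := by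
    simp [MvPolynomial.pderiv_X, Pi.single_apply]
  rw [this, MvPolynomial.coeff_C_mul, formProdCoeff]

end FormProdCoeff

/-! ### Multilinear coefficients of the polynomial of a circuit -/

section Circuit

variable {R : Type*} [CommRing R] {n k s : ℕ} (C : DepthThreeCircuit R n k s)

theorem DepthThreeCircuit.isHomogeneous_poly : C.poly.IsHomogeneous k := by
  refine MvPolynomial.IsHomogeneous.sum _ _ _ fun t _ => ?_
  have := MvPolynomial.IsHomogeneous.prod Finset.univ
    (fun j => ∑ i : Fin n, MvPolynomial.C (C.form t j i) * MvPolynomial.X i) (fun _ => 1)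
    fun j _ => MvPolynomial.IsHomogeneous.sum _ _ _ fun i _ =>
      MvPolynomial.isHomogeneous_C_mul_X _ _
  simpa using this

theorem DepthThreeCircuit.coeff_poly (S : Finset (Fin n)) :
    C.poly.coeff (multilinearExponent S) = ∑ t, formProdCoeff (C.form t) S Finset.univ := by
  simp only [DepthThreeCircuit.poly, MvPolynomial.coeff_sum, formProdCoeff]

/-- By homogeneity the degree condition is automatic for nonzero coefficients; sums and tests may
therefore run over all sets `S`, of any cardinality. -/
theorem DepthThreeCircuit.isMultilinearMonomial {S : Finset (Fin n)}
    (h : C.poly.coeff (multilinearExponent S) ≠ 0) :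
    IsMultilinearMonomial k (multilinearExponent S) := by
  refine ⟨fun i => by rw [multilinearExponent_apply]; split_ifs <;> simp, ?_⟩
  by_contra h'
  exact h (C.isHomogeneous_poly.coeff_eq_zero h')

theorem DepthThreeCircuit.hasMultilinearMonomial_iff :
    HasMultilinearMonomial k C.poly ↔
      ∃ S : Finset (Fin n), ∑ t, formProdCoeff (C.form t) S Finset.univ ≠ 0 := by
  constructor
  · rintro ⟨m, hm, hc⟩
    obtain ⟨S, rfl⟩ := exists_multilinearExponent_eq hm
    exact ⟨S, by rwa [← C.coeff_poly]⟩
  · rintro ⟨S, hS⟩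
    rw [← C.coeff_poly] at hS
    exact ⟨_, C.isMultilinearMonomial hS, hS⟩

theorem DepthThreeCircuit.multilinearCoeffSum_poly :
    multilinearCoeffSum k C.poly =
      ∑ S : Finset (Fin n), ∑ t, formProdCoeff (C.form t) S Finset.univ := by
  classical
  simp only [← C.coeff_poly]
  rw [multilinearCoeffSum, ← Finset.sum_image (s := Finset.univ)
    (f := fun m => C.poly.coeff m) fun S _ T _ h => multilinearExponent_injective h]
  refine Finset.sum_subset ?_ ?_
  · intro m hm
    obtain ⟨S, rfl⟩ := exists_multilinearExponent_eq (Finset.mem_filter.1 hm).2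
    simp
  · intro m hm hm'
    obtain ⟨S, -, rfl⟩ := Finset.mem_image.1 hm
    by_contra h
    exact hm' (Finset.mem_filter.2 ⟨MvPolynomial.mem_support_iff.2 h, C.isMultilinearMonomial h⟩)

/-- The entry of the input memory for the coefficient with the given indices. -/
def DepthThreeCircuit.entry (t j i : ℕ) : R := C.inputMemory.elt 0 ((t * k + j) * n + i)

theorem DepthThreeCircuit.entry_eq {t j i : ℕ} (ht : t < s) (hj : j < k) (hi : i < n) :
    C.entry t j i = C.form ⟨t, ht⟩ ⟨j, hj⟩ ⟨i, hi⟩ := by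
  have h1 : ((t * k + j) * n + i) / n = t * k + j := by
    rw [mul_comm, Nat.mul_add_div (by omega), Nat.div_eq_of_lt hi, add_zero]
  have h2 : (t * k + j) / k = t := by
    rw [mul_comm, Nat.mul_add_div (by omega), Nat.div_eq_of_lt hj, add_zero]
  have h3 : ((t * k + j) * n + i) % n = i := by
    rw [mul_comm, Nat.mul_add_mod, Nat.mod_eq_of_lt hi]
  have h4 : (t * k + j) % k = j := by
    rw [mul_comm, Nat.mul_add_mod, Nat.mod_eq_of_lt hj]
  simp [DepthThreeCircuit.entry, DepthThreeCircuit.inputMemory, h1, h2, h3, h4, ht, hj, hi]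

theorem DepthThreeCircuit.forall_elt_inputMemory {Q : R → Prop} (h0 : Q 0)
    (h : ∀ t j i, Q (C.form t j i)) (a c : ℕ) : Q (C.inputMemory.elt a c) := by
  simp only [DepthThreeCircuit.inputMemory]
  split_ifs
  exacts [h _ _ _, h0]

end Circuit

/-! ### Sets of linear forms coded as bit strings -/

/-- The set coded by the `k` bits of `T` from position `o` on. -/
def bitSet (k o T : ℕ) : Finset (Fin k) := Finset.univ.filter fun j => T.testBit (o + j)

theorem Nat.two_pow_le_of_testBit {T p : ℕ} (h : T.testBit p) : 2 ^ p ≤ T := by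
  by_contra h'
  simp [Nat.testBit_lt_two_pow (not_le.1 h')] at h

/-- The bit being set, no borrow occurs. This is how the programs remove a form from a coded set by
subtraction. -/
theorem Nat.testBit_sub_two_pow {T p : ℕ} (h : T.testBit p) (q : ℕ) :
    (T - 2 ^ p).testBit q = (T.testBit q && decide (q ≠ p)) := by
  induction p generalizing T q with
  | zero =>
    have hT : T % 2 = 1 := by simpa [Nat.testBit_zero] using h
    cases q with
    | zero => simp [Nat.testBit_zero]; omega
    | succ q =>
      rw [Nat.testBit_add_one, Nat.testBit_add_one, show (T - 2 ^ 0) / 2 = T / 2 by omega]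
      simp
  | succ p ih =>
    rw [Nat.testBit_add_one] at h
    have hle := Nat.two_pow_le_of_testBit h
    cases q with
    | zero =>
      rw [Nat.testBit_zero, Nat.testBit_zero, show (T - 2 ^ (p + 1)) % 2 = T % 2 by omega]
      simp
    | succ q =>
      rw [Nat.testBit_add_one, Nat.testBit_add_one,
        show (T - 2 ^ (p + 1)) / 2 = T / 2 - 2 ^ p by omega, ih h]
      simp

theorem bitSet_sub {k o T : ℕ} {j : Fin k} (h : T.testBit (o + j)) :
    bitSet k o (T - 2 ^ (o + j.val)) = (bitSet k o T).erase j := by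
  ext x
  simp only [bitSet, Finset.mem_filter, Finset.mem_univ, true_and, Finset.mem_erase,
    Nat.testBit_sub_two_pow h, Bool.and_eq_true, decide_eq_true_eq, Fin.ext_iff, ne_eq,
    Nat.add_left_cancel_iff]
  tauto

theorem bitSet_sub_of_forall_ne {k o T p : ℕ} (h : T.testBit p) (hp : ∀ j < k, o + j ≠ p) :
    bitSet k o (T - 2 ^ p) = bitSet k o T := by
  ext x
  have := hp x x.2
  simp [bitSet, Nat.testBit_sub_two_pow h, this]

theorem bitSet_two_pow_sub_one {k o N : ℕ} (h : o + k ≤ N) :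
    bitSet k o (2 ^ N - 1) = Finset.univ := by
  ext x
  simp only [bitSet, Nat.testBit_two_pow_sub_one, Finset.mem_filter, Finset.mem_univ, true_and,
    decide_eq_true_eq, iff_true]
  omega

theorem bitSet_eq_empty_iff {k o T : ℕ} : bitSet k o T = ∅ ↔ ∀ j < k, T.testBit (o + j) = false := by
  simp only [bitSet, Finset.filter_eq_empty_iff, Finset.mem_univ, true_imp_iff,
    Bool.not_eq_true]
  exact ⟨fun h j hj => h (x := ⟨j, hj⟩), fun h x => h x x.2⟩

theorem Nat.eq_zero_of_testBit_lt {T N : ℕ} (hT : T < 2 ^ N)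
    (h : ∀ j < N, T.testBit j = false) : T = 0 := by
  apply Nat.eq_of_testBit_eq
  intro i
  rcases lt_or_ge i N with hi | hi
  · simp [h i hi]
  · rw [Nat.zero_testBit]
    exact Nat.testBit_lt_two_pow (hT.trans_le (Nat.pow_le_pow_right (by simp) hi))

theorem sum_bitSet {M : Type*} [AddCommMonoid M] (k o T : ℕ) (f : ℕ → M) :
    ∑ j ∈ bitSet k o T, f j = ∑ p ∈ Finset.range k, if T.testBit (o + p) then f p else 0 := by
  rw [bitSet, Finset.sum_filter, Finset.sum_range]

/-- Pairs are coded by quotient and remainder, so that one loop counter serves for a double sum. -/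
theorem Finset.sum_range_mul {M : Type*} [AddCommMonoid M] (a b : ℕ) (f : ℕ → ℕ → M) :
    ∑ p ∈ Finset.range (a * b), f (p / b) (p % b) =
      ∑ x ∈ Finset.range a, ∑ y ∈ Finset.range b, f x y := by
  induction a with
  | zero => simp
  | succ a ih =>
    rw [add_mul, one_mul, Finset.sum_range_add, ih, Finset.sum_range_succ]
    congr 1
    refine Finset.sum_congr rfl fun y hy => ?_
    have hy := Finset.mem_range.1 hy
    rw [mul_comm, Nat.mul_add_div (by omega), Nat.div_eq_of_lt hy, add_zero, Nat.mul_add_mod,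
      Nat.mod_eq_of_lt hy]

/-! ### The recursion over the variables -/

/-- The recursion carried out by the counting algorithm: in step `i`, the value at `T` increases by
`b i p` times the value at `T - μ p`, for all moves `p < m` that are admissible at `T`. -/
def subsetDP {R : Type*} [CommRing R] (m : ℕ) (μ : ℕ → ℕ) (c : ℕ → ℕ → Bool) (b : ℕ → ℕ → R) :
    ℕ → ℕ → R
  | 0, T => if T = 0 then 1 else 0
  | i + 1, T => subsetDP m μ c b i T +
      ∑ p ∈ Finset.range m, if c p T then b i p * subsetDP m μ c b i (T - μ p) else 0

theorem Fin.filter_val_lt_succ {n i : ℕ} (hi : i < n) :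
    (Finset.univ.filter fun x : Fin n => x.val < i + 1) =
      insert ⟨i, hi⟩ (Finset.univ.filter fun x : Fin n => x.val < i) := by
  ext x
  simp only [Finset.mem_filter, Finset.mem_univ, true_and, Finset.mem_insert, Fin.ext_iff]
  omega

section Recursion

variable {R : Type*} [CommRing R] {n k s : ℕ} (C : DepthThreeCircuit R n k s)

theorem formProdCoeff_insert_bitSet {t i : ℕ} (ht : t < s) (hi : i < n) {S : Finset (Fin n)}
    (hS : ⟨i, hi⟩ ∉ S) (o T : ℕ) :
    formProdCoeff (C.form ⟨t, ht⟩) (insert ⟨i, hi⟩ S) (bitSet k o T) =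
      ∑ p ∈ Finset.range k, if T.testBit (o + p) then
        C.entry t p i * formProdCoeff (C.form ⟨t, ht⟩) S (bitSet k o (T - 2 ^ (o + p))) else 0 := by
  rw [formProdCoeff_insert _ hS, ← sum_bitSet]
  refine Finset.sum_congr rfl fun j hj => ?_
  rw [C.entry_eq ht j.2 hi, bitSet_sub (Finset.mem_filter.1 hj).2]

/-- The recursion for the sum of the coefficients of one product. -/
def DepthThreeCircuit.countDP (t : ℕ) : ℕ → ℕ → R :=
  subsetDP k (fun p => 2 ^ p) (fun p T => T.testBit p) (fun i p => C.entry t p i)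

/-- The recursion for the sum over all monomials of the products of their coefficients in two
products of linear forms. -/
def DepthThreeCircuit.pairDP (q : ℕ) : ℕ → ℕ → R :=
  subsetDP (k * k) (fun p => 2 ^ (p / k) + 2 ^ (k + p % k))
    (fun p T => T.testBit (p / k) && T.testBit (k + p % k))
    (fun i p => C.entry (q / s) (p / k) i * C.entry (q % s) (p % k) i)

/-- Sets of variables below `i + 1` either avoid variable `i`, which gives the old value, or arise
by inserting it, which is the recursion for the coefficients summed over `S`. -/
theorem DepthThreeCircuit.countDP_eq {t : ℕ} (ht : t < s) {i : ℕ} (hi : i ≤ n) {T : ℕ}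
    (hT : T < 2 ^ k) :
    C.countDP t i T = ∑ S ∈ (Finset.univ.filter fun x : Fin n => x.val < i).powerset,
      formProdCoeff (C.form ⟨t, ht⟩) S (bitSet k 0 T) := by
  induction i generalizing T with
  | zero =>
    have : bitSet k 0 T = ∅ ↔ T = 0 := by
      rw [bitSet_eq_empty_iff]
      refine ⟨fun h => Nat.eq_zero_of_testBit_lt hT (by simpa using h), ?_⟩
      rintro rfl
      simp
    simp [DepthThreeCircuit.countDP, subsetDP, formProdCoeff_empty, this]
  | succ i ih =>
    rw [Fin.filter_val_lt_succ hi, Finset.sum_powerset_insert (by simp), ← ih (by omega) hT,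
      DepthThreeCircuit.countDP, subsetDP]
    congr 1
    rw [Finset.sum_congr rfl fun S hS => formProdCoeff_insert_bitSet C ht hi
      (fun h => by simpa using Finset.mem_powerset.1 hS h) 0 T, Finset.sum_comm]
    refine Finset.sum_congr rfl fun p _ => ?_
    by_cases h : T.testBit p
    · simp only [h, zero_add, if_true]
      rw [← Finset.mul_sum, ← ih (by omega) (lt_of_le_of_lt (Nat.sub_le _ _) hT)]
      rfl
    · simp [h]

/-- The low `k` bits of `T` code the forms of the first product and the next `k` bits those of the
second. The new variable takes one form from each, whence `k * k` moves. -/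
theorem DepthThreeCircuit.pairDP_eq {q : ℕ} (hq : q / s < s) (hq' : q % s < s) {i : ℕ}
    (hi : i ≤ n) {T : ℕ} (hT : T < 2 ^ (k + k)) :
    C.pairDP q i T = ∑ S ∈ (Finset.univ.filter fun x : Fin n => x.val < i).powerset,
      formProdCoeff (C.form ⟨q / s, hq⟩) S (bitSet k 0 T) *
        formProdCoeff (C.form ⟨q % s, hq'⟩) S (bitSet k k T) := by
  induction i generalizing T with
  | zero =>
    have : bitSet k 0 T = ∅ ∧ bitSet k k T = ∅ ↔ T = 0 := by
      rw [bitSet_eq_empty_iff, bitSet_eq_empty_iff]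
      refine ⟨fun h => Nat.eq_zero_of_testBit_lt hT fun j hj => ?_, ?_⟩
      · rcases lt_or_ge j k with hjk | hjk
        · simpa using h.1 j hjk
        · simpa [hjk] using h.2 (j - k) (by omega)
      · rintro rfl
        simp
    simp only [DepthThreeCircuit.pairDP, subsetDP, ← this, ite_and]
    simp only [not_lt_zero, Finset.filter_false, Finset.powerset_empty, Finset.sum_singleton,
      formProdCoeff_empty, mul_ite, mul_one, mul_zero]
    split_ifs <;> rfl
  | succ i ih =>
    rw [Fin.filter_val_lt_succ hi, Finset.sum_powerset_insert (by simp), ← ih (by omega) hT,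
      DepthThreeCircuit.pairDP, subsetDP]
    congr 1
    have hS : ∀ S ∈ (Finset.univ.filter fun x : Fin n => x.val < i).powerset,
        (⟨i, hi⟩ : Fin n) ∉ S := fun S hS h => by simpa using Finset.mem_powerset.1 hS h
    symm
    -- Both factors are expanded by the recursion, and the product of the two sums becomes one sum
    -- over `p < k * k`.
    rw [Finset.sum_congr rfl fun S h => (by
      rw [formProdCoeff_insert_bitSet C hq hi (hS S h) 0 T,
        formProdCoeff_insert_bitSet C hq' hi (hS S h) k T, Finset.sum_mul_sum,
        ← Finset.sum_range_mul] : formProdCoeff (C.form ⟨q / s, hq⟩) (insert ⟨i, hi⟩ S)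
          (bitSet k 0 T) * formProdCoeff (C.form ⟨q % s, hq'⟩) (insert ⟨i, hi⟩ S)
          (bitSet k k T) = _), Finset.sum_comm]
    symm
    refine Finset.sum_congr rfl fun p hp => ?_
    have hp := Finset.mem_range.1 hp
    have hk : 0 < k := Nat.pos_of_ne_zero fun h => by simp [h] at hp
    have hpk : p / k < k := Nat.div_lt_of_lt_mul hp
    have hpk' : p % k < k := Nat.mod_lt _ hk
    by_cases h : T.testBit (p / k)
    · by_cases h' : T.testBit (k + p % k)
      -- The two bits lie in different halves, so clearing one affects neither the other bit nor the
      -- set coded in the other half.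
      · have h1 : (T - 2 ^ (k + p % k)).testBit (p / k) := by
          rw [Nat.testBit_sub_two_pow h', h]
          simp only [Bool.true_and, decide_eq_true_eq]
          omega
        have h2 : (T - 2 ^ (p / k)).testBit (k + p % k) := by
          rw [Nat.testBit_sub_two_pow h, h']
          simp only [Bool.true_and, decide_eq_true_eq]
          omega
        have e1 : bitSet k 0 (T - (2 ^ (p / k) + 2 ^ (k + p % k))) =
            bitSet k 0 (T - 2 ^ (p / k)) := by
          rw [Nat.sub_add_eq, bitSet_sub_of_forall_ne h2 (by intro j hj; omega)]
        have e2 : bitSet k k (T - (2 ^ (p / k) + 2 ^ (k + p % k))) =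
            bitSet k k (T - 2 ^ (k + p % k)) := by
          rw [add_comm, Nat.sub_add_eq, bitSet_sub_of_forall_ne h1 (by intro j hj; omega)]
        have := ih (by omega) (lt_of_le_of_lt (Nat.sub_le _ (2 ^ (p / k) + 2 ^ (k + p % k))) hT)
        rw [DepthThreeCircuit.pairDP] at this
        simp only [h, h', zero_add, Bool.and_self, if_true]
        rw [this, Finset.mul_sum]
        refine Finset.sum_congr rfl fun S _ => ?_
        rw [e1, e2]
        ring
      · simp [h, h']
    · simp [h]

theorem DepthThreeCircuit.multilinearCoeffSum_eq_sum_countDP :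
    multilinearCoeffSum k C.poly = ∑ t ∈ Finset.range s, C.countDP t n (2 ^ k - 1) := by
  rw [C.multilinearCoeffSum_poly, Finset.sum_comm, Finset.sum_range]
  refine Finset.sum_congr rfl fun t _ => ?_
  rw [C.countDP_eq t.2 le_rfl (Nat.sub_lt (by positivity) one_pos),
    bitSet_two_pow_sub_one (by omega)]
  simp

theorem DepthThreeCircuit.sum_sq_eq_sum_pairDP :
    ∑ S : Finset (Fin n), (∑ t, formProdCoeff (C.form t) S Finset.univ) ^ 2 =
      ∑ q ∈ Finset.range (s * s), C.pairDP q n (2 ^ (k + k) - 1) := by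
  -- The terms are extended by zero to all pairs of natural numbers so that the double sum over `t`,
  -- `t'` can be re-indexed by quotient and remainder.
  set f : ℕ → ℕ → R := fun t t' => if h : t < s ∧ t' < s then ∑ S : Finset (Fin n),
    formProdCoeff (C.form ⟨t, h.1⟩) S Finset.univ * formProdCoeff (C.form ⟨t', h.2⟩) S Finset.univ
    else 0 with hf
  trans ∑ q ∈ Finset.range (s * s), f (q / s) (q % s)
  · rw [Finset.sum_range_mul]
    simp only [sq, Finset.sum_mul_sum, Finset.sum_range]
    rw [Finset.sum_comm]
    refine Finset.sum_congr rfl fun t _ => ?_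
    rw [Finset.sum_comm]
    refine Finset.sum_congr rfl fun t' _ => ?_
    simp [hf]
  · refine Finset.sum_congr rfl fun q hq => ?_
    have hq := Finset.mem_range.1 hq
    have hs : 0 < s := Nat.pos_of_ne_zero fun h => by simp [h] at hq
    have h1 : q / s < s := Nat.div_lt_of_lt_mul hq
    have h2 : q % s < s := Nat.mod_lt _ hs
    rw [C.pairDP_eq h1 h2 le_rfl (Nat.sub_lt (by positivity) one_pos),
      bitSet_two_pow_sub_one (by omega), bitSet_two_pow_sub_one (by omega)]
    simp [hf, h1, h2]

end Recursion

/-! ### Rules for programs that begin with an assignment -/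

section Rules

variable {R : Type*} [CommRing R] {w : R → ℕ} {L W X : ℕ} {q : Program} {σ : Memory R}
  {S : Memory R → Prop}

theorem Runs.setNum_seq {a : ℕ} {i x : NumExpr} (hX : 1 ≤ X) (hx : x.eval σ < 2 ^ L)
    (hq : Runs w L W q X (σ.setNum a (i.eval σ) (x.eval σ)) S) :
    Runs w L W (.seq (.setNum a i x) q) X σ S := by
  refine Runs.seq (Q := fun τ => τ = σ.setNum a (i.eval σ) (x.eval σ))
    (Runs.setNum hX hx rfl) ?_
  rintro τ - rfl
  exact hq

theorem Runs.setElt_seq {a : ℕ} {i : NumExpr} {x : EltExpr} (hw : IsTameSize w) (hX : 1 ≤ X)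
    (hx : w (x.eval σ) ≤ W) (hq : Runs w L W q X (σ.setElt a (i.eval σ) (x.eval σ)) S) :
    Runs w L W (.seq (.setElt a i x) q) X σ S := by
  refine Runs.seq (Q := fun τ => τ = σ.setElt a (i.eval σ) (x.eval σ))
    (Runs.setElt hw hX hx rfl) ?_
  rintro τ - rfl
  exact hq

end Rules

/-! ### Preparation of the memory

The numbers `n`, `k`, `s` are copied to the scalar variables 2, 3, 4, and the array 5 is filled with
the powers of two with exponents up to `2 * k`. -/

/-- Copy the input parameters and tabulate powers of two. -/
def Program.prepare : Program :=
  .seq (.setNum 2 (.lit 0) (.read 0 (.lit 0))) <|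
  .seq (.setNum 3 (.lit 0) (.read 0 (.lit 1))) <|
  .seq (.setNum 4 (.lit 0) (.read 0 (.lit 2))) <|
  .seq (.setNum 5 (.lit 0) (.lit 1)) <|
  .seq (.setNum 7 (.lit 0) (.add (.var 3) (.var 3))) <|
  .forLoop 6 7 (.setNum 5 (.add (.var 6) (.lit 1)) (.mul (.read 5 (.var 6)) (.lit 2)))

/-- The memory holds the input together with the data computed by `Program.prepare`. -/
structure DepthThreeCircuit.IsPrepared {R : Type*} [CommRing R] {n k s : ℕ}
    (C : DepthThreeCircuit R n k s) (σ : Memory R) : Prop where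
  numVars : σ.num 2 0 = n
  degree : σ.num 3 0 = k
  fanIn : σ.num 4 0 = s
  twoPow : ∀ j ≤ k + k, σ.num 5 j = 2 ^ j
  answer : σ.num 1 0 = 0
  elt : σ.elt = C.inputMemory.elt

/-- The table replaces shifts: bit tests become a division by a stored power. The bound `k + k < L`
makes the largest entry fit. -/
theorem DepthThreeCircuit.runs_prepare {R : Type*} [CommRing R] {w : R → ℕ} {L W : ℕ}
    (hw : IsTameSize w) {n k s : ℕ} (C : DepthThreeCircuit R n k s) (hn : n < 2 ^ L)
    (hs : s < 2 ^ L) (hk : k + k < L) :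
    Runs w L W .prepare (k + k + 1) C.inputMemory C.IsPrepared := by
  have hL : L < 2 ^ L := Nat.lt_two_pow_self
  refine Runs.setNum_seq (by omega) ?_ <| Runs.setNum_seq (by omega) ?_ <|
    Runs.setNum_seq (by omega) ?_ <| Runs.setNum_seq (by omega) ?_ <|
    Runs.setNum_seq (by omega) ?_ ?_
  · simpa [NumExpr.eval, DepthThreeCircuit.inputMemory] using hn
  · simp [NumExpr.eval, DepthThreeCircuit.inputMemory]; omega
  · simpa [NumExpr.eval, DepthThreeCircuit.inputMemory] using hs
  · simp [NumExpr.eval]; omega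
  · simp [NumExpr.eval, DepthThreeCircuit.inputMemory]; omega
  refine (Runs.forLoop (m := k + k) (X := 1)
    (I := fun i τ => ∀ j ≤ i, τ.num 5 j = 2 ^ j) hw le_rfl (by omega)
    (by simp [Program.numWrites]) (by simp [Program.numWrites]) ?_ ?_ ?_).mono (by omega) ?_
  · simp [NumExpr.eval, DepthThreeCircuit.inputMemory]
  · simp [NumExpr.eval]
  · intro i hi τ _ hτ hI
    have hp : 2 ^ (i + 1) < 2 ^ L := Nat.pow_lt_pow_right (by simp) (by omega)
    refine Runs.setNum le_rfl ?_ ?_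
    · simpa [NumExpr.eval, hτ, hI i le_rfl, ← pow_succ] using hp
    · intro j hj
      rcases hj.lt_or_eq with hj' | rfl
      · have : j ≠ i + 1 := by omega
        simp [NumExpr.eval, hτ, hI j (by omega), this]
      · simp [NumExpr.eval, hτ, hI i le_rfl, pow_succ]
  · rintro τ hA ⟨-, hI⟩
    have hnum := hA.num
    have helt := hA.elt
    simp only [Program.forLoop, Program.numWrites, Program.eltWrites] at hnum helt
    exact ⟨by rw [hnum 2 (by simp)]; simp [NumExpr.eval, DepthThreeCircuit.inputMemory],
      by rw [hnum 3 (by simp)]; simp [NumExpr.eval, DepthThreeCircuit.inputMemory],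
      by rw [hnum 4 (by simp)]; simp [NumExpr.eval, DepthThreeCircuit.inputMemory], hI,
      by rw [hnum 1 (by simp)]; simp [NumExpr.eval, DepthThreeCircuit.inputMemory],
      funext fun a => by rw [helt a (by simp)]; simp⟩

/-! ### The program for the recursion over the variables

Scalar variables: 8 holds the number of states, 9 the number of summands and 14 the number of moves;
10, 11, 12, 13 are the loop counters for summands, variables, states and moves; 15 is the current
state. The values of the recursion are in the array 2 of ring elements, and the sum of the results
is accumulated in cell 0 of the array 1. -/

/-- The contribution of one move. -/
def Program.applyMove (cond : Test) (mask : NumExpr) (coef : EltExpr) : Program :=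
  .branch cond (.setElt 2 (.var 15) (.add (.read 2 (.var 15))
    (.mul coef (.read 2 (.sub (.var 15) mask))))) .skip

/-- Treat one variable: the states are updated in place, in decreasing order. -/
def Program.updateStates (cond : Test) (mask : NumExpr) (coef : EltExpr) : Program :=
  .forLoop 12 8 (.seq (.setNum 15 (.lit 0) (.sub (.sub (.var 8) (.lit 1)) (.var 12)))
    (.forLoop 13 14 (.applyMove cond mask coef)))

/-- Compute one summand and add it to the result. -/
def Program.addSummand (cond : Test) (mask : NumExpr) (coef : EltExpr) : Program :=
  .seq (.forLoop 12 8 (.setElt 2 (.var 12) .zero)) <|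
  .seq (.setElt 2 (.lit 0) .one) <|
  .seq (.forLoop 11 2 (.updateStates cond mask coef)) <|
  .setElt 1 (.lit 0) (.add (.read 1 (.lit 0)) (.read 2 (.sub (.var 8) (.lit 1))))

/-- Compute the sum of all summands. -/
def Program.sumDP (cond : Test) (mask : NumExpr) (coef : EltExpr) : Program :=
  .forLoop 10 9 (.addSummand cond mask coef)

/-- The value at `T` in step `i` after the contributions of the first `p` moves. -/
def subsetDPPartial {R : Type*} [CommRing R] (m : ℕ) (μ : ℕ → ℕ) (c : ℕ → ℕ → Bool)
    (b : ℕ → ℕ → R) (i T p : ℕ) : R :=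
  subsetDP m μ c b i T +
    ∑ p ∈ Finset.range p, if c p T then b i p * subsetDP m μ c b i (T - μ p) else 0

/-- The expressions plugged into `Program.sumDP` compute the data of a recursion, and all the values
that arise have size at most `W`. -/
structure SumDPSetup {R : Type*} [CommRing R] (w : R → ℕ) (L W : ℕ) (cond : Test)
    (mask : NumExpr) (coef : EltExpr) (n N cnt m : ℕ) (μ : ℕ → ℕ) (c : ℕ → ℕ → Bool)
    (b : ℕ → ℕ → ℕ → R) (σ : Memory R) : Prop where
  tame : IsTameSize w
  zero_le : w 0 ≤ W
  one_le : w 1 ≤ W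
  partial_le : ∀ q < cnt, ∀ i < n, ∀ T < N, ∀ p ≤ m, w (subsetDPPartial m μ c (b q) i T p) ≤ W
  sum_le : ∀ q ≤ cnt, w (∑ q ∈ Finset.range q, subsetDP m μ c (b q) n (N - 1)) ≤ W
  numVars_lt : n < 2 ^ L
  numStates_lt : N < 2 ^ L
  numSummands_lt : cnt < 2 ^ L
  numMoves_lt : m < 2 ^ L
  numStates_pos : 0 < N
  numVars : σ.num 2 0 = n
  numStates : σ.num 8 0 = N
  numSummands : σ.num 9 0 = cnt
  numMoves : σ.num 14 0 = m
  mask_le : ∀ p < m, ∀ T, c p T → 0 < μ p ∧ μ p ≤ T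
  cond_holds : ∀ τ, Memory.AgreeOff [10, 11, 12, 13, 15] [1, 2] σ τ → τ.num 13 0 < m →
    (cond.holds τ ↔ c (τ.num 13 0) (τ.num 15 0))
  mask_eval : ∀ τ, Memory.AgreeOff [10, 11, 12, 13, 15] [1, 2] σ τ → τ.num 13 0 < m →
    mask.eval τ = μ (τ.num 13 0)
  coef_eval : ∀ τ, Memory.AgreeOff [10, 11, 12, 13, 15] [1, 2] σ τ → τ.num 10 0 < cnt →
    τ.num 11 0 < n → τ.num 13 0 < m →
    coef.eval τ = b (τ.num 10 0) (τ.num 11 0) (τ.num 13 0)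

namespace SumDPSetup

variable {R : Type*} [CommRing R] {w : R → ℕ} {L W : ℕ} {cond : Test}
    {mask : NumExpr} {coef : EltExpr} {n N cnt m : ℕ} {μ : ℕ → ℕ} {c : ℕ → ℕ → Bool}
    {b : ℕ → ℕ → ℕ → R} {σ τ : Memory R} {q i T : ℕ}

/-- Every move reads a strictly smaller state, and only the cell of `T` is written; thus updating in
place is safe as long as the cells up to `T` still hold step `i`. -/
theorem runs_moves (h : SumDPSetup w L W cond mask coef n N cnt m μ c b σ)
    (hA : Memory.AgreeOff [10, 11, 12, 13, 15] [1, 2] σ τ) (hq : q < cnt) (hi : i < n) (hT : T < N)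
    (hτq : τ.num 10 0 = q) (hτi : τ.num 11 0 = i) (hτT : τ.num 15 0 = T)
    (hD : ∀ T' ≤ T, τ.elt 2 T' = subsetDP m μ c (b q) i T') :
    Runs w L W (.forLoop 13 14 (.applyMove cond mask coef)) ((m + 1) * 1) τ fun υ =>
      υ.elt 2 T = subsetDP m μ c (b q) (i + 1) T ∧ ∀ T' ≠ T, υ.elt 2 T' = τ.elt 2 T' := by
  refine (Runs.forLoop (m := m) (I := fun p υ =>
    υ.elt 2 T = subsetDPPartial m μ c (b q) i T p ∧ ∀ T' ≠ T, υ.elt 2 T' = τ.elt 2 T')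
    h.tame le_rfl h.numMoves_lt (by simp [Program.numWrites, Program.applyMove])
    (by simp [Program.numWrites, Program.applyMove])
    (by rw [hA.num 14 (by simp), h.numMoves])
    ⟨by simp [subsetDPPartial, hD T le_rfl], by simp⟩ ?_).mono le_rfl fun υ _ hυ => hυ.2
  intro p hp υ hA' hυp hI
  have hA'' : Memory.AgreeOff [10, 11, 12, 13, 15] [1, 2] σ υ :=
    hA.trans (hA'.mono (by simp [Program.numWrites, Program.applyMove])
      (by simp [Program.eltWrites, Program.applyMove]))
  have hnum := hA'.num
  simp only [Program.numWrites, Program.applyMove] at hnum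
  have hυT : υ.num 15 0 = T := by rw [hnum 15 (by simp), hτT]
  have hυq : υ.num 10 0 = q := by rw [hnum 10 (by simp), hτq]
  have hυi : υ.num 11 0 = i := by rw [hnum 11 (by simp), hτi]
  have hc := h.cond_holds υ hA'' (by rwa [hυp])
  rw [hυp, hυT] at hc
  refine Runs.branch h.tame le_rfl (fun hb => ?_) (fun hb => ?_)
  · have hcp := hc.1 hb
    have hmask := h.mask_eval υ hA'' (by rwa [hυp])
    have hcoef := h.coef_eval υ hA'' (by rwa [hυq]) (by rwa [hυi]) (by rwa [hυp])
    rw [hυp] at hmask hcoef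
    rw [hυq, hυi] at hcoef
    obtain ⟨h0, h1⟩ := h.mask_le p hp T hcp
    have hval : (EltExpr.add (.read 2 (.var 15))
        (.mul coef (.read 2 (.sub (.var 15) mask)))).eval υ =
        subsetDPPartial m μ c (b q) i T (p + 1) := by
      simp only [EltExpr.eval, NumExpr.eval, hυT, hI.1, hmask, hcoef]
      -- As `0 < μ p ≤ T`, the state read differs from `T` and has not been changed.
      rw [hI.2 _ (by omega), hD _ (by omega), subsetDPPartial, subsetDPPartial,
        Finset.sum_range_succ, if_pos hcp, add_assoc]
    refine Runs.setElt h.tame le_rfl ?_ ?_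
    · rw [hval]
      exact h.partial_le q hq i hi T hT _ hp
    · rw [hval]
      refine ⟨by simp [NumExpr.eval, hυT], fun T' hT' => ?_⟩
      simpa [NumExpr.eval, hυT, hT'] using hI.2 T' hT'
  · have hcp : ¬ c p T := fun h' => hb (hc.2 h')
    refine Runs.skip le_rfl ⟨?_, by simpa using hI.2⟩
    simp only [Memory.setNum_elt]
    rw [hI.1, subsetDPPartial, subsetDPPartial, Finset.sum_range_succ, if_neg hcp, add_zero]

/-- Decreasing order of the states: after `r` rounds the `r` largest states hold step `i + 1` and
all the others still hold step `i`. -/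
theorem runs_updateStates (h : SumDPSetup w L W cond mask coef n N cnt m μ c b σ)
    (hA : Memory.AgreeOff [10, 11, 12, 13, 15] [1, 2] σ τ) (hq : q < cnt) (hi : i < n)
    (hτq : τ.num 10 0 = q) (hτi : τ.num 11 0 = i)
    (hD : ∀ T < N, τ.elt 2 T = subsetDP m μ c (b q) i T) :
    Runs w L W (.updateStates cond mask coef) ((N + 1) * (m + 1)) τ fun υ =>
      ∀ T < N, υ.elt 2 T = subsetDP m μ c (b q) (i + 1) T := by
  refine (Runs.forLoop (m := N) (I := fun r υ => ∀ T < N,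
    υ.elt 2 T = subsetDP m μ c (b q) (if T < N - r then i else i + 1) T)
    h.tame (by omega) h.numStates_lt
    (by simp [Program.numWrites, Program.applyMove, Program.forLoop])
    (by simp [Program.numWrites, Program.applyMove, Program.forLoop])
    (by rw [hA.num 8 (by simp), h.numStates])
    (fun T hT => by simp [hT, hD T hT]) ?_).mono le_rfl
    fun υ _ hυ => fun T hT => by simpa using hυ.2 T hT
  intro r hr υ hA' hυr hI
  have hA'' : Memory.AgreeOff [10, 11, 12, 13, 15] [1, 2] σ υ :=
    hA.trans (hA'.mono (by simp [Program.numWrites, Program.applyMove, Program.forLoop])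
      (by simp [Program.eltWrites, Program.applyMove, Program.forLoop]))
  have hnum := hA'.num
  simp only [Program.numWrites, Program.applyMove, Program.forLoop] at hnum
  have hυ8 : υ.num 8 0 = N := by rw [hnum 8 (by simp), hA.num 8 (by simp), h.numStates]
  have hNL := h.numStates_lt
  refine Runs.setNum_seq (by omega) (by simp [NumExpr.eval, hυ8, hυr]; omega) ?_
  refine (h.runs_moves (T := N - 1 - r) (q := q) (i := i) (hA''.setNum (by simp)) hq hi (by omega)
    ?_ ?_ ?_ ?_).mono (by omega) ?_
  · simp [NumExpr.eval, hnum 10, hτq]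
  · simp [NumExpr.eval, hnum 11, hτi]
  · simp [NumExpr.eval, hυ8, hυr]
  · intro T hT
    rw [Memory.setNum_elt, hI T (by omega), if_pos (by omega)]
  · rintro υ' - ⟨h1, h2⟩ T hT
    simp only [Memory.setNum_elt]
    rcases eq_or_ne T (N - 1 - r) with rfl | hne
    · rw [h1, if_neg (by omega)]
    · rw [h2 T hne, Memory.setNum_elt, hI T hT]
      congr 1
      split_ifs <;> omega

/-- The table is cleared first, since it may still hold the values of the previous summand. The
result is read at the state `N - 1`, where all bits are set in the applications. -/
theorem runs_addSummand (h : SumDPSetup w L W cond mask coef n N cnt m μ c b σ)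
    (hA : Memory.AgreeOff [10, 11, 12, 13, 15] [1, 2] σ τ) (hq : q < cnt)
    (hτq : τ.num 10 0 = q)
    (hS : τ.elt 1 0 = ∑ q ∈ Finset.range q, subsetDP m μ c (b q) n (N - 1)) :
    Runs w L W (.addSummand cond mask coef) ((n + 1) * ((N + 1) * (m + 1))) τ fun υ =>
      υ.elt 1 0 = ∑ q ∈ Finset.range (q + 1), subsetDP m μ c (b q) n (N - 1) := by
  have hX : 1 ≤ (n + 1) * ((N + 1) * (m + 1)) := Nat.one_le_iff_ne_zero.2 (by positivity)
  have hN := h.numStates_pos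
  have hclear : Runs w L W (.forLoop 12 8 (.setElt 2 (.var 12) .zero))
      ((n + 1) * ((N + 1) * (m + 1))) τ fun υ => ∀ T < N, υ.elt 2 T = 0 := by
    refine (Runs.forLoop (m := N) (X := 1) (I := fun r υ => ∀ T < r, υ.elt 2 T = 0)
      h.tame le_rfl h.numStates_lt (by simp [Program.numWrites])
      (by simp [Program.numWrites]) (by rw [hA.num 8 (by simp), h.numStates]) (by simp) ?_).mono
      (by nlinarith [Nat.zero_le ((N + 1) * m), Nat.zero_le (n * ((N + 1) * (m + 1)))])
      fun υ _ hυ => hυ.2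
    intro r hr υ _ hυr hI
    refine Runs.setElt h.tame le_rfl h.zero_le fun T hT => ?_
    rcases eq_or_ne T r with rfl | hne
    · simp [NumExpr.eval, EltExpr.eval, hυr]
    · simpa [NumExpr.eval, hυr, hne] using hI T (by omega)
  refine hclear.seq fun υ hA₁ hυ => ?_
  have hA₁' : Memory.AgreeOff [12] [2] τ υ :=
    hA₁.mono (by simp [Program.numWrites, Program.forLoop])
      (by simp [Program.eltWrites, Program.forLoop])
  refine Runs.setElt_seq h.tame hX h.one_le ?_
  have hA₂ : Memory.AgreeOff [12] [2] τ (υ.setElt 2 ((NumExpr.lit 0).eval υ)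
    (EltExpr.one.eval υ)) := hA₁'.setElt (by simp)
  have hυ₂ : ∀ T < N, (υ.setElt 2 ((NumExpr.lit 0).eval υ) (EltExpr.one.eval υ)).elt 2 T =
      subsetDP m μ c (b q) 0 T := by
    intro T hT
    simp [NumExpr.eval, EltExpr.eval, subsetDP, hυ T hT]
  generalize υ.setElt 2 ((NumExpr.lit 0).eval υ) (EltExpr.one.eval υ) = υ₂ at hA₂ hυ₂
  have hA₂' : Memory.AgreeOff [10, 11, 12, 13, 15] [1, 2] σ υ₂ :=
    hA.trans (hA₂.mono (by simp) (by simp))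
  refine Runs.seq (Q := fun υ => ∀ T < N, υ.elt 2 T = subsetDP m μ c (b q) n T) ?_ ?_
  · refine (Runs.forLoop (m := n) (I := fun i υ => ∀ T < N,
      υ.elt 2 T = subsetDP m μ c (b q) i T) h.tame
      (Nat.one_le_iff_ne_zero.2 (by positivity)) h.numVars_lt
      (by simp [Program.numWrites, Program.applyMove, Program.forLoop, Program.updateStates])
      (by simp [Program.numWrites, Program.applyMove, Program.forLoop, Program.updateStates])
      (by rw [hA₂'.num 2 (by simp), h.numVars]) (fun T hT => by simpa using hυ₂ T hT)
      ?_).mono le_rfl fun υ _ hυ => hυ.2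
    intro i hi ν hA₃ hνi hI
    have hnum := hA₃.num
    simp only [Program.numWrites, Program.applyMove, Program.forLoop,
      Program.updateStates] at hnum
    exact (h.runs_updateStates (hA₂'.trans (hA₃.mono
      (by simp [Program.numWrites, Program.applyMove, Program.forLoop, Program.updateStates])
      (by simp [Program.eltWrites, Program.applyMove, Program.forLoop, Program.updateStates])))
      hq hi (by rw [hnum 10 (by simp), hA₂.num 10 (by simp), hτq]) hνi hI).mono le_rfl
      fun υ _ hυ => by simpa using hυ
  · intro ν hA₃ hν
    have hnum := hA₃.num
    have helt := hA₃.elt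
    simp only [Program.numWrites, Program.eltWrites, Program.applyMove, Program.forLoop,
      Program.updateStates] at hnum helt
    have hν8 : ν.num 8 0 = N := by rw [hnum 8 (by simp), hA₂'.num 8 (by simp), h.numStates]
    have hν1 : ν.elt 1 0 = ∑ q ∈ Finset.range q, subsetDP m μ c (b q) n (N - 1) := by
      rw [helt 1 (by simp), hA₂.elt 1 (by simp), hS]
    have hval : (EltExpr.add (.read 1 (.lit 0)) (.read 2 (.sub (.var 8) (.lit 1)))).eval ν =
        ∑ q ∈ Finset.range (q + 1), subsetDP m μ c (b q) n (N - 1) := by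
      simp only [EltExpr.eval, NumExpr.eval, hν8, hν1, Finset.sum_range_succ]
      rw [hν _ (by omega)]
    refine Runs.setElt h.tame hX ?_ ?_
    · rw [hval]
      exact h.sum_le _ hq
    · rw [hval]
      simp [NumExpr.eval]

theorem runs_sumDP (h : SumDPSetup w L W cond mask coef n N cnt m μ c b σ) (hS : σ.elt 1 0 = 0) :
    Runs w L W (.sumDP cond mask coef) ((cnt + 1) * ((n + 1) * ((N + 1) * (m + 1)))) σ fun τ =>
      τ.elt 1 0 = ∑ q ∈ Finset.range cnt, subsetDP m μ c (b q) n (N - 1) := by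
  refine (Runs.forLoop (m := cnt) (I := fun q υ =>
      υ.elt 1 0 = ∑ q ∈ Finset.range q, subsetDP m μ c (b q) n (N - 1)) h.tame
      (Nat.one_le_iff_ne_zero.2 (by positivity)) h.numSummands_lt
      (by simp [Program.numWrites, Program.applyMove, Program.forLoop, Program.updateStates,
        Program.addSummand])
      (by simp [Program.numWrites, Program.applyMove, Program.forLoop, Program.updateStates,
        Program.addSummand])
      h.numSummands (by simp [hS]) ?_).mono le_rfl fun υ _ hυ => hυ.2
  intro q hq τ hA hτq hI
  refine (h.runs_addSummand (hA.mono ?_ ?_) hq hτq hI).mono le_rfl fun υ _ hυ => by simpa using hυ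
  · simp [Program.numWrites, Program.applyMove, Program.forLoop, Program.updateStates,
      Program.addSummand]
  · simp [Program.eltWrites, Program.applyMove, Program.forLoop, Program.updateStates,
      Program.addSummand]

end SumDPSetup

/-! ### Sizes of integers and rational numbers -/

theorem isTameSize_unitSize {R : Type*} [CommRing R] : IsTameSize (unitSize : R → ℕ) :=
  ⟨by simp [unitSize], by simp [unitSize], by simp [unitSize], by simp [unitSize],
    by simp [unitSize]⟩

theorem intSize_add_le (x y : ℤ) : intSize (x + y) ≤ intSize x + intSize y := by
  have h := Nat.size_le_size (Int.natAbs_add_le x y)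
  have := Nat.size_add_le x.natAbs y.natAbs
  simp only [intSize]
  omega

theorem intSize_mul_le (x y : ℤ) : intSize (x * y) ≤ intSize x + intSize y := by
  have := Nat.size_mul_le x.natAbs y.natAbs
  simp only [intSize, Int.natAbs_mul]
  omega

theorem intSize_neg (x : ℤ) : intSize (-x) = intSize x := by simp [intSize]

theorem isTameSize_intSize : IsTameSize intSize := by
  refine ⟨by simp [intSize], by simp [intSize], fun x y => ?_, fun x y => ?_, fun x y => ?_⟩
  · have := intSize_add_le x y
    omega
  · have := intSize_add_le x (-y)
    rw [intSize_neg, ← sub_eq_add_neg] at this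
    omega
  · have := intSize_mul_le x y
    omega

/-- Numerator and denominator in lowest terms divide those of any other representation. A zero
numerator is treated apart, as divisibility then bounds nothing. -/
theorem ratSize_le_of_mul_eq {x : ℚ} {M K : ℕ} {z : ℤ} (hM : M ≠ 0) (h : x * M = z)
    (hz : z.natAbs ≤ K) : ratSize x ≤ K.size + 1 + M.size := by
  have hMQ : (M : ℚ) ≠ 0 := Nat.cast_ne_zero.2 hM
  have hx : x = Rat.divInt z M := by
    rw [Rat.divInt_eq_div, ← h]
    push_cast
    field_simp
  have hd : (x.den : ℤ) ∣ M := by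
    rw [hx]; exact Rat.den_dvd z M
  have hd' : x.den ≤ M := Nat.le_of_dvd (Nat.pos_of_ne_zero hM) (by exact_mod_cast hd)
  have hn : x.num ∣ z := by
    rcases eq_or_ne z 0 with rfl | hz0
    · simp
    · rw [hx]; exact Rat.num_dvd z (by exact_mod_cast hM)
  have hn' : x.num.natAbs ≤ K := by
    rcases eq_or_ne z 0 with rfl | hz0
    · have : x = 0 := by simpa using hx
      simp [this]
    · exact (Nat.le_of_dvd (Int.natAbs_pos.2 hz0) (Int.natAbs_dvd_natAbs.2 hn)).trans hz
  have h1 := Nat.size_le_size hd'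
  have h2 := Nat.size_le_size hn'
  simp only [ratSize, intSize]
  omega

theorem ratSize_neg (x : ℚ) : ratSize (-x) = ratSize x := by simp [ratSize, intSize]

/-- In the cross-multiplied fraction the denominators enter both above and below the bar, hence the
factor 2. -/
theorem ratSize_add_le (x y : ℚ) : ratSize (x + y) ≤ 2 * (ratSize x + ratSize y + 1) := by
  have h : (x + y) * (x.den * y.den : ℕ) = ((x.num * y.den + y.num * x.den : ℤ) : ℚ) := by
    push_cast
    rw [← Rat.mul_den_eq_num x, ← Rat.mul_den_eq_num y]
    ring
  have h1 := ratSize_le_of_mul_eq (Nat.mul_ne_zero x.den_nz y.den_nz) h le_rfl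
  have h2 := intSize_add_le (x.num * y.den) (y.num * x.den)
  have h3 := intSize_mul_le x.num y.den
  have h4 := intSize_mul_le y.num x.den
  have h5 := Nat.size_mul_le x.den y.den
  simp only [ratSize, intSize, Int.natAbs_natCast] at *
  omega

theorem ratSize_mul_le (x y : ℚ) : ratSize (x * y) ≤ 2 * (ratSize x + ratSize y + 1) := by
  have h : (x * y) * (x.den * y.den : ℕ) = ((x.num * y.num : ℤ) : ℚ) := by
    push_cast
    rw [← Rat.mul_den_eq_num x, ← Rat.mul_den_eq_num y]
    ring
  have h1 := ratSize_le_of_mul_eq (Nat.mul_ne_zero x.den_nz y.den_nz) h le_rfl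
  have h3 := intSize_mul_le x.num y.num
  have h5 := Nat.size_mul_le x.den y.den
  simp only [ratSize, intSize] at *
  omega

theorem isTameSize_ratSize : IsTameSize ratSize := by
  refine ⟨by simp [ratSize, intSize], by simp [ratSize, intSize], ratSize_add_le, fun x y => ?_,
    ratSize_mul_le⟩
  have := ratSize_add_le x (-y)
  rwa [ratSize_neg, ← sub_eq_add_neg] at this

theorem ratSize_intCast (z : ℤ) : ratSize z = intSize z + 1 := by
  simp [ratSize]

/-! ### Bounds for the values of the recursion -/

/-- The image of `x` in the rational numbers is a fraction with denominator `M` whose numerator has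
absolute value at most `K`. -/
def IsFraction {R : Type*} [CommRing R] (φ : R →+* ℚ) (M K : ℕ) (x : R) : Prop :=
  ∃ z : ℤ, φ x * M = z ∧ z.natAbs ≤ K

section IsFraction

variable {R : Type*} [CommRing R] {φ : R →+* ℚ} {M M' K K' : ℕ} {x y : R}

theorem IsFraction.zero : IsFraction φ M K 0 := ⟨0, by simp, by simp⟩

theorem IsFraction.one : IsFraction φ 1 1 1 := ⟨1, by simp, by simp⟩

theorem IsFraction.mono (h : IsFraction φ M K x) (hK : K ≤ K') : IsFraction φ M K' x := by
  obtain ⟨z, hz, hz'⟩ := h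
  exact ⟨z, hz, hz'.trans hK⟩

theorem IsFraction.add (hx : IsFraction φ M K x) (hy : IsFraction φ M K' y) :
    IsFraction φ M (K + K') (x + y) := by
  obtain ⟨z, hz, hz'⟩ := hx
  obtain ⟨u, hu, hu'⟩ := hy
  refine ⟨z + u, by push_cast; rw [map_add, add_mul, hz, hu], ?_⟩
  exact (Int.natAbs_add_le _ _).trans (add_le_add hz' hu')

theorem IsFraction.mul (hx : IsFraction φ M K x) (hy : IsFraction φ M' K' y) :
    IsFraction φ (M * M') (K * K') (x * y) := by
  obtain ⟨z, hz, hz'⟩ := hx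
  obtain ⟨u, hu, hu'⟩ := hy
  refine ⟨z * u, by push_cast; rw [map_mul, ← hz, ← hu]; ring, ?_⟩
  rw [Int.natAbs_mul]
  exact Nat.mul_le_mul hz' hu'

theorem IsFraction.scale (hx : IsFraction φ M K x) (r : ℕ) :
    IsFraction φ (M * r) (K * r) x := by
  obtain ⟨z, hz, hz'⟩ := hx
  refine ⟨z * r, by push_cast; rw [← hz]; ring, ?_⟩
  rw [Int.natAbs_mul, Int.natAbs_natCast]
  exact Nat.mul_le_mul hz' le_rfl

theorem IsFraction.sum {f : ℕ → R} {m : ℕ} (h : ∀ p < m, IsFraction φ M K (f p)) :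
    IsFraction φ M (m * K) (∑ p ∈ Finset.range m, f p) := by
  induction m with
  | zero => simpa using IsFraction.zero
  | succ m ih =>
    rw [Finset.sum_range_succ, add_mul, one_mul]
    exact (ih fun p hp => h p (by omega)).add (h m (by omega))

theorem IsFraction.size_le {w : R → ℕ} (hw : ∀ x, w x ≤ ratSize (φ x)) (h : IsFraction φ M K x)
    (hM : M ≠ 0) {e : ℕ} (hMe : M ≤ 2 ^ e) (hKe : K ≤ 2 ^ e) : w x ≤ 2 * e + 3 := by
  obtain ⟨z, hz, hz'⟩ := h
  have h1 : ∀ r, r ≤ 2 ^ e → r.size ≤ e + 1 := fun r hr =>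
    Nat.size_le.2 (hr.trans_lt (Nat.pow_lt_pow_right (by simp) (by omega)))
  have := ratSize_le_of_mul_eq hM hz hz'
  have := h1 M hMe
  have := h1 K hKe
  have := hw x
  omega

/-- A common denominator for all input coefficients, of bit length at most their total size. -/
theorem isFraction_of_fintype {ι : Type*} [Fintype ι] (a : ι → R) :
    ∃ M K : ℕ, M ≠ 0 ∧ M ≤ 2 ^ (∑ j, ratSize (φ (a j))) ∧ K ≤ 2 ^ (∑ j, ratSize (φ (a j))) ∧
      ∀ j, IsFraction φ M K (a j) := by
  classical
  -- Each factor of the second product bounds both numerator and denominator of one entry, so the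
  -- product bounds any one numerator times all the other denominators.
  refine ⟨∏ j, (φ (a j)).den, ∏ j, ((φ (a j)).num.natAbs + (φ (a j)).den),
    Finset.prod_ne_zero_iff.2 fun j _ => (φ (a j)).den_nz, ?_, ?_, fun j => ?_⟩
  · rw [← Finset.prod_pow_eq_pow_sum]
    refine Finset.prod_le_prod' fun j _ => (Nat.lt_size_self _).le.trans ?_
    exact Nat.pow_le_pow_right (by simp) (by simp [ratSize])
  · rw [← Finset.prod_pow_eq_pow_sum]
    refine Finset.prod_le_prod' fun j _ => (Nat.lt_size_self _).le.trans ?_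
    refine Nat.pow_le_pow_right (by simp) ((Nat.size_add_le _ _).trans ?_)
    simp only [ratSize, intSize]
    omega
  · have h : IsFraction φ (φ (a j)).den ((φ (a j)).num.natAbs + (φ (a j)).den) (a j) :=
      ⟨(φ (a j)).num, Rat.mul_den_eq_num _, by omega⟩
    rw [← Finset.mul_prod_erase _ _ (Finset.mem_univ j),
      ← Finset.mul_prod_erase _ (fun j => (φ (a j)).num.natAbs + _) (Finset.mem_univ j)]
    exact (h.scale _).mono (Nat.mul_le_mul le_rfl
      (Finset.prod_le_prod' fun _ _ => Nat.le_add_left _ _))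

end IsFraction

section SubsetDP

variable {R : Type*} [CommRing R] {φ : R →+* ℚ} {w : R → ℕ} {M K m : ℕ} {μ : ℕ → ℕ}
  {c : ℕ → ℕ → Bool} {b : ℕ → ℕ → R}

theorem subsetDPPartial_self (i T : ℕ) :
    subsetDPPartial m μ c b i T m = subsetDP m μ c b (i + 1) T := rfl

/-- The old value is rescaled to the denominator `M ^ (i + 1)`, which multiplies its numerator by
`M`; each of the `p` moves adds at most `K` times the old bound. -/
theorem IsFraction.subsetDPPartial {i T p : ℕ}
    (hb : ∀ i p, IsFraction φ M K (b i p))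
    (h : ∀ T, IsFraction φ (M ^ i) ((M + m * K) ^ i) (subsetDP m μ c b i T)) :
    IsFraction φ (M ^ (i + 1)) ((M + m * K) ^ i * (M + p * K))
      (subsetDPPartial m μ c b i T p) := by
  rw [mul_add, pow_succ, show (M + m * K) ^ i * (p * K) = p * ((M + m * K) ^ i * K) by ring]
  refine ((h T).scale M).add (IsFraction.sum fun p' _ => ?_)
  split_ifs
  · rw [mul_comm (M ^ i), mul_comm _ K]
    exact (hb i p').mul (h _)
  · exact IsFraction.zero

theorem IsFraction.subsetDP (hb : ∀ i p, IsFraction φ M K (b i p)) (i T : ℕ) :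
    IsFraction φ (M ^ i) ((M + m * K) ^ i) (subsetDP m μ c b i T) := by
  induction i generalizing T with
  | zero =>
    rw [_root_.subsetDP]
    split_ifs
    exacts [by simpa using IsFraction.one, IsFraction.zero]
  | succ i ih =>
    rw [← subsetDPPartial_self, pow_succ (M + m * K)]
    exact IsFraction.subsetDPPartial hb ih

/-- The exponent comes from `M + m * K ≤ 2 ^ e * (1 + m) ≤ 2 ^ (e + m)`, raised to at most the
`n`-th power; summing up to `cnt` values costs a factor below `2 ^ cnt`. -/
theorem subsetDP_size_le (hw : ∀ x, w x ≤ ratSize (φ x)) (hM : M ≠ 0) {e cnt n : ℕ}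
    (hMe : M ≤ 2 ^ e) (hKe : K ≤ 2 ^ e) {b : ℕ → ℕ → ℕ → R}
    (hb : ∀ q i p, IsFraction φ M K (b q i p)) :
    (∀ q, ∀ i < n, ∀ T, ∀ p ≤ m,
      w (subsetDPPartial m μ c (b q) i T p) ≤ 2 * (cnt + (e + m) * n) + 3) ∧
    ∀ q ≤ cnt, ∀ T, w (∑ q ∈ Finset.range q, subsetDP m μ c (b q) n T) ≤
      2 * (cnt + (e + m) * n) + 3 := by
  have hm : 1 + m ≤ 2 ^ m := by
    have := Nat.lt_two_pow_self (n := m)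
    omega
  have hK : M + m * K ≤ 2 ^ (e + m) := by
    rw [pow_add]
    calc M + m * K ≤ 2 ^ e + m * 2 ^ e := by gcongr
      _ = 2 ^ e * (1 + m) := by ring
      _ ≤ _ := by gcongr
  have hM' : M ≤ 2 ^ (e + m) := hMe.trans (Nat.pow_le_pow_right (by simp) (by omega))
  have pow_le : ∀ {x i}, x ≤ 2 ^ (e + m) → i ≤ n → x ^ i ≤ 2 ^ ((e + m) * n) := by
    intro x i hx hi
    calc x ^ i ≤ (2 ^ (e + m)) ^ i := Nat.pow_le_pow_left hx i
      _ = 2 ^ ((e + m) * i) := (pow_mul _ _ _).symm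
      _ ≤ _ := Nat.pow_le_pow_right (by simp) (by gcongr)
  have hle : 2 ^ ((e + m) * n) ≤ 2 ^ (cnt + (e + m) * n) :=
    Nat.pow_le_pow_right (by simp) (by omega)
  constructor
  · intro q i hi T p hp
    refine IsFraction.size_le hw (IsFraction.subsetDPPartial (hb q)
      (IsFraction.subsetDP (hb q) i)) (pow_ne_zero _ hM) ((pow_le hM' hi).trans hle) ?_
    refine le_trans ?_ ((pow_le hK hi).trans hle)
    rw [pow_succ]
    gcongr
  · intro q hq T
    refine IsFraction.size_le hw (IsFraction.sum fun q _ => IsFraction.subsetDP (hb q) n T)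
      (pow_ne_zero _ hM) ((pow_le hM' le_rfl).trans hle) ?_
    rw [pow_add]
    exact Nat.mul_le_mul (hq.trans Nat.lt_two_pow_self.le) (pow_le hK le_rfl)

end SubsetDP

/-! ### Counting multilinear monomials -/

/-- The bit at position `p` of `x`. -/
def NumExpr.bit (x p : NumExpr) : NumExpr := .mod (.div x (.read 5 p)) (.lit 2)

/-- The coefficient of the variable `i` in the linear form `p` of the product `t`. -/
def EltExpr.coefficient (t p i : NumExpr) : EltExpr :=
  .read 0 (.add (.mul (.add (.mul t (.var 3)) p) (.var 2)) i)

/-- The program for the multilinear counting problem. -/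
def Program.count : Program :=
  .seq .prepare <|
  .seq (.setNum 8 (.lit 0) (.read 5 (.var 3))) <|
  .seq (.setNum 9 (.lit 0) (.var 4)) <|
  .seq (.setNum 14 (.lit 0) (.var 3)) <|
  .sumDP (.eq (.bit (.var 15) (.var 13)) (.lit 1)) (.read 5 (.var 13))
    (.coefficient (.var 10) (.var 13) (.var 11))

/-- Compute the sum of the squares of the coefficients of all multilinear monomials. -/
def Program.sumSquares : Program :=
  .seq .prepare <|
  .seq (.setNum 8 (.lit 0) (.read 5 (.add (.var 3) (.var 3)))) <|
  .seq (.setNum 9 (.lit 0) (.mul (.var 4) (.var 4))) <|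
  .seq (.setNum 14 (.lit 0) (.mul (.var 3) (.var 3))) <|
  .sumDP (.eq (.mul (.bit (.var 15) (.div (.var 13) (.var 3)))
      (.bit (.var 15) (.add (.var 3) (.mod (.var 13) (.var 3))))) (.lit 1))
    (.add (.read 5 (.div (.var 13) (.var 3))) (.read 5 (.add (.var 3) (.mod (.var 13) (.var 3)))))
    (.mul (.coefficient (.div (.var 10) (.var 4)) (.div (.var 13) (.var 3)) (.var 11))
      (.coefficient (.mod (.var 10) (.var 4)) (.mod (.var 13) (.var 3)) (.var 11)))

/-- The program for the multilinear detection problem over the integers. -/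
def Program.detectInt : Program :=
  .seq .sumSquares (.branch (.isZero (.read 1 (.lit 0))) .skip (.setNum 1 (.lit 0) (.lit 1)))

theorem DepthThreeCircuit.form_le_inputSize {R : Type*} {w : R → ℕ} {n k s : ℕ}
    (C : DepthThreeCircuit R n k s) (t : Fin s) (j : Fin k) (i : Fin n) :
    w (C.form t j i) ≤ C.inputSize w := by
  rw [DepthThreeCircuit.inputSize]
  have h1 := Finset.single_le_sum (f := fun i => w (C.form t j i)) (fun _ _ => Nat.zero_le _)
    (Finset.mem_univ i)
  have h2 := Finset.single_le_sum (f := fun j => ∑ i, w (C.form t j i)) (fun _ _ => Nat.zero_le _)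
    (Finset.mem_univ j)
  have h3 := Finset.single_le_sum (f := fun t => ∑ j, ∑ i, w (C.form t j i))
    (fun _ _ => Nat.zero_le _) (Finset.mem_univ t)
  omega

section Count

variable {R : Type*} [CommRing R] {w : R → ℕ} {W n k s : ℕ} (C : DepthThreeCircuit R n k s)

theorem DepthThreeCircuit.bounded_inputMemory {L : ℕ} (hn : n < 2 ^ L) (hk : k < 2 ^ L)
    (hs : s < 2 ^ L) (h0 : w 0 ≤ W) (hW : ∀ t j i, w (C.form t j i) ≤ W) :
    C.inputMemory.Bounded w L W := by
  refine ⟨fun a i => ?_, C.forall_elt_inputMemory (Q := fun x => w x ≤ W) h0 hW⟩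
  simp only [DepthThreeCircuit.inputMemory]
  split_ifs
  exacts [hn, hk, hs, by positivity]

/-- A number of bits that suffices for the numbers used by the programs. -/
def addressBits (n k s : ℕ) : ℕ := 2 * (n + k + s) + 1

theorem lt_two_pow_addressBits {x : ℕ} (h : x ≤ 2 * (n + k + s) + 1) :
    x < 2 ^ addressBits n k s :=
  h.trans_lt Nat.lt_two_pow_self

theorem mul_self_lt_two_pow_addressBits {x : ℕ} (h : x ≤ n + k + s) :
    x * x < 2 ^ addressBits n k s := by
  have hx : x < 2 ^ (n + k + s) := h.trans_lt Nat.lt_two_pow_self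
  calc x * x < 2 ^ (n + k + s) * 2 ^ (n + k + s) := Nat.mul_lt_mul'' hx hx
    _ = 2 ^ (2 * (n + k + s)) := by ring
    _ ≤ _ := Nat.pow_le_pow_right (by simp) (by simp [addressBits])

theorem two_pow_lt_two_pow_addressBits {x : ℕ} (h : x ≤ 2 * (n + k + s)) :
    2 ^ x < 2 ^ addressBits n k s :=
  Nat.pow_lt_pow_right (by simp) (by simp only [addressBits]; omega)

theorem DepthThreeCircuit.runs_count (hw : IsTameSize w) (h0 : w 0 ≤ W) (h1 : w 1 ≤ W)
    (hp : ∀ q < s, ∀ i < n, ∀ T < 2 ^ k, ∀ p ≤ k, w (subsetDPPartial k (fun p => 2 ^ p)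
      (fun p T => T.testBit p) (fun i p => C.entry q p i) i T p) ≤ W)
    (hs : ∀ q ≤ s, w (∑ q ∈ Finset.range q, C.countDP q n (2 ^ k - 1)) ≤ W) :
    Runs w (addressBits n k s) W .count (2 * ((s + 1) * ((n + 1) * ((2 ^ k + 1) * (k + 1)))))
      C.inputMemory fun τ => τ.elt 1 0 = multilinearCoeffSum k C.poly := by
  -- With this, the factor 2 in the bound covers the `k + k + 1` rounds of the preparation.
  have hX : k + 1 ≤ (s + 1) * ((n + 1) * ((2 ^ k + 1) * (k + 1))) := by
    rw [← mul_assoc, ← mul_assoc]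
    exact Nat.le_mul_of_pos_left _ (by positivity)
  refine Runs.seq (((C.runs_prepare hw (lt_two_pow_addressBits (by omega))
    (lt_two_pow_addressBits (by omega)) (by simp only [addressBits]; omega)).mono
    (by omega) fun τ _ hτ => hτ)) ?_
  intro τ _ hτ
  have hτk : τ.num 5 k = 2 ^ k := hτ.twoPow k (by omega)
  refine Runs.setNum_seq (by omega) ?_ (Runs.setNum_seq (by omega) ?_
    (Runs.setNum_seq (by omega) ?_ ?_))
  · simpa [NumExpr.eval, hτ.degree, hτk] using two_pow_lt_two_pow_addressBits (by omega)
  · simpa [NumExpr.eval, hτ.fanIn] using lt_two_pow_addressBits (by omega)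
  · simpa [NumExpr.eval, hτ.degree] using lt_two_pow_addressBits (by omega)
  have setup : SumDPSetup w (addressBits n k s) W (.eq (.bit (.var 15) (.var 13)) (.lit 1))
      (.read 5 (.var 13)) (.coefficient (.var 10) (.var 13) (.var 11)) n (2 ^ k) s k (fun p => 2 ^ p)
      (fun p T => T.testBit p) (fun q i p => C.entry q p i)
      (((τ.setNum 8 0 (2 ^ k)).setNum 9 0 s).setNum 14 0 k) := by
    constructor
    case tame => exact hw
    case zero_le => exact h0
    case one_le => exact h1
    case partial_le => exact hp
    case sum_le => exact hs
    case numVars_lt => exact lt_two_pow_addressBits (by omega)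
    case numStates_lt => exact two_pow_lt_two_pow_addressBits (by omega)
    case numSummands_lt => exact lt_two_pow_addressBits (by omega)
    case numMoves_lt => exact lt_two_pow_addressBits (by omega)
    case numStates_pos => positivity
    case numVars => simp [hτ.numVars]
    case numStates => simp
    case numSummands => simp
    case numMoves => simp
    case mask_le => exact fun p _ T h => ⟨by positivity, Nat.two_pow_le_of_testBit h⟩
    case cond_holds =>
      intro υ hυ hp
      have h5 : υ.num 5 (υ.num 13 0) = 2 ^ υ.num 13 0 := by
        rw [hυ.num 5 (by simp)]
        simpa using hτ.twoPow _ (by omega)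
      simp [Test.holds, NumExpr.bit, NumExpr.eval, h5, Nat.testBit_eq_decide_div_mod_eq]
    case mask_eval =>
      intro υ hυ hp
      simp only [NumExpr.eval]
      rw [hυ.num 5 (by simp)]
      simpa using hτ.twoPow _ (by omega)
    case coef_eval =>
      intro υ hυ _ _ _
      have h2 : υ.num 2 0 = n := by rw [hυ.num 2 (by simp)]; simp [hτ.numVars]
      have h3 : υ.num 3 0 = k := by rw [hυ.num 3 (by simp)]; simp [hτ.degree]
      simp only [EltExpr.coefficient, EltExpr.eval, NumExpr.eval, h2, h3]
      rw [hυ.elt 0 (by simp)]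
      simp [hτ.elt, DepthThreeCircuit.entry]
  simp only [NumExpr.eval, hτ.degree, hτ.fanIn, hτk, Memory.setNum_num]
  refine (setup.runs_sumDP ?_).mono (by omega) ?_
  · simp [hτ.elt, DepthThreeCircuit.inputMemory]
  · intro υ _ hυ
    rw [hυ, C.multilinearCoeffSum_eq_sum_countDP]
    rfl

theorem DepthThreeCircuit.runs_sumSquares (hw : IsTameSize w) (h0 : w 0 ≤ W) (h1 : w 1 ≤ W)
    (hp : ∀ q < s * s, ∀ i < n, ∀ T < 2 ^ (k + k), ∀ p ≤ k * k,
      w (subsetDPPartial (k * k) (fun p => 2 ^ (p / k) + 2 ^ (k + p % k))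
        (fun p T => T.testBit (p / k) && T.testBit (k + p % k))
        (fun i p => C.entry (q / s) (p / k) i * C.entry (q % s) (p % k) i) i T p) ≤ W)
    (hs : ∀ q ≤ s * s, w (∑ q ∈ Finset.range q, C.pairDP q n (2 ^ (k + k) - 1)) ≤ W) :
    Runs w (addressBits n k s) W .sumSquares
      (2 * ((s * s + 1) * ((n + 1) * ((2 ^ (k + k) + 1) * (k * k + 1)))))
      C.inputMemory fun τ => τ.num 1 0 = 0 ∧ τ.elt 1 0 =
        ∑ S : Finset (Fin n), (∑ t, formProdCoeff (C.form t) S Finset.univ) ^ 2 := by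
  have hX : k + 1 ≤ (s * s + 1) * ((n + 1) * ((2 ^ (k + k) + 1) * (k * k + 1))) := by
    rw [← mul_assoc, ← mul_assoc]
    exact le_trans (by nlinarith [Nat.zero_le k, sq_nonneg ((k : ℤ) - 1), Nat.le_mul_self k])
      (Nat.le_mul_of_pos_left _ (by positivity))
  refine Runs.seq (((C.runs_prepare hw (lt_two_pow_addressBits (by omega))
    (lt_two_pow_addressBits (by omega)) (by simp only [addressBits]; omega)).mono
    (by omega) fun τ _ hτ => hτ)) ?_
  intro τ _ hτ
  have hτk : τ.num 5 (k + k) = 2 ^ (k + k) := hτ.twoPow _ (by omega)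
  refine Runs.setNum_seq (by omega) ?_ (Runs.setNum_seq (by omega) ?_
    (Runs.setNum_seq (by omega) ?_ ?_))
  · simpa [NumExpr.eval, hτ.degree, hτk] using two_pow_lt_two_pow_addressBits (by omega)
  · simpa [NumExpr.eval, hτ.fanIn] using mul_self_lt_two_pow_addressBits (by omega)
  · simpa [NumExpr.eval, hτ.degree] using mul_self_lt_two_pow_addressBits (by omega)
  have setup : SumDPSetup w (addressBits n k s) W
      (.eq (.mul (.bit (.var 15) (.div (.var 13) (.var 3)))
        (.bit (.var 15) (.add (.var 3) (.mod (.var 13) (.var 3))))) (.lit 1))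
      (.add (.read 5 (.div (.var 13) (.var 3)))
        (.read 5 (.add (.var 3) (.mod (.var 13) (.var 3)))))
      (.mul (.coefficient (.div (.var 10) (.var 4)) (.div (.var 13) (.var 3)) (.var 11))
        (.coefficient (.mod (.var 10) (.var 4)) (.mod (.var 13) (.var 3)) (.var 11)))
      n (2 ^ (k + k)) (s * s) (k * k) (fun p => 2 ^ (p / k) + 2 ^ (k + p % k))
      (fun p T => T.testBit (p / k) && T.testBit (k + p % k))
      (fun q i p => C.entry (q / s) (p / k) i * C.entry (q % s) (p % k) i)
      (((τ.setNum 8 0 (2 ^ (k + k))).setNum 9 0 (s * s)).setNum 14 0 (k * k)) := by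
    have hpos : ∀ {p}, p < k * k → p / k < k ∧ p % k < k := fun {p} hp =>
      ⟨Nat.div_lt_of_lt_mul hp, Nat.mod_lt _ (Nat.pos_of_ne_zero fun h => by simp [h] at hp)⟩
    have h3 : ∀ υ, Memory.AgreeOff [10, 11, 12, 13, 15] [1, 2]
        (((τ.setNum 8 0 (2 ^ (k + k))).setNum 9 0 (s * s)).setNum 14 0 (k * k)) υ →
        υ.num 3 0 = k := fun υ hυ => by rw [hυ.num 3 (by simp)]; simp [hτ.degree]
    have h5 : ∀ υ, Memory.AgreeOff [10, 11, 12, 13, 15] [1, 2]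
        (((τ.setNum 8 0 (2 ^ (k + k))).setNum 9 0 (s * s)).setNum 14 0 (k * k)) υ →
        ∀ j ≤ k + k, υ.num 5 j = 2 ^ j := fun υ hυ j hj => by
      rw [hυ.num 5 (by simp)]
      simpa using hτ.twoPow _ hj
    constructor
    case tame => exact hw
    case zero_le => exact h0
    case one_le => exact h1
    case partial_le => exact hp
    case sum_le => exact hs
    case numVars_lt => exact lt_two_pow_addressBits (by omega)
    case numStates_lt => exact two_pow_lt_two_pow_addressBits (by omega)
    case numSummands_lt => exact mul_self_lt_two_pow_addressBits (by omega)
    case numMoves_lt => exact mul_self_lt_two_pow_addressBits (by omega)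
    case numStates_pos => positivity
    case numVars => simp [hτ.numVars]
    case numStates => simp
    case numSummands => simp
    case numMoves => simp
    case mask_le =>
      intro p hp T h
      simp only [Bool.and_eq_true] at h
      refine ⟨by positivity, ?_⟩
      have := hpos hp
      have h' : (T - 2 ^ (p / k)).testBit (k + p % k) := by
        rw [Nat.testBit_sub_two_pow h.1, h.2]
        simp only [Bool.true_and, decide_eq_true_eq]
        omega
      have := Nat.two_pow_le_of_testBit h.1
      have := Nat.two_pow_le_of_testBit h'
      omega
    case cond_holds =>
      intro υ hυ hp
      have := hpos hp
      simp only [Test.holds, NumExpr.bit, NumExpr.eval, h3 υ hυ]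
      rw [h5 υ hυ _ (by omega), h5 υ hυ _ (by omega)]
      simp only [Nat.testBit_eq_decide_div_mod_eq, Bool.and_eq_true, decide_eq_true_eq]
      -- The conjunction of two bit tests is programmed as a test whether the product of the bits is
      -- 1.
      rcases Nat.mod_two_eq_zero_or_one (υ.num 15 0 / 2 ^ (υ.num 13 0 / k)) with h | h <;>
      rcases Nat.mod_two_eq_zero_or_one (υ.num 15 0 / 2 ^ (k + υ.num 13 0 % k)) with h' | h' <;>
      simp [h, h']
    case mask_eval =>
      intro υ hυ hp
      have := hpos hp
      simp only [NumExpr.eval, h3 υ hυ]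
      rw [h5 υ hυ _ (by omega), h5 υ hυ _ (by omega)]
    case coef_eval =>
      intro υ hυ _ _ _
      have h2 : υ.num 2 0 = n := by rw [hυ.num 2 (by simp)]; simp [hτ.numVars]
      have h4 : υ.num 4 0 = s := by rw [hυ.num 4 (by simp)]; simp [hτ.fanIn]
      simp only [EltExpr.coefficient, EltExpr.eval, NumExpr.eval, h2, h3 υ hυ, h4]
      rw [hυ.elt 0 (by simp)]
      simp [hτ.elt, DepthThreeCircuit.entry]
  simp only [NumExpr.eval, hτ.degree, hτ.fanIn, hτk, Memory.setNum_num]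
  refine (setup.runs_sumDP ?_).mono (by omega) ?_
  · simp [hτ.elt, DepthThreeCircuit.inputMemory]
  · intro υ hA hυ
    refine ⟨?_, ?_⟩
    · rw [hA.num 1 (by simp [Program.numWrites, Program.applyMove, Program.forLoop,
        Program.updateStates, Program.addSummand, Program.sumDP])]
      simp [hτ.answer]
    · rw [hυ, C.sum_sq_eq_sum_pairDP]
      rfl

end Count

/-! ### The bounds for counting and for detection over the integers -/

section Bounds

variable {R : Type*} [CommRing R] {w : R → ℕ} {n k s : ℕ} (C : DepthThreeCircuit R n k s)

theorem DepthThreeCircuit.computesMLC_count {W I d : ℕ} (hw : IsTameSize w) (h0 : w 0 ≤ W)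
    (h1 : w 1 ≤ W) (hform : ∀ t j i, w (C.form t j i) ≤ W)
    (hp : ∀ q < s, ∀ i < n, ∀ T < 2 ^ k, ∀ p ≤ k, w (subsetDPPartial k (fun p => 2 ^ p)
      (fun p T => T.testBit p) (fun i p => C.entry q p i) i T p) ≤ W)
    (hs : ∀ q ≤ s, w (∑ q ∈ Finset.range q, C.countDP q n (2 ^ k - 1)) ≤ W)
    (hI : n + k + s ≤ I) (hd : W ≤ 12 * (I + 1) ^ d) (hd0 : d ≠ 0) :
    ComputesMLC w .count C
      ((Program.count.weight * 56 : ℕ) * 2 ^ k * ((I : ℝ) + 1) ^ (d + 3)) := by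
  obtain ⟨τ, t, he, ht, -, hτ⟩ := C.runs_count hw h0 h1 hp hs
    (C.bounded_inputMemory (lt_two_pow_addressBits (by omega)) (lt_two_pow_addressBits (by omega))
      (lt_two_pow_addressBits (by omega)) h0 hform)
  refine ⟨τ, t, he, ?_, hτ⟩
  have hI1 : I + 1 ≤ (I + 1) ^ d := Nat.le_self_pow hd0 _
  -- The addresses contribute at most `2 * (I + 1)` and `W` the other 12 units; with the two factors
  -- 2 in the number of rounds this yields 56.
  have hU : addressBits n k s + W + 1 ≤ 14 * (I + 1) ^ d := by
    simp only [addressBits]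
    omega
  have h2 : 2 ^ k + 1 ≤ 2 * 2 ^ k := by have := Nat.one_le_two_pow (n := k); omega
  have key : t ≤ Program.count.weight * 56 * 2 ^ k * (I + 1) ^ (d + 3) := by
    calc t ≤ _ := ht
      _ ≤ Program.count.weight * (2 * ((I + 1) * ((I + 1) * ((2 * 2 ^ k) * (I + 1))))) *
          (14 * (I + 1) ^ d) := by gcongr <;> omega
      _ = _ := by ring
  exact_mod_cast key

theorem DepthThreeCircuit.sum_ratSize_le {φ : R →+* ℚ} (hφ : ∀ x, ratSize (φ x) ≤ 2 * w x) :
    ∑ x : Fin s × Fin k × Fin n, ratSize (φ (C.form x.1 x.2.1 x.2.2)) ≤ 2 * C.inputSize w := by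
  rw [Fintype.sum_prod_type]
  simp only [Fintype.sum_prod_type]
  calc _ ≤ ∑ t, ∑ j, ∑ i, 2 * w (C.form t j i) := by
        gcongr
        exact hφ _
    _ ≤ _ := by
        simp only [← Finset.mul_sum, DepthThreeCircuit.inputSize]
        omega

/-- Treats `ℤ` and `ℚ` at once through a map to `ℚ`. The factor 2 in `hφ` leaves room for the
denominator 1 of an integer. -/
theorem DepthThreeCircuit.computesMLC_count_of_rat (hw : IsTameSize w) {φ : R →+* ℚ}
    (hφ : ∀ x, ratSize (φ x) ≤ 2 * w x) (hφ' : ∀ x, w x ≤ ratSize (φ x)) :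
    ComputesMLC w .count C
      ((Program.count.weight * 56 : ℕ) * 2 ^ k * ((C.inputSize w : ℝ) + 1) ^ 5) := by
  obtain ⟨M, K, hM, hMe, hKe, hMK⟩ := isFraction_of_fintype (φ := φ)
    (fun x : Fin s × Fin k × Fin n => C.form x.1 x.2.1 x.2.2)
  have he := C.sum_ratSize_le hφ
  set e := ∑ x : Fin s × Fin k × Fin n, ratSize (φ (C.form x.1 x.2.1 x.2.2))
  have hb : ∀ q i p, IsFraction φ M K (C.entry q p i) := fun q i p =>
    C.forall_elt_inputMemory (Q := IsFraction φ M K) IsFraction.zero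
      (fun t j i => hMK (t, j, i)) _ _
  have hsize := subsetDP_size_le (m := k) (μ := fun p => 2 ^ p) (c := fun p T => T.testBit p)
    (cnt := s) (n := n) hφ' hM hMe hKe hb
  have hI : n + k + s ≤ C.inputSize w := by
    rw [DepthThreeCircuit.inputSize]; omega
  have hform := C.form_le_inputSize (w := w)
  set I := C.inputSize w
  have := hw.zero
  have := hw.one
  refine C.computesMLC_count (W := 2 * (s + (e + k) * n) + 3 + I) hw (by omega) (by omega)
    (fun t j i => (hform t j i).trans (by omega))
    (fun q _ i hi T _ p hp => (hsize.1 q i hi T p hp).trans (by omega))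
    (fun q hq => (hsize.2 q hq _).trans (by omega)) hI ?_ two_ne_zero
  have : (e + k) * n ≤ (3 * I) * I := Nat.mul_le_mul (by omega) (by omega)
  nlinarith

/-- A sum of squares of integers vanishes only if every term does, so no cancellation between
monomials can hide a nonzero coefficient. -/
theorem DepthThreeCircuit.decidesMMD_detectInt {n k s : ℕ} (C : DepthThreeCircuit ℤ n k s) :
    DecidesMMD intSize .detectInt C
      ((Program.detectInt.weight * 60 : ℕ) * 4 ^ k * ((C.inputSize intSize : ℝ) + 1) ^ 8) := by
  have hφ : ∀ x : ℤ, ratSize (Int.castRingHom ℚ x) ≤ 2 * intSize x := fun x => by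
    simp only [eq_intCast, ratSize_intCast]
    simp only [intSize]
    omega
  have hφ' : ∀ x : ℤ, intSize x ≤ ratSize (Int.castRingHom ℚ x) := fun x => by
    simp [ratSize_intCast]
  obtain ⟨M, K, hM, hMe, hKe, hMK⟩ := isFraction_of_fintype (φ := Int.castRingHom ℚ)
    (fun x : Fin s × Fin k × Fin n => C.form x.1 x.2.1 x.2.2)
  have he := C.sum_ratSize_le hφ
  set e := ∑ x : Fin s × Fin k × Fin n, ratSize (Int.castRingHom ℚ (C.form x.1 x.2.1 x.2.2))
  have hb : ∀ q i p, IsFraction (Int.castRingHom ℚ) M K (C.entry q p i) := fun q i p =>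
    C.forall_elt_inputMemory (Q := IsFraction (Int.castRingHom ℚ) M K) IsFraction.zero
      (fun t j i => hMK (t, j, i)) _ _
  -- Each move multiplies by two input coefficients, hence the denominator `M * M`, the numerator
  -- bound `K * K` and the exponent `e + e`.
  have hsize := subsetDP_size_le (m := k * k) (μ := fun p => 2 ^ (p / k) + 2 ^ (k + p % k))
    (c := fun p T => T.testBit (p / k) && T.testBit (k + p % k))
    (cnt := s * s) (n := n) (e := e + e) hφ' (Nat.mul_ne_zero hM hM)
    (by rw [pow_add]; exact Nat.mul_le_mul hMe hMe) (by rw [pow_add]; exact Nat.mul_le_mul hKe hKe)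
    (b := fun q i p => C.entry (q / s) (p / k) i * C.entry (q % s) (p % k) i)
    (fun q i p => (hb _ _ _).mul (hb _ _ _))
  have hI : n + k + s ≤ C.inputSize intSize := by
    rw [DepthThreeCircuit.inputSize]; omega
  have hform := C.form_le_inputSize (w := intSize)
  set I := C.inputSize intSize
  have hw := isTameSize_intSize
  have := hw.zero
  have := hw.one
  set W := 2 * (s * s + (e + e + k * k) * n) + 3 + I with hW
  have hrun : Runs intSize (addressBits n k s) W .detectInt
      (2 * ((s * s + 1) * ((n + 1) * ((2 ^ (k + k) + 1) * (k * k + 1)))))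
      C.inputMemory fun τ => (HasMultilinearMonomial k C.poly → τ.num 1 0 = 1) ∧
        (¬ HasMultilinearMonomial k C.poly → τ.num 1 0 = 0) := by
    refine Runs.seq (C.runs_sumSquares hw (by omega) (by omega)
      (fun q _ i hi T _ p hp => (hsize.1 q i hi T p hp).trans (by omega))
      (fun q hq => (hsize.2 q hq _).trans (by omega))) ?_
    rintro τ - ⟨hτ, hτ'⟩
    have hX : 1 ≤ 2 * ((s * s + 1) * ((n + 1) * ((2 ^ (k + k) + 1) * (k * k + 1)))) :=
      Nat.one_le_iff_ne_zero.2 (by positivity)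
    have hiff : τ.elt 1 0 = 0 ↔ ¬ HasMultilinearMonomial k C.poly := by
      rw [hτ', C.hasMultilinearMonomial_iff, Finset.sum_eq_zero_iff_of_nonneg
        fun _ _ => sq_nonneg _]
      simp
    refine Runs.branch hw hX (fun hz => Runs.skip hX ?_) (fun hz => Runs.setNum hX ?_ ?_)
    · have hz : τ.elt 1 0 = 0 := hz
      exact ⟨fun h => absurd h (hiff.1 hz), fun _ => hτ⟩
    · simp [NumExpr.eval, addressBits]
    · have hz : ¬ τ.elt 1 0 = 0 := hz
      exact ⟨fun _ => by simp [NumExpr.eval], fun h => absurd (hiff.2 h) hz⟩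
  obtain ⟨τ, t, hex, ht, -, hτ⟩ := hrun
    (C.bounded_inputMemory (lt_two_pow_addressBits (by omega)) (lt_two_pow_addressBits (by omega))
      (lt_two_pow_addressBits (by omega)) (by omega) fun t j i => (hform t j i).trans (by omega))
  refine ⟨τ, t, hex, ?_, hτ⟩
  have hU : addressBits n k s + W + 1 ≤ 15 * (I + 1) ^ 3 := by
    have h1 : k * k ≤ I * I := Nat.mul_le_mul (by omega) (by omega)
    have h2 : s * s ≤ I * I := Nat.mul_le_mul (by omega) (by omega)
    have h3 : (e + e + k * k) * n ≤ (4 * I + I * I) * I := Nat.mul_le_mul (by omega) (by omega)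
    simp only [addressBits, hW]
    nlinarith [Nat.zero_le (I * I), Nat.zero_le (I * I * I)]
  have h4 : 2 ^ (k + k) + 1 ≤ 2 * 4 ^ k := by
    have : 1 ≤ 4 ^ k := Nat.one_le_pow _ _ (by simp)
    have : 2 ^ (k + k) = 4 ^ k := by rw [← two_mul, pow_mul]; norm_num
    omega
  have hsq : ∀ x, x ≤ I → x * x + 1 ≤ (I + 1) * (I + 1) := fun x hx => by nlinarith
  have key : t ≤ Program.detectInt.weight * 60 * 4 ^ k * (I + 1) ^ 8 := by
    calc t ≤ _ := ht
      _ ≤ Program.detectInt.weight * (2 * (((I + 1) * (I + 1)) * ((I + 1) * ((2 * 4 ^ k) *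
          ((I + 1) * (I + 1)))))) * (15 * (I + 1) ^ 3) := by
        gcongr
        · exact hsq s (by omega)
        · omega
        · exact hsq k (by omega)
      _ = _ := by ring
  exact_mod_cast key

end Bounds

/-! ### Echelon systems and their annihilators -/

/-- The vector `P r` has its entries before position `r` equal to zero, and vanishes if its entry at
position `r` does. -/
def IsEchelon {F : Type*} [Zero F] (N : ℕ) (P : ℕ → ℕ → F) : Prop :=
  ∀ r < N, (∀ x < r, P r x = 0) ∧ (P r r = 0 → P r = 0)

/-- The functional vanishes on the first `N` vectors of the family. -/
def Annihilates {F : Type*} [Field F] (φ : (ℕ → F) →ₗ[F] F) (N : ℕ) (P : ℕ → ℕ → F) : Prop :=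
  ∀ r < N, φ (P r) = 0

/-- The vector with the first `N` entries of `f` and zeros afterwards. -/
def truncate {F : Type*} [Zero F] (N : ℕ) (f : ℕ → F) : ℕ → F := fun x => if x < N then f x else 0

theorem truncate_congr {F : Type*} [Zero F] {N : ℕ} {f g : ℕ → F} (h : ∀ x < N, f x = g x) :
    truncate N f = truncate N g := by
  funext x
  simp only [truncate]
  split_ifs with hx
  exacts [h x hx, rfl]

section Echelon

variable {F : Type*} [Field F] {N c : ℕ} {P : ℕ → ℕ → F} {v : ℕ → F}

theorem IsEchelon.update (h : IsEchelon N P) (hv : ∀ x < c, v x = 0) (hvc : v c ≠ 0) :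
    IsEchelon N (Function.update P c v) := by
  intro r hr
  rcases eq_or_ne r c with rfl | hne
  · simpa [hvc] using hv
  · simpa [hne] using h r hr

/-- In an echelon system a row with zero pivot is zero, so overwriting it loses nothing from the
span. -/
theorem IsEchelon.annihilates_update_iff (h : IsEchelon N P) (hc : c < N) (hP : P c c = 0)
    (φ : (ℕ → F) →ₗ[F] F) :
    Annihilates φ N (Function.update P c v) ↔ Annihilates φ N P ∧ φ v = 0 := by
  constructor
  · refine fun h' => ⟨fun r hr => ?_, by simpa using h' c hc⟩
    rcases eq_or_ne r c with rfl | hne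
    · rw [(h r hr).2 hP, map_zero]
    · simpa [hne] using h' r hr
  · rintro ⟨h1, h2⟩ r hr
    rcases eq_or_ne r c with rfl | hne
    · simpa using h2
    · simpa [hne] using h1 r hr

/-- The machine does not divide ring elements. Cross-multiplied elimination replaces `v` by a
nonzero multiple of itself modulo a row of the system. -/
theorem Annihilates.map_reduce_eq_zero_iff {φ : (ℕ → F) →ₗ[F] F} (h : Annihilates φ N P)
    (hc : c < N) (hP : P c c ≠ 0) : φ (P c c • v - v c • P c) = 0 ↔ φ v = 0 := by
  rw [map_sub, map_smul, map_smul, h c hc, smul_zero, sub_zero, smul_eq_zero]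
  simp [hP]

theorem IsEchelon.reduce_apply_eq_zero (h : IsEchelon N P) (hc : c < N) (hv : ∀ x < c, v x = 0)
    {x : ℕ} (hx : x < c + 1) : (P c c • v - v c • P c) x = 0 := by
  rcases (Nat.lt_succ_iff.1 hx).lt_or_eq with hx | rfl
  · simp [hv x hx, (h c hc).1 x hx]
  · simp [mul_comm]

end Echelon

/-! ### The state vectors -/

theorem Nat.sub_two_pow_div_two_pow {x j k : ℕ} (h : x.testBit j) (hj : j < k) :
    (x - 2 ^ j) / 2 ^ k = x / 2 ^ k := by
  apply Nat.eq_of_testBit_eq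
  intro q
  rw [Nat.testBit_div_two_pow, Nat.testBit_div_two_pow, Nat.testBit_sub_two_pow h]
  have : q + k ≠ j := by omega
  simp [this]

section StateVector

variable {F : Type*} [Field F] {n k s : ℕ} (C : DepthThreeCircuit F n k s)

/-- The coefficients of the multilinear monomial with the variables in `S` in all subproducts of the
products of the circuit. The entry at `t * 2 ^ k + T` belongs to the forms in `T` of the `t`-th
product. -/
noncomputable def DepthThreeCircuit.stateVector (S : Finset (Fin n)) : ℕ → F := fun x =>
  if h : x / 2 ^ k < s then formProdCoeff (C.form ⟨x / 2 ^ k, h⟩) S (bitSet k 0 x) else 0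

/-- The entry at `x` of the state vector obtained by adding the variable `i`. -/
def DepthThreeCircuit.transition (i : ℕ) (v : ℕ → F) (x : ℕ) : F :=
  ∑ j ∈ Finset.range k, if x.testBit j then C.entry (x / 2 ^ k) j i * v (x - 2 ^ j) else 0

/-- The linear map on state vectors that corresponds to adding the variable `i`. -/
def DepthThreeCircuit.transitionMap (i : ℕ) : (ℕ → F) →ₗ[F] (ℕ → F) where
  toFun v := truncate (s * 2 ^ k) (C.transition i v)
  map_add' u v := by
    funext x
    simp only [truncate, DepthThreeCircuit.transition, Pi.add_apply]
    split_ifs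
    · rw [← Finset.sum_add_distrib]
      refine Finset.sum_congr rfl fun j _ => ?_
      split_ifs
      · ring
      · simp
    · simp
  map_smul' a v := by
    funext x
    simp only [truncate, DepthThreeCircuit.transition, Pi.smul_apply, smul_eq_mul,
      RingHom.id_apply]
    split_ifs
    · rw [Finset.mul_sum]
      refine Finset.sum_congr rfl fun j _ => ?_
      split_ifs
      · ring
      · simp
    · simp

/-- The recursion for coefficients only refers to subproducts of the same product gate, and its
factors do not depend on `S`; so one linear map serves all sets that avoid `i`. -/
theorem DepthThreeCircuit.transitionMap_stateVector {i : ℕ} (hi : i < n) {S : Finset (Fin n)}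
    (hS : ⟨i, hi⟩ ∉ S) :
    C.transitionMap i (C.stateVector S) = C.stateVector (insert ⟨i, hi⟩ S) := by
  funext x
  have hiff : x < s * 2 ^ k ↔ x / 2 ^ k < s := (Nat.div_lt_iff_lt_mul (by positivity)).symm
  simp only [DepthThreeCircuit.transitionMap, LinearMap.coe_mk, AddHom.coe_mk, truncate,
    DepthThreeCircuit.stateVector, hiff]
  split_ifs with h
  · rw [formProdCoeff_insert_bitSet C h hi hS]
    refine Finset.sum_congr rfl fun j hj => ?_
    have hj := Finset.mem_range.1 hj
    by_cases hx : x.testBit j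
    · have e := Nat.sub_two_pow_div_two_pow hx hj
      have hv : C.stateVector S (x - 2 ^ j) =
          formProdCoeff (C.form ⟨x / 2 ^ k, h⟩) S (bitSet k 0 (x - 2 ^ j)) := by
        simp only [DepthThreeCircuit.stateVector, e, h, dif_pos]
      simp only [hx, if_true, zero_add, hv]
    · simp [hx]
  · rfl

theorem DepthThreeCircuit.stateVector_empty (x : ℕ) :
    C.stateVector ∅ x = if x / 2 ^ k < s ∧ x % 2 ^ k = 0 then 1 else 0 := by
  have : bitSet k 0 x = ∅ ↔ x % 2 ^ k = 0 := by
    rw [bitSet_eq_empty_iff]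
    constructor
    · intro h
      refine Nat.eq_zero_of_testBit_lt (N := k) (Nat.mod_lt _ (by positivity)) fun j hj => ?_
      have := h j hj
      rw [zero_add] at this
      simp [Nat.testBit_mod_two_pow, this]
    · intro h j hj
      have := Nat.testBit_mod_two_pow x k j
      rw [h] at this
      simpa [hj] using this.symm
  simp only [DepthThreeCircuit.stateVector, formProdCoeff_empty, this, ite_and]
  split_ifs <;> rfl

/-- The sum of the entries that belong to the full products. -/
def fullEntrySum (F : Type*) [Field F] (k s : ℕ) : (ℕ → F) →ₗ[F] F :=
  ∑ t ∈ Finset.range s, LinearMap.proj (t * 2 ^ k + 2 ^ k - 1)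

theorem fullEntrySum_apply (v : ℕ → F) :
    fullEntrySum F k s v = ∑ t ∈ Finset.range s, v (t * 2 ^ k + 2 ^ k - 1) := by
  simp [fullEntrySum]

theorem DepthThreeCircuit.fullEntrySum_stateVector (S : Finset (Fin n)) :
    fullEntrySum F k s (C.stateVector S) = ∑ t, formProdCoeff (C.form t) S Finset.univ := by
  rw [fullEntrySum_apply, Finset.sum_range]
  refine Finset.sum_congr rfl fun t _ => ?_
  have hk : 2 ^ k - 1 < 2 ^ k := Nat.sub_lt (by positivity) one_pos
  have e : t.val * 2 ^ k + 2 ^ k - 1 = 2 ^ k * t + (2 ^ k - 1) := by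
    rw [mul_comm]; omega
  have h1 : (t.val * 2 ^ k + 2 ^ k - 1) / 2 ^ k = t := by
    rw [e, Nat.mul_add_div (by positivity), Nat.div_eq_of_lt hk, add_zero]
  have h2 : bitSet k 0 (t.val * 2 ^ k + 2 ^ k - 1) = Finset.univ := by
    ext j
    rw [e, bitSet]
    simp [Nat.testBit_two_pow_mul_add _ hk]
  simp only [DepthThreeCircuit.stateVector, h1, h2, t.2, dif_pos]

/-- The dual form of `V_(i+1) = V_i + M_i V_i`, by splitting the sets according to whether they
contain variable `i`. -/
theorem DepthThreeCircuit.forall_stateVector_succ_iff {i : ℕ} (hi : i < n)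
    (φ : (ℕ → F) →ₗ[F] F) :
    (∀ S ⊆ Finset.univ.filter fun x : Fin n => x.val < i + 1, φ (C.stateVector S) = 0) ↔
      (∀ S ⊆ Finset.univ.filter fun x : Fin n => x.val < i, φ (C.stateVector S) = 0) ∧
      ∀ S ⊆ Finset.univ.filter fun x : Fin n => x.val < i,
        φ (C.transitionMap i (C.stateVector S)) = 0 := by
  have hmem : ∀ S ⊆ Finset.univ.filter fun x : Fin n => x.val < i, (⟨i, hi⟩ : Fin n) ∉ S :=
    fun S hS h => by simpa using hS h
  rw [Fin.filter_val_lt_succ hi]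
  constructor
  · refine fun h => ⟨fun S hS => h S (hS.trans (Finset.subset_insert _ _)), fun S hS => ?_⟩
    rw [C.transitionMap_stateVector hi (hmem S hS)]
    exact h _ (Finset.insert_subset_insert _ hS)
  · rintro ⟨h1, h2⟩ S hS
    by_cases hiS : (⟨i, hi⟩ : Fin n) ∈ S
    · have hS' := Finset.subset_insert_iff.1 hS
      have := h2 _ hS'
      rwa [C.transitionMap_stateVector hi (hmem _ hS'), Finset.insert_erase hiS] at this
    · exact h1 S ((Finset.subset_insert_iff_of_notMem hiS).1 hS)

end StateVector

/-! ### The program for detection over fields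

Scalar variables: 8 holds the number `N` of entries of a state vector, and 9 holds `N * N`. The array
2 of ring elements holds an echelon system of `N` vectors, the array 3 a copy of it, and the array 4
the current vector. The number arrays 10 to 15 are loop counters. -/

/-- Add the contribution of one linear form to the current entry of the new vector. -/
def Program.applyForm : Program :=
  .branch (.eq (.bit (.var 13) (.var 14)) (.lit 1))
    (.setElt 4 (.var 13) (.add (.read 4 (.var 13))
      (.mul (.coefficient (.div (.var 13) (.read 5 (.var 3))) (.var 14) (.var 10))
        (.read 3 (.add (.mul (.var 12) (.var 8)) (.sub (.var 13) (.read 5 (.var 14)))))))) .skip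

/-- Apply the transition map of the current variable to a row of the copied system. -/
def Program.applyTransition : Program :=
  .forLoop 13 8 (.seq (.setElt 4 (.var 13) .zero) (.forLoop 14 3 .applyForm))

/-- The index of the entry `x` of the row `r`. -/
def NumExpr.entryIndex (r x : NumExpr) : NumExpr := .add (.mul r (.var 8)) x

/-- Move the current vector to a row of the echelon system. -/
def Program.storeVector : Program :=
  .forLoop 15 8 (.seq (.setElt 2 (.entryIndex (.var 13) (.var 15)) (.read 4 (.var 15)))
    (.setElt 4 (.var 15) .zero))

/-- Eliminate an entry of the current vector by means of a row of the echelon system. -/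
def Program.reduceVector : Program :=
  .seq (.setElt 5 (.lit 0) (.read 2 (.entryIndex (.var 13) (.var 13)))) <|
  .seq (.setElt 5 (.lit 1) (.read 4 (.var 13))) <|
  .forLoop 15 8 (.setElt 4 (.var 15)
    (.sub (.mul (.read 5 (.lit 0)) (.read 4 (.var 15)))
      (.mul (.read 5 (.lit 1)) (.read 2 (.entryIndex (.var 13) (.var 15))))))

/-- Insert the current vector into the echelon system. -/
def Program.insertVector : Program :=
  .forLoop 13 8 (.branch (.isZero (.read 4 (.var 13))) .skip
    (.branch (.isZero (.read 2 (.entryIndex (.var 13) (.var 13)))) .storeVector .reduceVector))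

/-- Treat one variable. -/
def Program.extendSystem : Program :=
  .seq (.forLoop 11 9 (.setElt 3 (.var 11) (.read 2 (.var 11))))
    (.forLoop 12 8 (.seq .applyTransition .insertVector))

/-- Test whether the sum of the full entries vanishes for all rows of the echelon system. -/
def Program.testRows : Program :=
  .forLoop 12 8 <|
  .seq (.setElt 5 (.lit 0) .zero) <|
  .seq (.forLoop 13 4 (.setElt 5 (.lit 0) (.add (.read 5 (.lit 0))
    (.read 2 (.entryIndex (.var 12) (.sub (.add (.mul (.var 13) (.read 5 (.var 3)))
      (.read 5 (.var 3))) (.lit 1))))))) <|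
  .branch (.isZero (.read 5 (.lit 0))) .skip (.setNum 1 (.lit 0) (.lit 1))

/-- The program for the multilinear detection problem over fields. -/
def Program.detectField : Program :=
  .seq .prepare <|
  .seq (.setNum 8 (.lit 0) (.mul (.var 4) (.read 5 (.var 3)))) <|
  .seq (.setNum 9 (.lit 0) (.mul (.var 8) (.var 8))) <|
  .seq (.forLoop 13 4 (.setElt 2 (.mul (.var 13) (.read 5 (.var 3))) .one)) <|
  .seq (.forLoop 10 2 .extendSystem) .testRows

/-- The rows of the system of `N` vectors stored in the given array. -/
def Memory.rows {F : Type*} [Zero F] (N : ℕ) (f : ℕ → F) (r : ℕ) : ℕ → F :=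
  truncate N fun x => f (r * N + x)

theorem Nat.mul_add_eq_mul_add_iff {N r c x y : ℕ} (hx : x < N) (hy : y < N) :
    r * N + x = c * N + y ↔ r = c ∧ x = y := by
  constructor
  · intro h
    have h1 : (r * N + x) / N = r := by
      rw [mul_comm, Nat.mul_add_div (by omega), Nat.div_eq_of_lt hx, add_zero]
    have h2 : (c * N + y) / N = c := by
      rw [mul_comm, Nat.mul_add_div (by omega), Nat.div_eq_of_lt hy, add_zero]
    have : r = c := by rw [← h1, h, h2]
    subst this
    exact ⟨rfl, by omega⟩
  · rintro ⟨rfl, rfl⟩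
    rfl

/-- The parameters of the elimination are in the memory, and the bound `L` on the number of bits is
large enough. -/
structure DepthThreeCircuit.IsEliminating {F : Type*} [Field F] {n k s : ℕ}
    (C : DepthThreeCircuit F n k s) (L : ℕ) (σ : Memory F) : Prop where
  numVars : σ.num 2 0 = n
  degree : σ.num 3 0 = k
  fanIn : σ.num 4 0 = s
  twoPow : ∀ j ≤ k, σ.num 5 j = 2 ^ j
  numEntries : σ.num 8 0 = s * 2 ^ k
  numCells : σ.num 9 0 = s * 2 ^ k * (s * 2 ^ k)
  elt : σ.elt 0 = C.inputMemory.elt 0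
  numVars_lt : n < 2 ^ L
  degree_lt : k < 2 ^ L
  fanIn_lt : s < 2 ^ L
  numEntries_lt : s * 2 ^ k < 2 ^ L
  numCells_lt : s * 2 ^ k * (s * 2 ^ k) < 2 ^ L

/-! ### Correctness of the transition step and of Gaussian elimination -/

section Elimination

variable {F : Type*} [Field F] {n k s L : ℕ} {C : DepthThreeCircuit F n k s} {σ τ : Memory F}

theorem DepthThreeCircuit.IsEliminating.of_agreeOff (h : C.IsEliminating L σ)
    (hA : Memory.AgreeOff [1, 10, 11, 12, 13, 14, 15] [2, 3, 4, 5] σ τ) : C.IsEliminating L τ :=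
  { h with
    numVars := by rw [hA.num 2 (by simp), h.numVars]
    degree := by rw [hA.num 3 (by simp), h.degree]
    fanIn := by rw [hA.num 4 (by simp), h.fanIn]
    twoPow := fun j hj => by rw [hA.num 5 (by simp), h.twoPow j hj]
    numEntries := by rw [hA.num 8 (by simp), h.numEntries]
    numCells := by rw [hA.num 9 (by simp), h.numCells]
    elt := by rw [hA.elt 0 (by simp), h.elt] }

theorem runs_unitSize_setElt {X W : ℕ} {a : ℕ} {i : NumExpr} {x : EltExpr} {Q : Memory F → Prop}
    (hX : 1 ≤ X) (hQ : Q (σ.setElt a (i.eval σ) (x.eval σ))) :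
    Runs unitSize L W (.setElt a i x) X σ Q :=
  Runs.setElt isTameSize_unitSize hX (Nat.zero_le _) hQ

theorem runs_unitSize_setElt_seq {X W : ℕ} {a : ℕ} {i : NumExpr} {x : EltExpr} {q : Program}
    {Q : Memory F → Prop} (hX : 1 ≤ X)
    (hq : Runs unitSize L W q X (σ.setElt a (i.eval σ) (x.eval σ)) Q) :
    Runs unitSize L W (.seq (.setElt a i x) q) X σ Q :=
  Runs.setElt_seq isTameSize_unitSize hX (Nat.zero_le _) hq

namespace DepthThreeCircuit.IsEliminating

theorem runs_applyTransition (h : C.IsEliminating L σ) {r i : ℕ} (hr : σ.num 12 0 = r)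
    (hi : σ.num 10 0 = i) :
    Runs unitSize L 0 .applyTransition ((s * 2 ^ k + 1) * (k + 1)) σ fun τ =>
      truncate (s * 2 ^ k) (τ.elt 4) =
        C.transitionMap i (Memory.rows (s * 2 ^ k) (σ.elt 3) r) := by
  set N := s * 2 ^ k with hN
  refine (Runs.forLoop (m := N) (X := (k + 1) * 1) (I := fun c τ => ∀ x < c, τ.elt 4 x =
    C.transition i (Memory.rows N (σ.elt 3) r) x) isTameSize_unitSize (by omega) h.numEntries_lt
    (by simp [Program.numWrites, Program.applyForm, Program.forLoop])
    (by simp [Program.numWrites, Program.applyForm, Program.forLoop]) h.numEntries (by simp)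
    ?_).mono (by simp) fun τ _ hτ => truncate_congr hτ.2
  intro c hc τ hA hτc hI
  refine runs_unitSize_setElt_seq (by omega) ?_
  have hA₁ : Memory.AgreeOff [13, 14] [4] σ (τ.setElt 4 ((NumExpr.var 13).eval τ)
      (EltExpr.zero.eval τ)) := (hA.mono (by simp [Program.numWrites, Program.applyForm,
        Program.forLoop]) (by simp [Program.eltWrites, Program.applyForm,
        Program.forLoop])).setElt (by simp)
  have hI₁ : ∀ x < c, (τ.setElt 4 ((NumExpr.var 13).eval τ) (EltExpr.zero.eval τ)).elt 4 x =
      C.transition i (Memory.rows N (σ.elt 3) r) x := fun x hx => by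
    simpa [NumExpr.eval, hτc, hx.ne] using hI x hx
  have h0 : (τ.setElt 4 ((NumExpr.var 13).eval τ) (EltExpr.zero.eval τ)).elt 4 c = 0 := by
    simp [NumExpr.eval, EltExpr.eval, hτc]
  have hc₁ : (τ.setElt 4 ((NumExpr.var 13).eval τ) (EltExpr.zero.eval τ)).num 13 0 = c := hτc
  generalize τ.setElt 4 ((NumExpr.var 13).eval τ) (EltExpr.zero.eval τ) = υ at hA₁ hI₁ h0 hc₁
  have hE := h.of_agreeOff (hA₁.mono (by simp) (by simp))
  refine (Runs.forLoop (m := k) (X := 1) (I := fun p τ => (∀ x < c, τ.elt 4 x = υ.elt 4 x) ∧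
    τ.elt 4 c = ∑ j ∈ Finset.range p, if c.testBit j then
      C.entry (c / 2 ^ k) j i * Memory.rows N (σ.elt 3) r (c - 2 ^ j) else 0)
    isTameSize_unitSize le_rfl h.degree_lt (by simp [Program.numWrites, Program.applyForm])
    (by simp [Program.numWrites, Program.applyForm]) hE.degree (by simp [h0]) ?_).mono le_rfl ?_
  · intro p hp ν hA₂ hνp hJ
    have hA₂' : Memory.AgreeOff [14] [4] υ ν := hA₂.mono
      (by simp [Program.numWrites, Program.applyForm])
      (by simp [Program.eltWrites, Program.applyForm])
    have hE' := hE.of_agreeOff (hA₂'.mono (by simp) (by simp))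
    have hνc : ν.num 13 0 = c := by rw [hA₂'.num 13 (by simp), hc₁]
    have hνr : ν.num 12 0 = r := by rw [hA₂'.num 12 (by simp), hA₁.num 12 (by simp), hr]
    have hνi : ν.num 10 0 = i := by rw [hA₂'.num 10 (by simp), hA₁.num 10 (by simp), hi]
    have hν3 : ν.elt 3 = σ.elt 3 := by rw [hA₂'.elt 3 (by simp), hA₁.elt 3 (by simp)]
    have hbit : (Test.eq (.bit (.var 13) (.var 14)) (.lit 1)).holds ν ↔ c.testBit p := by
      simp [Test.holds, NumExpr.bit, NumExpr.eval, hνc, hνp, hE'.twoPow p hp.le,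
        Nat.testBit_eq_decide_div_mod_eq]
    refine Runs.branch isTameSize_unitSize le_rfl (fun hb => ?_) (fun hb => ?_)
    · have hb := hbit.1 hb
      have hlt : c - 2 ^ p < N := lt_of_le_of_lt (Nat.sub_le _ _) hc
      refine runs_unitSize_setElt le_rfl ⟨fun x hx => ?_, ?_⟩
      · simpa [NumExpr.eval, hνc, hx.ne] using hJ.1 x hx
      · simp only [NumExpr.eval, EltExpr.eval, EltExpr.coefficient, hνc, hνp, hνr, hνi, hν3,
          hE'.degree, hE'.numVars, hE'.numEntries, hE'.twoPow p hp.le, hE'.twoPow k le_rfl,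
          hE'.elt, Memory.setNum_elt, Memory.setElt_elt, hJ.2, Finset.sum_range_succ, hb, if_true,
          true_and, Memory.rows, truncate, ← hN, hlt, DepthThreeCircuit.entry]
    · have hb : ¬ c.testBit p := fun h' => hb (hbit.2 h')
      refine Runs.skip le_rfl ⟨by simpa using hJ.1, ?_⟩
      simp only [Memory.setNum_elt]
      rw [hJ.2, Finset.sum_range_succ, if_neg hb, add_zero]
  · rintro ν - ⟨-, h1, h2⟩ x hx
    simp only [Memory.setNum_elt]
    rcases (Nat.lt_succ_iff.1 hx).lt_or_eq with hx | rfl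
    · rw [h1 x hx, hI₁ x hx]
    · rw [h2]
      rfl

/-- Clearing the current vector while it is moved makes the later rounds of the insertion do
nothing. -/
theorem runs_storeVector (h : C.IsEliminating L σ) {c : ℕ} (hc : c < s * 2 ^ k)
    (hσc : σ.num 13 0 = c) :
    Runs unitSize L 0 .storeVector (s * 2 ^ k + 1) σ fun τ =>
      truncate (s * 2 ^ k) (τ.elt 4) = 0 ∧
      Memory.rows (s * 2 ^ k) (τ.elt 2) = Function.update (Memory.rows (s * 2 ^ k) (σ.elt 2)) c
        (truncate (s * 2 ^ k) (σ.elt 4)) := by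
  set N := s * 2 ^ k with hN
  refine (Runs.forLoop (m := N) (X := 1) (I := fun y τ => ∀ x < N,
    τ.elt 4 x = (if x < y then 0 else σ.elt 4 x) ∧ ∀ r, τ.elt 2 (r * N + x) =
      if r = c ∧ x < y then σ.elt 4 x else σ.elt 2 (r * N + x)) isTameSize_unitSize
    le_rfl h.numEntries_lt (by simp [Program.numWrites]) (by simp [Program.numWrites])
    h.numEntries (by simp) ?_).mono (by omega) ?_
  · intro y hy τ hA hτy hI
    have hE := h.of_agreeOff (hA.mono (by simp [Program.numWrites]) (by simp [Program.eltWrites]))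
    have hτc : τ.num 13 0 = c := by rw [hA.num 13 (by simp [Program.numWrites]), hσc]
    refine runs_unitSize_setElt_seq le_rfl (runs_unitSize_setElt le_rfl fun x hx => ⟨?_, ?_⟩)
    · simp only [NumExpr.eval, EltExpr.eval, NumExpr.entryIndex, Memory.setNum_elt,
        Memory.setElt_elt, Memory.setElt_num, hτy, (hI x hx).1]
      by_cases hxy : x = y
      · simp [hxy]
      · simp only [hxy, and_false, if_false, show (4 : ℕ) ≠ 2 by simp, false_and]
        congr 1
        apply propext
        omega
    · intro r
      simp only [NumExpr.eval, EltExpr.eval, NumExpr.entryIndex, Memory.setNum_elt,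
        Memory.setElt_elt, Memory.setElt_num, hτy, hτc, hE.numEntries, ← hN, (hI x hx).2 r,
        (hI y hy).1, Nat.mul_add_eq_mul_add_iff hx hy, lt_irrefl, if_false,
        show (2 : ℕ) ≠ 4 by simp, false_and, true_and]
      by_cases hxy : x = y
      · subst hxy
        by_cases hrc : r = c <;> simp [hrc]
      · simp only [hxy, and_false, if_false]
        congr 2
        apply propext
        omega
  · rintro τ - ⟨-, hI⟩
    refine ⟨?_, ?_⟩
    · funext x
      simp only [truncate, Pi.zero_apply]
      split_ifs with hx
      · rw [(hI x hx).1, if_pos hx]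
      · rfl
    · funext r
      rcases eq_or_ne r c with rfl | hrc
      · rw [Function.update_self]
        exact truncate_congr fun x hx => by rw [(hI x hx).2 r, if_pos ⟨rfl, hx⟩]
      · rw [Function.update_of_ne hrc]
        exact truncate_congr fun x hx => by rw [(hI x hx).2 r, if_neg fun h => hrc h.1]

/-- The two multipliers are saved beforehand, since the loop overwrites entry `c` of the current
vector. -/
theorem runs_reduceVector (h : C.IsEliminating L σ) {c : ℕ} (hc : c < s * 2 ^ k)
    (hσc : σ.num 13 0 = c) :
    Runs unitSize L 0 .reduceVector (s * 2 ^ k + 1) σ fun τ =>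
      truncate (s * 2 ^ k) (τ.elt 4) =
        Memory.rows (s * 2 ^ k) (σ.elt 2) c c • truncate (s * 2 ^ k) (σ.elt 4) -
          truncate (s * 2 ^ k) (σ.elt 4) c • Memory.rows (s * 2 ^ k) (σ.elt 2) c ∧
      Memory.rows (s * 2 ^ k) (τ.elt 2) = Memory.rows (s * 2 ^ k) (σ.elt 2) := by
  set N := s * 2 ^ k with hN
  refine runs_unitSize_setElt_seq (by omega) (runs_unitSize_setElt_seq (by omega) ?_)
  have hidx : ∀ τ : Memory F, τ.num 13 0 = c → τ.num 8 0 = N →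
      (NumExpr.entryIndex (.var 13) (.var 13)).eval τ = c * N + c := fun τ h1 h2 => by
    simp [NumExpr.entryIndex, NumExpr.eval, h1, h2]
  simp only [EltExpr.eval, hidx σ hσc h.numEntries]
  refine (Runs.forLoop (m := N) (X := 1) (I := fun y τ => τ.elt 5 0 = σ.elt 2 (c * N + c) ∧
    τ.elt 5 1 = σ.elt 4 c ∧ τ.elt 2 = σ.elt 2 ∧ ∀ x < N, τ.elt 4 x = if x < y then
      σ.elt 2 (c * N + c) * σ.elt 4 x - σ.elt 4 c * σ.elt 2 (c * N + x) else σ.elt 4 x)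
    isTameSize_unitSize le_rfl h.numEntries_lt (by simp [Program.numWrites])
    (by simp [Program.numWrites]) ?_ ?_ ?_).mono (by omega) ?_
  · simpa using h.numEntries
  · refine ⟨by simp [NumExpr.eval], by simp [NumExpr.eval, hσc], ?_, by simp⟩
    funext x
    simp
  · intro y hy τ hA hτy hI
    have hτ8 : τ.num 8 0 = N := by
      rw [hA.num 8 (by simp [Program.numWrites])]; simpa using h.numEntries
    have hτc : τ.num 13 0 = c := by
      rw [hA.num 13 (by simp [Program.numWrites])]; simpa using hσc
    refine runs_unitSize_setElt le_rfl ⟨by simpa using hI.1, by simpa using hI.2.1, ?_, ?_⟩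
    · funext x
      simp [hI.2.2.1]
    · intro x hx
      simp only [NumExpr.eval, EltExpr.eval, NumExpr.entryIndex, Memory.setNum_elt,
        Memory.setElt_elt, hτy, hτ8, hτc, hI.1, hI.2.1, hI.2.2.1, hI.2.2.2 y hy,
        hI.2.2.2 x hx, lt_irrefl, if_false, true_and]
      by_cases hxy : x = y
      · simp [hxy]
      · simp only [hxy, if_false]
        congr 1
        apply propext
        omega
  · rintro τ - ⟨-, -, -, h2, h4⟩
    refine ⟨?_, by rw [h2]⟩
    funext x
    simp only [truncate, Memory.rows, Pi.sub_apply, Pi.smul_apply, smul_eq_mul, if_pos hc]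
    split_ifs with hx
    · rw [h4 x hx, if_pos hx]
    · simp

/-- Every round preserves the set of functionals that vanish on both the rows and the current
vector, and makes one more entry of the vector zero. In the end the vector is zero and the rows
alone carry the span. -/
theorem runs_insertVector (h : C.IsEliminating L σ)
    (hP : IsEchelon (s * 2 ^ k) (Memory.rows (s * 2 ^ k) (σ.elt 2))) :
    Runs unitSize L 0 .insertVector ((s * 2 ^ k + 1) * (s * 2 ^ k + 1)) σ fun τ =>
      IsEchelon (s * 2 ^ k) (Memory.rows (s * 2 ^ k) (τ.elt 2)) ∧
      ∀ φ : (ℕ → F) →ₗ[F] F,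
        Annihilates φ (s * 2 ^ k) (Memory.rows (s * 2 ^ k) (τ.elt 2)) ↔
          Annihilates φ (s * 2 ^ k) (Memory.rows (s * 2 ^ k) (σ.elt 2)) ∧
            φ (truncate (s * 2 ^ k) (σ.elt 4)) = 0 := by
  set N := s * 2 ^ k with hN
  have hX : 1 ≤ N + 1 := by omega
  have hw : IsTameSize (unitSize : F → ℕ) := isTameSize_unitSize
  refine (Runs.forLoop (m := N) (X := N + 1) (I := fun c τ =>
    IsEchelon N (Memory.rows N (τ.elt 2)) ∧ (∀ x < c, truncate N (τ.elt 4) x = 0) ∧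
      ∀ φ : (ℕ → F) →ₗ[F] F,
        Annihilates φ N (Memory.rows N (τ.elt 2)) ∧ φ (truncate N (τ.elt 4)) = 0 ↔
          Annihilates φ N (Memory.rows N (σ.elt 2)) ∧ φ (truncate N (σ.elt 4)) = 0)
    hw hX h.numEntries_lt
    (by simp [Program.numWrites, Program.forLoop, Program.storeVector, Program.reduceVector])
    (by simp [Program.numWrites, Program.forLoop, Program.storeVector, Program.reduceVector])
    h.numEntries (by simpa using hP) ?_).mono le_rfl ?_
  · intro c hc τ hA hτc hI
    obtain ⟨hech, hzero, hann⟩ := hI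
    have hE := h.of_agreeOff (hA.mono (by simp [Program.numWrites, Program.forLoop,
      Program.storeVector, Program.reduceVector]) (by simp [Program.eltWrites, Program.forLoop,
      Program.storeVector, Program.reduceVector]))
    have hv : truncate N (τ.elt 4) c = τ.elt 4 c := if_pos hc
    have hPc : Memory.rows N (τ.elt 2) c c = τ.elt 2 (c * N + c) := if_pos hc
    refine Runs.branch hw hX (fun hb => Runs.skip hX ⟨hech, fun x hx => ?_, hann⟩) (fun hb => ?_)
    · rcases (Nat.lt_succ_iff.1 hx).lt_or_eq with hx | rfl
      · exact hzero x hx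
      · rw [Memory.setNum_elt, hv]
        simpa [Test.holds, EltExpr.eval, NumExpr.eval, hτc] using hb
    have hvc : truncate N (τ.elt 4) c ≠ 0 := by
      rw [hv]
      simpa [Test.holds, EltExpr.eval, NumExpr.eval, hτc] using hb
    refine Runs.branch hw hX (fun hb' => ?_) (fun hb' => ?_)
    · have hPc0 : Memory.rows N (τ.elt 2) c c = 0 := by
        rw [hPc]
        simpa [Test.holds, EltExpr.eval, NumExpr.eval, NumExpr.entryIndex, hτc, hE.numEntries]
          using hb'
      refine (hE.runs_storeVector hc hτc).mono le_rfl ?_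
      rintro υ - ⟨h1, h2⟩
      simp only [Memory.setNum_elt]
      rw [← hN] at h1 h2
      rw [h1, h2]
      refine ⟨hech.update hzero hvc, by simp, fun φ => ?_⟩
      rw [map_zero, hech.annihilates_update_iff hc hPc0, ← hann φ]
      simp
    · have hPc0 : Memory.rows N (τ.elt 2) c c ≠ 0 := by
        rw [hPc]
        simpa [Test.holds, EltExpr.eval, NumExpr.eval, NumExpr.entryIndex, hτc, hE.numEntries]
          using hb'
      refine (hE.runs_reduceVector hc hτc).mono le_rfl ?_
      rintro υ - ⟨h1, h2⟩
      simp only [Memory.setNum_elt]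
      rw [← hN] at h1 h2
      rw [h1, h2]
      refine ⟨hech, fun x hx => hech.reduce_apply_eq_zero hc hzero hx, fun φ => ?_⟩
      rw [← hann φ]
      exact and_congr_right fun ha => ha.map_reduce_eq_zero_iff hc hPc0
  · rintro τ - ⟨-, h1, h2, h3⟩
    refine ⟨h1, fun φ => ?_⟩
    have : truncate N (τ.elt 4) = 0 := by
      funext x
      by_cases hx : x < N
      · exact h2 x hx
      · simp [truncate, hx]
    rw [← h3 φ, this, map_zero]
    simp

end DepthThreeCircuit.IsEliminating

end Elimination

/-! ### The span of the state vectors and the final test -/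

section Detection

variable {F : Type*} [Field F] {n k s L : ℕ} {C : DepthThreeCircuit F n k s} {σ τ : Memory F}

/-- The system of rows stored in the memory is echelon and spans the state vectors of the sets of
variables below `i`. -/
def DepthThreeCircuit.IsSystem (C : DepthThreeCircuit F n k s) (i : ℕ) (P : ℕ → ℕ → F) : Prop :=
  IsEchelon (s * 2 ^ k) P ∧ ∀ φ : (ℕ → F) →ₗ[F] F, Annihilates φ (s * 2 ^ k) P ↔
    ∀ S ⊆ Finset.univ.filter fun x : Fin n => x.val < i, φ (C.stateVector S) = 0

namespace DepthThreeCircuit.IsEliminating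

/-- The transition is applied to a copy, because the images must be those of the old rows while
insertions already modify the system. -/
theorem runs_extendSystem (h : C.IsEliminating L σ) {i : ℕ} (hi : i < n) (hσi : σ.num 10 0 = i)
    (hP : C.IsSystem i (Memory.rows (s * 2 ^ k) (σ.elt 2))) :
    Runs unitSize L 0 .extendSystem ((s * 2 ^ k + 1) * ((s * 2 ^ k + 1) * (s * 2 ^ k + k + 1))) σ
      fun τ => C.IsSystem (i + 1) (Memory.rows (s * 2 ^ k) (τ.elt 2)) := by
  set N := s * 2 ^ k with hN
  have hw : IsTameSize (unitSize : F → ℕ) := isTameSize_unitSize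
  have hX : 1 ≤ (N + 1) * (N + k + 1) := Nat.one_le_iff_ne_zero.2 (by positivity)
  have hcopy : Runs unitSize L 0 (.forLoop 11 9 (.setElt 3 (.var 11) (.read 2 (.var 11))))
      ((N + 1) * ((N + 1) * (N + k + 1))) σ fun τ => ∀ x < N * N, τ.elt 3 x = σ.elt 2 x := by
    refine (Runs.forLoop (m := N * N) (X := 1) (I := fun y τ => ∀ x < y, τ.elt 3 x = σ.elt 2 x)
      hw le_rfl h.numCells_lt (by simp [Program.numWrites]) (by simp [Program.numWrites])
      h.numCells (by simp) ?_).mono ?_ fun τ _ hτ => hτ.2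
    · intro y hy τ hA hτy hI
      refine runs_unitSize_setElt le_rfl fun x hx => ?_
      have h2 : τ.elt 2 = σ.elt 2 := hA.elt 2 (by simp [Program.eltWrites])
      rcases (Nat.lt_succ_iff.1 hx).lt_or_eq with hx | rfl
      · simpa [NumExpr.eval, hτy, hx.ne] using hI x hx
      · simp [NumExpr.eval, EltExpr.eval, hτy, h2]
    · calc (N * N + 1) * 1 ≤ (N + 1) * (N + 1) := by nlinarith
        _ ≤ (N + 1) * (N + 1) * (N + k + 1) := Nat.le_mul_of_pos_right _ (by omega)
        _ = _ := by ring
  refine hcopy.seq fun τ hA hτ => ?_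
  have hA' : Memory.AgreeOff [11] [3] σ τ := hA.mono (by simp [Program.numWrites, Program.forLoop])
    (by simp [Program.eltWrites, Program.forLoop])
  have hE := h.of_agreeOff (hA'.mono (by simp) (by simp))
  set P := Memory.rows N (σ.elt 2) with hPdef
  have h3 : ∀ r < N, Memory.rows N (τ.elt 3) r = P r := fun r hr =>
    truncate_congr fun x hx => hτ _ (by nlinarith)
  have h2 : Memory.rows N (τ.elt 2) = P := by rw [hA'.elt 2 (by simp)]
  have hwr : (Program.seq .applyTransition .insertVector).numWrites ⊆ [13, 14, 15] := by
    simp [Program.numWrites, Program.forLoop, Program.applyTransition, Program.applyForm,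
      Program.insertVector, Program.storeVector, Program.reduceVector]
  have hwr' : (Program.seq .applyTransition .insertVector).eltWrites ⊆ [2, 4, 5] := by
    simp [Program.eltWrites, Program.forLoop, Program.applyTransition, Program.applyForm,
      Program.insertVector, Program.storeVector, Program.reduceVector]
  refine (Runs.forLoop (m := N) (X := (N + 1) * (N + k + 1)) (I := fun r τ =>
    IsEchelon N (Memory.rows N (τ.elt 2)) ∧ ∀ φ : (ℕ → F) →ₗ[F] F,
      Annihilates φ N (Memory.rows N (τ.elt 2)) ↔
        Annihilates φ N P ∧ ∀ r' < r, φ (C.transitionMap i (P r')) = 0)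
    hw hX h.numEntries_lt (fun h => by
      rcases List.mem_cons.1 h with h | h
      · simp at h
      · simpa using hwr h) (fun h => by simpa using hwr h) hE.numEntries
    (by simpa [h2] using hP.1) ?_).mono le_rfl ?_
  · intro r hr υ hAυ hυr hI
    have hAυ' : Memory.AgreeOff [12, 13, 14, 15] [2, 4, 5] τ υ :=
      hAυ.mono (List.cons_subset_cons _ hwr) hwr'
    have hEυ := hE.of_agreeOff (hAυ'.mono (by simp) (by simp))
    refine Runs.seq ((hEυ.runs_applyTransition (i := i) hυr (by
      rw [hAυ'.num 10 (by simp), hA'.num 10 (by simp), hσi])).mono (by gcongr; omega)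
      fun _ _ h => h) fun ν hAν hν => ?_
    have hAν' : Memory.AgreeOff [13, 14] [4] υ ν :=
      hAν.mono (by simp [Program.numWrites, Program.forLoop, Program.applyTransition,
        Program.applyForm]) (by simp [Program.eltWrites, Program.forLoop, Program.applyTransition,
        Program.applyForm])
    have hEν := hEυ.of_agreeOff (hAν'.mono (by simp) (by simp))
    have hν2 : ν.elt 2 = υ.elt 2 := hAν'.elt 2 (by simp)
    rw [← hN, hAυ'.elt 3 (by simp), h3 r hr] at hν
    refine (hEν.runs_insertVector (by rw [hν2]; exact hI.1)).mono
      (by rw [← hN]; gcongr; omega) ?_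
    rintro ρ - ⟨hρ, hρ'⟩
    refine ⟨hρ, fun φ => ?_⟩
    rw [Memory.setNum_elt, hρ' φ, ← hN, hν, hν2, hI.2 φ, and_assoc]
    refine and_congr_right fun _ => ⟨?_, fun h => ⟨fun r' hr' => h r' (by omega), h r (by omega)⟩⟩
    rintro ⟨h1, h2⟩ r' hr'
    rcases (Nat.lt_succ_iff.1 hr').lt_or_eq with hr' | rfl
    exacts [h1 r' hr', h2]
  · rintro υ - ⟨-, h1, h2⟩
    refine ⟨h1, fun φ => ?_⟩
    rw [← hN, h2 φ, C.forall_stateVector_succ_iff hi φ, hP.2 φ]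
    -- That `φ` vanishes on the images of the rows means that its composition with the transition
    -- map annihilates the old system, to which the hypothesis applies again.
    exact and_congr_right fun _ => hP.2 (φ.comp (C.transitionMap i))

/-- The functional `fullEntrySum` maps a state vector to the coefficient of its monomial in the
circuit, so it annihilates the rows iff all multilinear coefficients vanish. -/
theorem runs_testRows (h : C.IsEliminating L σ) (h1 : σ.num 1 0 = 0)
    (hP : C.IsSystem n (Memory.rows (s * 2 ^ k) (σ.elt 2))) :
    Runs unitSize L 0 .testRows ((s * 2 ^ k + 1) * (s + 1)) σ fun τ =>
      (HasMultilinearMonomial k C.poly → τ.num 1 0 = 1) ∧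
        (¬ HasMultilinearMonomial k C.poly → τ.num 1 0 = 0) := by
  set N := s * 2 ^ k with hN
  set P := Memory.rows N (σ.elt 2) with hPdef
  set φ := fullEntrySum F k s
  have hw : IsTameSize (unitSize : F → ℕ) := isTameSize_unitSize
  have hX : 1 ≤ s + 1 := by omega
  refine (Runs.forLoop (m := N) (X := s + 1) (I := fun r τ =>
    (τ.num 1 0 = 1 ∧ ¬ Annihilates φ r P) ∨ (τ.num 1 0 = 0 ∧ Annihilates φ r P))
    hw hX h.numEntries_lt (by simp [Program.numWrites, Program.forLoop])
    (by simp [Program.numWrites, Program.forLoop]) h.numEntries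
    (Or.inr ⟨by simpa using h1, fun r hr => absurd hr (Nat.not_lt_zero r)⟩) ?_).mono le_rfl ?_
  · intro r hr τ hA hτr hI
    have hA' : Memory.AgreeOff [1, 12, 13] [5] σ τ := hA.mono
      (by simp [Program.numWrites, Program.forLoop]) (by simp [Program.eltWrites, Program.forLoop])
    have hE := h.of_agreeOff (hA'.mono (by simp) (by simp))
    refine runs_unitSize_setElt_seq hX ?_
    have hυ : Memory.AgreeOff [] [5] τ (τ.setElt 5 ((NumExpr.lit 0).eval τ)
        (EltExpr.zero.eval τ)) := Memory.AgreeOff.refl.setElt (by simp)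
    have hυ0 : (τ.setElt 5 ((NumExpr.lit 0).eval τ) (EltExpr.zero.eval τ)).elt 5 0 = 0 := by
      simp [NumExpr.eval, EltExpr.eval]
    generalize τ.setElt 5 ((NumExpr.lit 0).eval τ) (EltExpr.zero.eval τ) = υ at hυ hυ0
    have hEυ := hE.of_agreeOff (hυ.mono (by simp) (by simp))
    refine Runs.seq (Q := fun ν => ν.elt 5 0 = φ (P r)) ?_ fun ν hAν hν => ?_
    · refine (Runs.forLoop (m := s) (X := 1) (I := fun t ν =>
        ν.elt 5 0 = ∑ t ∈ Finset.range t, P r (t * 2 ^ k + 2 ^ k - 1)) hw le_rfl h.fanIn_lt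
        (by simp [Program.numWrites]) (by simp [Program.numWrites]) hEυ.fanIn (by simp [hυ0])
        ?_).mono (by omega) ?_
      · intro t ht ν hAν hνt hJ
        have hAν' : Memory.AgreeOff [13] [5] υ ν := hAν.mono
          (by simp [Program.numWrites]) (by simp [Program.eltWrites])
        have hEν := hEυ.of_agreeOff (hAν'.mono (by simp) (by simp))
        have hνr : ν.num 12 0 = r := by
          rw [hAν'.num 12 (by simp), hυ.num 12 (by simp), hτr]
        have hν2 : ν.elt 2 = σ.elt 2 := by
          rw [hAν'.elt 2 (by simp), hυ.elt 2 (by simp), hA'.elt 2 (by simp)]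
        have hlt : t * 2 ^ k + 2 ^ k - 1 < N := by
          have : (t + 1) * 2 ^ k ≤ s * 2 ^ k := by gcongr; omega
          have := Nat.one_le_two_pow (n := k)
          rw [add_mul, one_mul] at *
          omega
        refine runs_unitSize_setElt le_rfl ?_
        simp [NumExpr.eval, EltExpr.eval, NumExpr.entryIndex, hνt, hνr, hν2, hEν.degree,
          hEν.numEntries, hEν.twoPow k le_rfl, hJ, Finset.sum_range_succ, hPdef, Memory.rows,
          truncate, hlt, ← hN]
      · rintro ν - ⟨-, h⟩
        rw [h, fullEntrySum_apply]
    · have hν1 : ν.num 1 0 = τ.num 1 0 := by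
        rw [hAν.num 1 (by simp [Program.numWrites, Program.forLoop]), hυ.num 1 (by simp)]
      have hann : Annihilates φ (r + 1) P ↔ Annihilates φ r P ∧ φ (P r) = 0 := by
        refine ⟨fun h => ⟨fun r' hr' => h r' (by omega), h r (by omega)⟩, ?_⟩
        rintro ⟨h1, h2⟩ r' hr'
        rcases (Nat.lt_succ_iff.1 hr').lt_or_eq with hr' | rfl
        exacts [h1 r' hr', h2]
      refine Runs.branch hw hX (fun hb => Runs.skip hX ?_) (fun hb => Runs.setNum hX ?_ ?_)
      · have hb : φ (P r) = 0 := by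
          rw [← hν]
          simpa [Test.holds, EltExpr.eval, NumExpr.eval] using hb
        simpa [hν1, hann, hb] using hI
      -- Writing the answer 1 needs at least one bit, which is available because a row exists and `N
      -- < 2 ^ L`.
      · have : L ≠ 0 := by
          rintro rfl
          have := h.numEntries_lt
          omega
        simpa [NumExpr.eval] using this
      · have hb : φ (P r) ≠ 0 := by
          rw [← hν]
          simpa [Test.holds, EltExpr.eval, NumExpr.eval] using hb
        exact Or.inl ⟨by simp [NumExpr.eval], fun h => hb (hann.1 h).2⟩
  · rintro τ - ⟨-, hτ⟩
    have hiff : Annihilates φ N P ↔ ¬ HasMultilinearMonomial k C.poly := by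
      rw [hN, hP.2 φ, C.hasMultilinearMonomial_iff]
      simp [φ, C.fullEntrySum_stateVector]
    rcases hτ with ⟨h1, h2⟩ | ⟨h1, h2⟩
    · exact ⟨fun _ => h1, fun h => absurd (hiff.2 h) h2⟩
    · exact ⟨fun h => absurd h (hiff.1 h2), fun _ => h1⟩

end DepthThreeCircuit.IsEliminating

/-- Before any variable is treated, only the empty set counts: row 0 is its state vector and the
other rows are zero. -/
theorem DepthThreeCircuit.isSystem_zero {f : ℕ → F}
    (hf : ∀ x < s * 2 ^ k * (s * 2 ^ k), f x = if x / 2 ^ k < s ∧ x % 2 ^ k = 0 then 1 else 0) :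
    C.IsSystem 0 (Memory.rows (s * 2 ^ k) f) := by
  set N := s * 2 ^ k with hN
  have hrow : ∀ r < N, Memory.rows N f r = if r = 0 then C.stateVector ∅ else 0 := by
    intro r hr
    funext x
    have hdiv : ∀ y, y / 2 ^ k < s ↔ y < N := fun y => Nat.div_lt_iff_lt_mul (by positivity)
    rcases eq_or_ne r 0 with rfl | h0
    · simp only [Memory.rows, truncate, zero_mul, zero_add, if_true, C.stateVector_empty, hdiv]
      split_ifs with h h' h'
      · rw [hf x (by nlinarith), if_pos (by rwa [hdiv])]
      · rw [hf x (by nlinarith), if_neg (by rwa [hdiv])]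
      · exact absurd h'.1 h
      · rfl
    · simp only [Memory.rows, truncate, if_neg h0, Pi.zero_apply]
      split_ifs with h
      · rw [hf _ (by nlinarith), if_neg]
        rw [hdiv]
        rintro ⟨h1, -⟩
        have : N ≤ r * N := Nat.le_mul_of_pos_left _ (Nat.pos_of_ne_zero h0)
        omega
      · rfl
  refine ⟨fun r hr => ?_, fun φ => ?_⟩
  · rw [hrow r hr]
    split_ifs with h0
    · subst h0
      have hs : 0 < s := Nat.pos_of_ne_zero fun h => by simp [h] at hr
      simp [C.stateVector_empty, hs]
    · simp
  · constructor
    · intro h S hS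
      have hS : S = ∅ := by simpa using hS
      subst hS
      -- For `N = 0` there is no row 0, but then `s = 0` and the state vector itself is zero.
      rcases Nat.eq_zero_or_pos N with h0 | h0
      · have : C.stateVector ∅ = 0 := by
          have hs : s = 0 := by simpa [hN] using h0
          funext x
          simp [C.stateVector_empty, hs]
        rw [this, map_zero]
      · have := h 0 h0
        rwa [hrow 0 h0, if_pos rfl] at this
    · intro h r hr
      rw [hrow r hr]
      split_ifs
      · exact h ∅ (by simp)
      · exact map_zero φ

theorem DepthThreeCircuit.runs_detectField (C : DepthThreeCircuit F n k s) :
    Runs unitSize (addressBits n k s) 0 .detectField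
      (2 * ((s + 1) * ((n + 1) * ((s * 2 ^ k + 1) * ((s * 2 ^ k + 1) * (s * 2 ^ k + k + 1))))))
      C.inputMemory fun τ => (HasMultilinearMonomial k C.poly → τ.num 1 0 = 1) ∧
        (¬ HasMultilinearMonomial k C.poly → τ.num 1 0 = 0) := by
  have hw : IsTameSize (unitSize : F → ℕ) := isTameSize_unitSize
  set N := s * 2 ^ k with hN
  set Y := (N + 1) * ((N + 1) * (N + k + 1)) with hY
  have hYk : N + k + 1 ≤ Y := by
    rw [hY, ← mul_assoc]
    -- This and the following comparisons bound every phase of the program by the common count `2 *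
    -- X`.
    exact Nat.le_mul_of_pos_left _ (by positivity)
  have hYN : N + 1 ≤ Y := Nat.le_mul_of_pos_right _ (by positivity)
  have hnY : Y ≤ (n + 1) * Y := Nat.le_mul_of_pos_left _ (by omega)
  have hsY : (s + 1) * (N + 1) ≤ (s + 1) * ((n + 1) * Y) := by gcongr; omega
  have hsY' : (n + 1) * Y ≤ (s + 1) * ((n + 1) * Y) := Nat.le_mul_of_pos_left _ (by omega)
  set X := (s + 1) * ((n + 1) * Y) with hX
  have hNlt : N < 2 ^ (s + k) := by
    rw [pow_add]
    exact Nat.mul_lt_mul_of_pos_right Nat.lt_two_pow_self (by positivity)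
  have hNN : N * N < 2 ^ addressBits n k s := by
    calc N * N < 2 ^ (s + k) * 2 ^ (s + k) := Nat.mul_lt_mul'' hNlt hNlt
      _ = 2 ^ (2 * (s + k)) := by ring
      _ ≤ _ := Nat.pow_le_pow_right (by simp) (by simp only [addressBits]; omega)
  have hNL : N < 2 ^ addressBits n k s :=
    hNlt.trans_le (Nat.pow_le_pow_right (by simp) (by simp only [addressBits]; omega))
  refine Runs.seq ((C.runs_prepare hw (lt_two_pow_addressBits (by omega))
    (lt_two_pow_addressBits (by omega)) (by simp only [addressBits]; omega)).mono (by omega)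
    fun _ _ h => h) fun τ _ hτ => ?_
  refine Runs.setNum_seq (by omega) ?_ (Runs.setNum_seq (by omega) ?_ ?_)
  · simpa [NumExpr.eval, hτ.degree, hτ.fanIn, hτ.twoPow k] using hNL
  · simpa [NumExpr.eval, hτ.degree, hτ.fanIn, hτ.twoPow k] using hNN
  simp only [NumExpr.eval, hτ.degree, hτ.fanIn, hτ.twoPow k (by omega), Memory.setNum_num,
    and_self, if_true, ← hN]
  have hE : C.IsEliminating (addressBits n k s) ((τ.setNum 8 0 N).setNum 9 0 (N * N)) :=
    { numVars := by simp [hτ.numVars]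
      degree := by simp [hτ.degree]
      fanIn := by simp [hτ.fanIn]
      twoPow := fun j hj => by simpa using hτ.twoPow j (by omega)
      numEntries := by simp [hN]
      numCells := by simp [hN]
      elt := by simp [hτ.elt]
      numVars_lt := lt_two_pow_addressBits (by omega)
      degree_lt := lt_two_pow_addressBits (by omega)
      fanIn_lt := lt_two_pow_addressBits (by omega)
      numEntries_lt := hNL
      numCells_lt := hNN }
  have h2 : ∀ x, ((τ.setNum 8 0 N).setNum 9 0 (N * N)).elt 2 x = 0 := fun x => by
    simp [hτ.elt, DepthThreeCircuit.inputMemory]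
  have h1 : ((τ.setNum 8 0 N).setNum 9 0 (N * N)).num 1 0 = 0 := by simp [hτ.answer]
  generalize (τ.setNum 8 0 N).setNum 9 0 (N * N) = σ at hE h2 h1
  have hinit : Runs unitSize (addressBits n k s) 0
      (.forLoop 13 4 (.setElt 2 (.mul (.var 13) (.read 5 (.var 3))) .one)) (2 * X) σ fun υ =>
      C.IsSystem 0 (Memory.rows N (υ.elt 2)) := by
    refine (Runs.forLoop (m := s) (X := 1) (I := fun t υ => ∀ x, υ.elt 2 x =
      if x / 2 ^ k < t ∧ x % 2 ^ k = 0 then 1 else 0) hw le_rfl hE.fanIn_lt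
      (by simp [Program.numWrites]) (by simp [Program.numWrites]) hE.fanIn (by simpa using h2)
      ?_).mono (by nlinarith) fun υ _ hυ => C.isSystem_zero fun x _ => hυ.2 x
    intro t ht υ hA hυt hI
    have hEυ := hE.of_agreeOff (hA.mono (by simp [Program.numWrites]) (by simp [Program.eltWrites]))
    refine runs_unitSize_setElt le_rfl fun x => ?_
    have hx : x = t * 2 ^ k ↔ x / 2 ^ k = t ∧ x % 2 ^ k = 0 := by
      have := Nat.div_add_mod x (2 ^ k)
      constructor
      · rintro rfl
        simp
      · rintro ⟨h1, h2⟩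
        rw [h1, h2] at this
        rw [← this]
        ring
    simp only [NumExpr.eval, EltExpr.eval, Memory.setNum_elt, Memory.setElt_elt, hυt, hEυ.degree,
      hEυ.twoPow k le_rfl, true_and, hI x, hx]
    by_cases h0 : x % 2 ^ k = 0
    · by_cases h1 : x / 2 ^ k = t
      · simp [h0, h1]
      · simp only [h0, h1, and_true, if_false]
        congr 1
        apply propext
        omega
    · simp [h0]
  refine hinit.seq fun υ hA hυ => ?_
  have hA' : Memory.AgreeOff [13] [2] σ υ := hA.mono
    (by simp [Program.numWrites, Program.forLoop]) (by simp [Program.eltWrites, Program.forLoop])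
  have hEυ := hE.of_agreeOff (hA'.mono (by simp) (by simp))
  have hwr : Program.extendSystem.numWrites ⊆ [11, 12, 13, 14, 15] := by
    simp [Program.numWrites, Program.forLoop, Program.applyTransition, Program.applyForm,
      Program.insertVector, Program.storeVector, Program.reduceVector, Program.extendSystem]
  have hwr' : Program.extendSystem.eltWrites ⊆ [2, 3, 4, 5] := by
    simp [Program.eltWrites, Program.forLoop, Program.applyTransition, Program.applyForm,
      Program.insertVector, Program.storeVector, Program.reduceVector, Program.extendSystem]
  have hloop : Runs unitSize (addressBits n k s) 0 (.forLoop 10 2 .extendSystem) (2 * X) υ fun ν =>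
      C.IsSystem n (Memory.rows N (ν.elt 2)) := by
    refine (Runs.forLoop (m := n) (X := Y) (I := fun i ν =>
      C.IsSystem i (Memory.rows N (ν.elt 2))) hw (by omega) hE.numVars_lt (fun h => by
      rcases List.mem_cons.1 h with h | h
      · simp at h
      · simpa using hwr h) (fun h => by simpa using hwr h) hEυ.numVars (by simpa using hυ) ?_).mono
      (by omega) fun ν _ hν => hν.2
    intro i hi ν hAν hνi hI
    have hEν := hEυ.of_agreeOff ((hAν.mono (List.cons_subset_cons _ hwr) hwr').mono
      (by simp) (by simp))
    exact (hEν.runs_extendSystem hi hνi hI).mono le_rfl fun ρ _ hρ => by simpa using hρ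
  refine hloop.seq fun ν hAν hν => ?_
  have hAν' : Memory.AgreeOff [10, 11, 12, 13, 14, 15] [2, 3, 4, 5] υ ν :=
    hAν.mono (by simpa [Program.numWrites, Program.forLoop] using
      List.subset_cons_of_subset _ hwr)
      (by simpa [Program.eltWrites, Program.forLoop] using hwr')
  refine ((hEυ.of_agreeOff (hAν'.mono (by simp) (by simp))).runs_testRows ?_ hν).mono ?_
    fun _ _ h => h
  · rw [hAν'.num 1 (by simp), hA'.num 1 (by simp), h1]
  · rw [← hN, mul_comm]
    omega

/-- The three factors of order `N = s * 2 ^ k` in the number of rounds produce `8 ^ k`; the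
remaining factors are polynomial in the input size. -/
theorem DepthThreeCircuit.decidesMMD_detectField (C : DepthThreeCircuit F n k s) :
    DecidesMMD unitSize .detectField C
      ((Program.detectField.weight * 4 : ℕ) * 8 ^ k * ((n + k + s : ℝ) + 1) ^ 6) := by
  obtain ⟨τ, t, he, ht, -, hτ⟩ := C.runs_detectField
    (C.bounded_inputMemory (lt_two_pow_addressBits (by omega)) (lt_two_pow_addressBits (by omega))
      (lt_two_pow_addressBits (by omega)) le_rfl fun _ _ _ => le_rfl)
  refine ⟨τ, t, he, ?_, hτ⟩
  set I := n + k + s with hI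
  have h1 : 1 ≤ 2 ^ k := Nat.one_le_two_pow
  have hN : s * 2 ^ k + k + 1 ≤ 2 ^ k * (I + 1) := by nlinarith
  have hN' : s * 2 ^ k + 1 ≤ 2 ^ k * (I + 1) := by omega
  have hU : addressBits n k s + 0 + 1 ≤ 2 * (I + 1) := by
    simp only [addressBits]
    omega
  have h8 : 8 ^ k = 2 ^ k * (2 ^ k * 2 ^ k) := by
    rw [← mul_pow, ← mul_pow]
    norm_num
  have key : t ≤ Program.detectField.weight * 4 * 8 ^ k * (I + 1) ^ 6 := by
    calc t ≤ _ := ht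
      _ ≤ Program.detectField.weight * (2 * ((I + 1) * ((I + 1) * ((2 ^ k * (I + 1)) *
          ((2 ^ k * (I + 1)) * (2 ^ k * (I + 1))))))) * (2 * (I + 1)) := by
        gcongr <;> omega
      _ = _ := by rw [h8]; ring
  rw [show ((n : ℝ) + k + s) = (I : ℝ) by rw [hI]; push_cast; ring]
  exact_mod_cast key

end Detection

theorem DecidesMMD.mono {R : Type*} [CommRing R] {n k s : ℕ} {w : R → ℕ} {P : Program}
    {C : DepthThreeCircuit R n k s} {T T' : ℝ} (h : DecidesMMD w P C T) (hT : T ≤ T') :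
    DecidesMMD w P C T' := by
  obtain ⟨τ, t, he, ht, hτ⟩ := h
  exact ⟨τ, t, he, ht.trans hT, hτ⟩

theorem theorem3 :
    -- counting: one program for all fields (unit cost) and for `ℤ`, `ℚ` (bit cost), time `O*(2^k)`
    (∃ (P : Program) (A d : ℕ),
      (∀ (F : Type*) [Field F] (n k s : ℕ) (C : DepthThreeCircuit F n k s),
        ComputesMLC unitSize P C (A * 2 ^ k * ((n + k + s : ℝ) + 1) ^ d)) ∧
      (∀ (n k s : ℕ) (C : DepthThreeCircuit ℤ n k s),
        ComputesMLC intSize P C (A * 2 ^ k * ((C.inputSize intSize : ℝ) + 1) ^ d)) ∧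
      (∀ (n k s : ℕ) (C : DepthThreeCircuit ℚ n k s),
        ComputesMLC ratSize P C (A * 2 ^ k * ((C.inputSize ratSize : ℝ) + 1) ^ d))) ∧
    -- detection over `ℤ` (bit cost), time `O*(4^k)`
    (∃ (P : Program) (A d : ℕ), ∀ (n k s : ℕ) (C : DepthThreeCircuit ℤ n k s),
        DecidesMMD intSize P C (A * 4 ^ k * ((C.inputSize intSize : ℝ) + 1) ^ d)) ∧
    -- detection over finite fields (unit cost for field operations)
    (∃ (P : Program) (c : ℝ), c ≤ 5 ∧ ∃ (A B d : ℕ),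
      ∀ (F : Type*) [Field F] [Finite F] (n k s : ℕ) (C : DepthThreeCircuit F n k s),
        DecidesMMD unitSize P C
          (Real.exp k * (k : ℝ) ^ ((B : ℝ) * Real.log k) *
            ((2 : ℝ) ^ (c * (k : ℝ)) + (2 : ℝ) ^ (k : ℝ)) *
            (A * ((n + k + s : ℝ) + 1) ^ d))) := by
  refine ⟨⟨.count, Program.count.weight * 56, 5, fun F _ n k s C => ?_, fun n k s C => ?_,
    fun n k s C => ?_⟩, ⟨.detectInt, Program.detectInt.weight * 60, 8, fun n k s C =>
      C.decidesMMD_detectInt⟩, ⟨.detectField, 3, by norm_num, Program.detectField.weight * 4, 0, 6,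
      fun F _ _ n k s C => C.decidesMMD_detectField.mono ?_⟩⟩
  -- Under unit cost all sizes are 0, so the size conditions are trivial; `d = 2` is chosen to match
  -- the exponent 5 of the other two cases.
  · have := C.computesMLC_count (W := 0) (I := n + k + s) (d := 2) isTameSize_unitSize le_rfl le_rfl
      (fun _ _ _ => le_rfl) (fun _ _ _ _ _ _ _ _ => le_rfl) (fun _ _ => le_rfl) le_rfl
      (Nat.zero_le _) two_ne_zero
    push_cast at this ⊢
    exact this
  · refine C.computesMLC_count_of_rat isTameSize_intSize (φ := Int.castRingHom ℚ) (fun x => ?_)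
      fun x => ?_
    · simp only [eq_intCast, ratSize_intCast]
      simp only [intSize]
      omega
    · simp [ratSize_intCast]
  · exact C.computesMLC_count_of_rat isTameSize_ratSize (φ := RingHom.id ℚ)
      (fun x => by simp only [RingHom.id_apply]; omega) fun x => le_rfl
  -- With `c = 3` the term `2 ^ (c * k)` is exactly `8 ^ k`. For `B = 0` the quasi-polynomial factor
  -- is 1, also at `k = 0`; `e ^ k ≥ 1` and the summand `2 ^ k ≥ 0` are given away.
  · have h8 : (2 : ℝ) ^ ((3 : ℝ) * k) = 8 ^ k := by
      rw [Real.rpow_mul (by norm_num), Real.rpow_natCast]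
      norm_num
    have he : (1 : ℝ) ≤ Real.exp k := Real.one_le_exp (Nat.cast_nonneg k)
    have h2 : (0 : ℝ) ≤ 2 ^ (k : ℝ) := by positivity
    rw [h8]
    simp only [Nat.cast_zero, zero_mul, Real.rpow_zero, mul_one]
    calc _ = 1 * ((8 : ℝ) ^ k + 0) * ((Program.detectField.weight * 4 : ℕ) *
          ((n + k + s : ℝ) + 1) ^ 6) := by ring
      _ ≤ _ := by gcongr
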